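/- **Theorem 3.5 (multiscale Bakry–Émery criterion).** Let $t\in[0,\infty)\mapsto \dot C_t$ be a bounded function with values in the positive semidefinite real $N\times N$ matrices, integrable on $[0,\infty)$, right-continuous at $t=0$ and differentiable at every $t>0$ with derivative $\ddot C_t$. Set $$C_t=\int_0^t\dot C_s\,ds,\qquad C_\infty=\int_0^\infty \dot C_s\,ds,$$ and let $X\subset\mathbb R^N$ be the image of $C_\infty$, with the inherited scalar product. For a positive semidefinite $C$ let $\mathsf P_C$, $\mathsf E_C$ denote the centred Gaussian measure with covariance $C$ and its expectation (acting on the variable $\zeta$), and write $(u)_C^2=\sum_{i,j}C_{ij}u_iu_j$. Let $V_0:X\to\mathbb R$ be continuous and bounded below, and let $\nu_0$ be the probability measure on $X$ with $\mathbb E_{\nu_0}[F]\propto \mathsf E_{C_\infty}[e^{-V_0(\zeta)}F(\zeta)]$. For $0\le t\le\infty$ define the renormalised potential $V_t(\varphi)=-\log\mathsf E_{C_t}[e^{-V_0(\varphi+\zeta)}]$, $\varphi\in X$; and for $0\le s\le t<\infty$ define $$\boldsymbol P_{s,t}F(\varphi)=e^{V_t(\varphi)}\,\mathsf E_{C_t-C_s}\big[e^{-V_s(\varphi+\zeta)}F(\varphi+\zeta)\big],\qquad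 \mathbb E_{\nu_t}[F]=e^{V_\infty(0)}\,\mathsf E_{C_\infty-C_t}\big[e^{-V_t(\zeta)}F(\zeta)\big].$$ Assume that for all bounded smooth functions $F:X\to\mathbb R$ and $g:\mathbb R\to\mathbb R$, $$\lim_{t\to\infty}\mathbb E_{\nu_t}\big[g(\boldsymbol P_{0,t}F)\big]=g\big(\mathbb E_{\nu_0}[F]\big).$$ Suppose that there are real numbers $\dot\lambda_t$, possibly negative, integrable in $t$ over every interval $[0,T]$, such that, as quadratic forms, $$\forall \varphi\in X,\ t>0:\qquad \dot C_t\,\mathrm{Hess}\,V_t(\varphi)\,\dot C_t-\tfrac12\ddot C_t\ \ge\ \dot\lambda_t\,\dot C_t,$$ where $(\dot C_tu,\mathrm{Hess}\,V_t(\varphi)\,\dot C_tu)$ is the second derivative of $V_t$ at $\varphi$ along $\dot C_tu\in X$. Put $$\lambda_t=\int_0^t\dot\lambda_s\,ds,\qquad \frac1\gamma=\int_0^\infty e^{-2\lambda_t}\,dt,$$ and assume that the last integral is finite. Then $\gamma>0$ and $\nu_0$ satisfies the log-Sobolev inequality $$\mathrm{Ent}_{\nu_0}(F)\ \le\ \frac2\gamma\,\mathbb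 E_{\nu_0}\big[(\nabla\sqrt F)^2_{\dot C_0}\big]\qquad\text{for all smooth, compactly supported } F:X\to[0,\infty),$$ where $\mathrm{Ent}_{\nu}(F)=\mathbb E_{\nu}[\Phi(F)]-\Phi(\mathbb E_{\nu}[F])$ with $\Phi(x)=x\log x$, and $\nabla\sqrt F:=0$ at points where $\sqrt F$ is not differentiable (these are zeros of $F$). -/

import Mathlib

open MeasureTheory ProbabilityTheory Filter Topology Set
open scoped ContDiff

noncomputable section

namespace Polchinski

/-- `ℝ^N` with the standard scalar product. -/
abbrev Vec (N : ℕ) : Type := EuclideanSpace ℝ (Fin N)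

/-- Real `N × N` matrices. -/
abbrev Mat (N : ℕ) : Type := Matrix (Fin N) (Fin N) ℝ

/-- `(u)_C^2 = ∑_{i,j} C_{ij} u_i u_j`. -/
def quadForm {N : ℕ} (C : Mat N) (u : Vec N) : ℝ :=
  ∑ i, ∑ j, C i j * u i * u j

/-! ### Covariance decompositions -/

/-- `C_t = ∫_0^t Ċ_s ds`, entry by entry. -/
def cov {N : ℕ} (dC : ℝ → Mat N) (t : ℝ) : Mat N :=
  Matrix.of fun i j => ∫ s in (0 : ℝ)..t, dC s i j

/-- `C_∞ = ∫_0^∞ Ċ_s ds`, entry by entry. -/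
def covInf {N : ℕ} (dC : ℝ → Mat N) : Mat N :=
  Matrix.of fun i j => ∫ s in Ioi (0 : ℝ), dC s i j

/-- `C̈_t`, the derivative of `t ↦ Ċ_t`, entry by entry. -/
def ddot {N : ℕ} (dC : ℝ → Mat N) (t : ℝ) : Mat N :=
  Matrix.of fun i j => deriv (fun s => dC s i j) t

/-- `C_∞ = ∫_0^∞ Ċ_s ds` is a covariance decomposition whose density `t ↦ Ċ_t` is differentiable
at every `t > 0` and right-continuous at `0`. Only the times `t ≥ 0` matter. Differentiability
makes `Ċ` continuous, so that it is in particular càdlàg and the derivative of `C_t`. -/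
structure IsDifferentiableCovDecomposition {N : ℕ} (dC : ℝ → Mat N) : Prop where
  posSemidef : ∀ t, 0 ≤ t → (dC t).PosSemidef
  bounded : ∃ K : ℝ, ∀ t, 0 ≤ t → ∀ i j, |dC t i j| ≤ K
  integrable : ∀ i j, IntegrableOn (fun t => dC t i j) (Ioi 0)
  right_continuous_zero : ∀ i j, ContinuousWithinAt (fun t => dC t i j) (Ici 0) 0
  differentiable : ∀ t, 0 < t → ∀ i j, DifferentiableAt ℝ (fun s => dC s i j) t

/-- The space `X ⊆ ℝ^N`, the image of `C_∞`, with the inherited scalar product. -/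
abbrev fieldSpace {N : ℕ} (dC : ℝ → Mat N) : Submodule ℝ (Vec N) :=
  LinearMap.range (Matrix.toEuclideanLin (covInf dC))

/-! ### Gaussian measures and the Polchinski flow -/

section Flow

variable {N : ℕ} (dC : ℝ → Mat N)

/-- The orthogonal projection of `ℝ^N` onto `X`. It only serves to read vectors which lie in `X`
as elements of `X`. -/
def toX (v : Vec N) : fieldSpace dC := (fieldSpace dC).orthogonalProjectionOnto v

/-- The centred Gaussian measure `P_C` with covariance `C`, as a measure on `X`. For the matrices
`C` used below, whose image is contained in `X`, the Gaussian measure on `ℝ^N` is carried by `X`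
and the projection is almost surely the identity. -/
def gaussian (C : Mat N) : Measure (fieldSpace dC) :=
  (multivariateGaussian 0 C).map (toX dC)

/-- `-log E_C[exp (-V₀ (φ + ζ))]`. -/
def renormPotentialCov (V₀ : fieldSpace dC → ℝ) (C : Mat N) (φ : fieldSpace dC) : ℝ :=
  -Real.log (∫ ζ, Real.exp (-V₀ (φ + ζ)) ∂gaussian dC C)

/-- The renormalised potential `V_t`, for `0 ≤ t < ∞`. -/
def renormPotential (V₀ : fieldSpace dC → ℝ) (t : ℝ) : fieldSpace dC → ℝ :=
  renormPotentialCov dC V₀ (cov dC t)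

/-- The renormalised potential `V_∞`. -/
def renormPotentialInf (V₀ : fieldSpace dC → ℝ) : fieldSpace dC → ℝ :=
  renormPotentialCov dC V₀ (covInf dC)

/-- The Polchinski semigroup
`P_{s,t} F (φ) = exp (V_t φ) E_{C_t - C_s}[exp (-V_s (φ + ζ)) F (φ + ζ)]`. -/
def semigroup (V₀ : fieldSpace dC → ℝ) (s t : ℝ) (F : fieldSpace dC → ℝ)
    (φ : fieldSpace dC) : ℝ :=
  Real.exp (renormPotential dC V₀ t φ) *
    ∫ ζ, Real.exp (-renormPotential dC V₀ s (φ + ζ)) * F (φ + ζ) ∂gaussian dC (cov dC t - cov dC s)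

/-- The renormalised measure `ν_t`:
`E_{ν_t}[F] = exp (V_∞ 0) E_{C_∞ - C_t}[exp (-V_t ζ) F ζ]`. -/
def renormMeasure (V₀ : fieldSpace dC → ℝ) (t : ℝ) : Measure (fieldSpace dC) :=
  (gaussian dC (covInf dC - cov dC t)).withDensity fun ζ =>
    ENNReal.ofReal (Real.exp (renormPotentialInf dC V₀ 0) * Real.exp (-renormPotential dC V₀ t ζ))

/-- The probability measure `ν₀` with `E_{ν₀}[F] ∝ E_{C_∞}[exp (-V₀ ζ) F ζ]`. -/
def initialMeasure (V₀ : fieldSpace dC → ℝ) : Measure (fieldSpace dC) :=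
  (gaussian dC (covInf dC)).tilted fun ζ => -V₀ ζ

/-- The continuity assumption: `E_{ν_t}[g (P_{0,t} F)] → g (E_{ν₀}[F])` as `t → ∞`, for all
bounded smooth `F : X → ℝ` and `g : ℝ → ℝ`. -/
def ContinuityAssumption (V₀ : fieldSpace dC → ℝ) : Prop :=
  ∀ (F : fieldSpace dC → ℝ) (g : ℝ → ℝ),
    ContDiff ℝ ∞ F → (∃ K, ∀ φ, |F φ| ≤ K) → ContDiff ℝ ∞ g → (∃ K, ∀ x, |g x| ≤ K) →
    Tendsto (fun t => ∫ φ, g (semigroup dC V₀ 0 t F φ) ∂renormMeasure dC V₀ t) atTop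
      (𝓝 (g (∫ φ, F φ ∂initialMeasure dC V₀)))

end Flow

/-! ### The Hessian, the criterion and the log-Sobolev inequality -/

/-- The quadratic form `(w, Hess V(φ) w)` of the Hessian, computed as the second derivative of `V`
at `φ` along `w`. -/
def hessForm {E : Type*} [NormedAddCommGroup E] [NormedSpace ℝ E] (V : E → ℝ) (φ w : E) : ℝ :=
  iteratedDeriv 2 (fun r : ℝ => V (φ + r • w)) 0

/-- For `C²` functions, `hessForm` is the second Fréchet derivative on the diagonal. -/
theorem hessForm_eq {E : Type*} [NormedAddCommGroup E] [NormedSpace ℝ E] {V : E → ℝ}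
    (hV : ContDiff ℝ 2 V) (φ w : E) : hessForm V φ w = fderiv ℝ (fderiv ℝ V) φ w w := by
  have hline : ∀ r : ℝ, HasDerivAt (fun r : ℝ => φ + r • w) w r := fun r => by
    simpa using ((hasDerivAt_id r).smul_const w).const_add φ
  have h1 : deriv (fun r : ℝ => V (φ + r • w)) = fun r => fderiv ℝ V (φ + r • w) w := by
    funext r
    have hd : DifferentiableAt ℝ V (φ + r • w) := (hV.differentiable (by norm_num)) _
    exact (hd.hasFDerivAt.comp_hasDerivAt r (hline r)).deriv
  have hd2 : DifferentiableAt ℝ (fderiv ℝ V) (φ + (0 : ℝ) • w) :=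
    (hV.fderiv_right (m := 1) (by norm_num)).differentiable (by norm_num) _
  have h2 : HasDerivAt (fun r : ℝ => fderiv ℝ V (φ + r • w)) (fderiv ℝ (fderiv ℝ V) φ w) 0 := by
    have h := hd2.hasFDerivAt.comp_hasDerivAt (0 : ℝ) (hline 0)
    rw [zero_smul, add_zero] at h
    exact h
  have h3 := ((ContinuousLinearMap.apply ℝ ℝ w).hasFDerivAt).comp_hasDerivAt (0 : ℝ) h2
  rw [hessForm, iteratedDeriv_succ, iteratedDeriv_one, h1]
  exact h3.deriv

/-- The multiscale criterion `Ċ_t Hess V_t(φ) Ċ_t - C̈_t / 2 ≥ λ̇_t Ċ_t` for all `φ ∈ X`, `t > 0`,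
as an inequality of quadratic forms on `ℝ^N`. Note that `Ċ_t u ∈ X`. -/
def MultiscaleCriterion {N : ℕ} (dC : ℝ → Mat N) (V₀ : fieldSpace dC → ℝ) (dlam : ℝ → ℝ) : Prop :=
  ∀ t, 0 < t → ∀ (φ : fieldSpace dC) (u : Vec N),
    dlam t * quadForm (dC t) u ≤
      hessForm (renormPotential dC V₀ t) φ (toX dC (Matrix.toEuclideanLin (dC t) u)) -
        1 / 2 * quadForm (ddot dC t) u

/-- `Ent_ν(F) = E_ν[Φ(F)] - Φ(E_ν[F])` with `Φ(x) = x log x`. -/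
def entropy {α : Type*} [MeasurableSpace α] (ν : Measure α) (F : α → ℝ) : ℝ :=
  (∫ x, F x * Real.log (F x) ∂ν) - (∫ x, F x ∂ν) * Real.log (∫ x, F x ∂ν)

/-- The log-Sobolev inequality `Ent_ν(F) ≤ (2/γ) E_ν[(∇√F)²_Q]` for all smooth compactly supported
`F : X → [0, ∞)`, on a linear subspace `X` of `ℝ^N`. Where `√F` is not differentiable, which for
such `F` occurs only at zeros of `F`, Mathlib's gradient is `0`, in agreement with the weak
gradient. -/
def LogSobolev {N : ℕ} {X : Submodule ℝ (Vec N)} (ν : Measure X) (Q : Mat N) (γ : ℝ) : Prop :=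
  0 < γ ∧ ∀ F : X → ℝ, ContDiff ℝ ∞ F → HasCompactSupport F → (∀ φ, 0 ≤ F φ) →
    entropy ν F ≤
      2 / γ * ∫ φ, quadForm Q ((gradient (fun ψ => Real.sqrt (F ψ)) φ : X) : Vec N) ∂ν

end Polchinski

end

set_option linter.unusedSectionVars false
set_option autoImplicit false
set_option maxSynthPendingDepth 3

noncomputable section

namespace Polchinski

/-! Write Z_t and G_t for the averages of e^{-V_0} and e^{-V_0}F over the Gaussian of covariance
C_t, w_t = log(G_t/Z_t) = log P_{0,t}F, and D_t for the Gaussian of covariance C_∞ - C_t. Up to the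
normalisation of ν_0, the quantity to follow is S(t) = ∫ G_t w_t dD_t: it starts at E_{ν_0}[Φ(F)]
and, by the continuity assumption, ends at Φ(E_{ν_0}[F]).

Z and G solve the heat equation ∂_t = ½Δ with Laplacian taken in Ċ_t, while D_t loses the covariance
that they gain. Hence the derivative of ∫ ψ_t dD_t is ∫ (∂_tψ_t - ½Δψ_t) dD_t
(`GaussianFlow.hasDerivAt_integral_D`). For ψ = Gw this gives S' = -½ I with I = ∫ G (∇w)²_{Ċ_t}
dD_t. A Bochner computation expresses I' as the integral of G times (∇w)²_{C̈_t} - 2 (Ċ_t∇w, Hess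
V_t Ċ_t∇w) minus a sum of squares of second derivatives of w. Dropping the squares, the criterion
yields I' ≤ -2 λ̇_t I (`HeatPair.exists_hasDerivAt_fisher`), and Grönwall makes S a convex function
of the clock Λ(t) = ∫_0^t e^{-2λ_s} ds. A convex function stays above its initial tangent, so the
total drop of S is at most Λ(∞) = 1/γ times the initial slope ∫ e^{-V_0} (∇F)²_{Ċ_0}/(2F). Since
(∇F)² = 4F (∇√F)², this is the claim (`entropy_sub_le_of_convex`, `entropy_le_of_pos`).

Four points need care. First, V_0 is only continuous, so Z and G are smooth only if C_t is
nondegenerate on X for t > 0. This follows from the criterion itself (`posOn_cov`): V_t is bounded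
above near the origin and below everywhere, so a uniform lower bound on its second derivative along
Ċ_t u cannot be large, which gives C̈_t ≤ (B - 2λ̇_t) Ċ_t; a direction lost at one time is then lost
for ever, and is not in X.

Second, Z may decay arbitrarily fast, so quotients by Z are unbounded. Gaussian smoothing bounds
derivatives by every power Z^θ with θ < 1 (`Tame`), quotients are then bounded by every negative
power (`Mild`), and a tame function times a mild one is tame, hence bounded. This justifies every
exchange of derivative and integral.

Third, nothing is differentiated at t = 0. The initial slope is only bounded from above, by
expanding the Bregman divergence of x log x at small times (`GaussianFlow.entropy_slope`).

Fourth, F is first assumed bounded away from zero; the general case applies this to F + ε and lets ε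
tend to zero (`entropy_le`). -/

/-- `∑_{i,j} C_{ij} B(e_i, e_j)`. -/
def traceForm {N : ℕ} {E : Type*} [NormedAddCommGroup E] [NormedSpace ℝ E] (e : Fin N → E)
    (C : Mat N) (B : E →L[ℝ] E →L[ℝ] ℝ) : ℝ :=
  ∑ i, ∑ j, C i j * B (e i) (e j)

/-! ### Gaussian measures on X: convolution, moments, Cameron–Martin formula -/

section GaussianLayer

variable {N : ℕ} (dC : ℝ → Mat N)

/-- The projection `toX` as a continuous linear map. -/
def projX : Vec N →L[ℝ] fieldSpace dC := (fieldSpace dC).orthogonalProjectionOnto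

theorem projX_apply (v : Vec N) : projX dC v = toX dC v := rfl

theorem norm_toX_le (v : Vec N) : ‖toX dC v‖ ≤ ‖v‖ :=
  (fieldSpace dC).norm_orthogonalProjectionOnto_apply_le v

theorem inner_toX (v : Vec N) (a : fieldSpace dC) :
    inner ℝ (toX dC v) a = inner ℝ v (a : Vec N) :=
  Submodule.inner_orthogonalProjectionOnto_eq_of_mem_right a v

theorem gaussian_eq_map (C : Mat N) :
    gaussian dC C = (multivariateGaussian 0 C).map (projX dC) := rfl

instance isGaussian_gaussian (C : Mat N) : IsGaussian (gaussian dC C) := by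
  rw [gaussian_eq_map]; infer_instance

instance isProbabilityMeasure_gaussian (C : Mat N) : IsProbabilityMeasure (gaussian dC C) :=
  inferInstance

/-- The projections to `X` of the standard basis vectors. -/
def frame (i : Fin N) : fieldSpace dC := toX dC (EuclideanSpace.single i 1)

theorem toX_eq_sum (x : Vec N) : toX dC x = ∑ i, x i • frame dC i := by
  have hx : x = ∑ i, x i • EuclideanSpace.single i (1 : ℝ) := by
    ext j
    simp [Finset.sum_apply, Pi.single_apply]
  conv_lhs => rw [hx]
  rw [← projX_apply, map_sum]
  simp only [map_smul, projX_apply, frame]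

theorem inner_frame (i : Fin N) (a : fieldSpace dC) :
    inner ℝ (frame dC i) a = (a : Vec N) i := by
  rw [frame, inner_toX]
  simp [PiLp.inner_apply]

theorem integral_gaussian {W : Type*} [NormedAddCommGroup W] [NormedSpace ℝ W] (C : Mat N)
    {f : fieldSpace dC → W} (hf : AEStronglyMeasurable f (gaussian dC C)) :
    ∫ ζ, f ζ ∂gaussian dC C = ∫ x, f (toX dC x) ∂multivariateGaussian 0 C := by
  rw [gaussian_eq_map] at *
  rw [integral_map (projX dC).continuous.aemeasurable hf]
  rfl

/-- Characteristic functions multiply on ℝ^N, and the projection to X is linear, so it commutes with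
convolution. -/
theorem gaussian_add {C D : Mat N} (hC : C.PosSemidef) (hD : D.PosSemidef) :
    gaussian dC (C + D) = (gaussian dC C).conv (gaussian dC D) := by
  rw [gaussian_eq_map, gaussian_eq_map, gaussian_eq_map, ← Measure.map_conv_continuousLinearMap]
  congr 1
  apply Measure.ext_of_charFun
  ext t
  rw [charFun_conv, charFun_multivariateGaussian hC, charFun_multivariateGaussian hD,
    charFun_multivariateGaussian (hC.add hD), ← Complex.exp_add]
  congr 1
  simp only [inner_zero_right, Matrix.add_mulVec, dotProduct_add]
  push_cast
  ring

theorem integral_gaussian_linear (C : Mat N) {W : Type*} [NormedAddCommGroup W] [NormedSpace ℝ W]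
    [CompleteSpace W] (ℓ : fieldSpace dC →L[ℝ] W) : ∫ ζ, ℓ ζ ∂gaussian dC C = 0 := by
  rw [integral_gaussian dC C (by fun_prop)]
  have := (ℓ.comp (projX dC)).integral_comp_comm
    (μ := multivariateGaussian (0 : Vec N) C) IsGaussian.integrable_fun_id
  simp only [integral_id_multivariateGaussian, map_zero] at this
  exact this

theorem integral_mul_multivariateGaussian {C : Mat N} (hC : C.PosSemidef) (i j : Fin N) :
    ∫ x, x i * x j ∂multivariateGaussian (0 : Vec N) C = C i j := by
  have h := covariance_eval_multivariateGaussian (μ := (0 : Vec N)) hC i j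
  have hm : ∀ i : Fin N, ∫ x, x i ∂multivariateGaussian (0 : Vec N) C = 0 := fun i => by
    have := (EuclideanSpace.proj i : Vec N →L[ℝ] ℝ).integral_comp_comm
      (μ := multivariateGaussian (0 : Vec N) C) IsGaussian.integrable_fun_id
    simpa using this
  rw [← h, covariance]
  simp [hm]

theorem integrable_mul_multivariateGaussian (C : Mat N) (i j : Fin N) :
    Integrable (fun x : Vec N => x i * x j) (multivariateGaussian (0 : Vec N) C) := by
  have h : ∀ i : Fin N, MemLp (fun x : Vec N => x i) 2 (multivariateGaussian (0 : Vec N) C) :=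
    fun i => (EuclideanSpace.proj i : Vec N →L[ℝ] ℝ).comp_memLp'
      IsGaussian.memLp_two_id
  exact (h i).integrable_mul (h j)

theorem integral_gaussian_bilin {C : Mat N} (hC : C.PosSemidef)
    (B : fieldSpace dC →L[ℝ] fieldSpace dC →L[ℝ] ℝ) :
    ∫ ζ, B ζ ζ ∂gaussian dC C = traceForm (frame dC) C B := by
  rw [integral_gaussian dC C (by fun_prop)]
  have h : ∀ x : Vec N, B (toX dC x) (toX dC x) =
      ∑ i, ∑ j, (x i * x j) * B (frame dC i) (frame dC j) := fun x => by
    rw [toX_eq_sum]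
    simp only [map_sum, map_smul, sum_apply, smul_apply, smul_eq_mul, Finset.mul_sum]
    rw [Finset.sum_comm]
    exact Finset.sum_congr rfl fun i _ => Finset.sum_congr rfl fun j _ => by ring
  simp_rw [h]
  rw [integral_finsetSum]
  · refine Finset.sum_congr rfl fun i _ => ?_
    rw [integral_finsetSum]
    · refine Finset.sum_congr rfl fun j _ => ?_
      rw [integral_mul_const, integral_mul_multivariateGaussian hC]
    · exact fun j _ => (integrable_mul_multivariateGaussian C i j).mul_const _
  · exact fun i _ => integrable_finsetSum _ fun j _ =>
      (integrable_mul_multivariateGaussian C i j).mul_const _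

theorem integrable_norm_pow_gaussian (C : Mat N) (p : ℕ) :
    Integrable (fun ζ => ‖ζ‖ ^ p) (gaussian dC C) := by
  have h := (IsGaussian.memLp_id (gaussian dC C) p (by simp)).integrable_norm_pow'
  simpa using h

/-- The sum of the absolute values of the entries. -/
def entrySum (C : Mat N) : ℝ := ∑ i, ∑ j, |C i j|

theorem entrySum_nonneg (C : Mat N) : 0 ≤ entrySum C :=
  Finset.sum_nonneg fun _ _ => Finset.sum_nonneg fun _ _ => abs_nonneg _

theorem quadForm_eq_inner (C : Mat N) (u : Vec N) :
    quadForm C u = inner ℝ u (Matrix.toEuclideanLin C u) := by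
  simp only [quadForm, PiLp.inner_apply, Matrix.toLpLin_apply, Matrix.mulVec, dotProduct,
    RCLike.inner_apply, conj_trivial, Finset.sum_mul]
  exact Finset.sum_congr rfl fun i _ => Finset.sum_congr rfl fun j _ => by ring

theorem quadForm_le_entrySum (C : Mat N) (u : Vec N) : quadForm C u ≤ entrySum C * ‖u‖ ^ 2 := by
  rw [quadForm, entrySum, Finset.sum_mul]
  refine Finset.sum_le_sum fun i _ => ?_
  rw [Finset.sum_mul]
  refine Finset.sum_le_sum fun j _ => ?_
  have hi := PiLp.norm_apply_le u i
  have hj := PiLp.norm_apply_le u j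
  rw [Real.norm_eq_abs] at hi hj
  calc C i j * u i * u j ≤ |C i j * u i * u j| := le_abs_self _
    _ = |C i j| * (|u i| * |u j|) := by rw [abs_mul, abs_mul, mul_assoc]
    _ ≤ |C i j| * (‖u‖ * ‖u‖) := by gcongr
    _ = _ := by ring

open scoped MatrixOrder in
theorem norm_sqrt_apply_sq {C : Mat N} (hC : C.PosSemidef) (u : Vec N) :
    ‖Matrix.toEuclideanCLM (𝕜 := ℝ) (CFC.sqrt C) u‖ ^ 2 = quadForm C u := by
  have hs : IsSelfAdjoint (Matrix.toEuclideanCLM (𝕜 := ℝ) (n := Fin N) (CFC.sqrt C)) :=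
    (CFC.sqrt_nonneg C).isSelfAdjoint.map _
  rw [quadForm_eq_inner, ← real_inner_self_eq_norm_sq]
  conv_lhs => rw [← ContinuousLinearMap.adjoint_inner_right, hs.adjoint_eq,
    ← ContinuousLinearMap.comp_apply, ← ContinuousLinearMap.mul_def, ← map_mul,
      CFC.sqrt_mul_sqrt_self _ hC.nonneg]
  rfl

/-- The moments of the norm of a standard Gaussian vector. -/
def stdMoment (N p : ℕ) : ℝ := ∫ x, ‖x‖ ^ p ∂stdGaussian (Vec N)

theorem stdMoment_nonneg (N p : ℕ) : 0 ≤ stdMoment N p :=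
  integral_nonneg fun _ => by positivity

@[fun_prop]
theorem continuous_toX : Continuous (toX dC) := (projX dC).continuous

/-- A sample is √C applied to a standard Gaussian x, and ‖√C x‖² is the quadratic form of C at x.
The bound scales like |C|^{p/2}; applied to increments of C_t it produces the powers of √(t - s) in
the flow. -/
theorem integral_norm_pow_gaussian_le {C : Mat N} (hC : C.PosSemidef) (p : ℕ) :
    ∫ ζ, ‖ζ‖ ^ p ∂gaussian dC C ≤ Real.sqrt (entrySum C) ^ p * stdMoment N p := by
  rw [integral_gaussian dC C (by fun_prop), multivariateGaussian,
    integral_map (by fun_prop) (Continuous.aestronglyMeasurable (by fun_prop)),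
    stdMoment, ← integral_const_mul]
  refine integral_mono_of_nonneg (Eventually.of_forall fun _ => by positivity) ?_
    (Eventually.of_forall fun x => ?_)
  · have h := (IsGaussian.memLp_id (stdGaussian (Vec N)) p (by simp)).integrable_norm_pow'
    exact Integrable.const_mul (by simpa using h) _
  · simp only [zero_add]
    rw [← mul_pow]
    gcongr
    refine (norm_toX_le dC _).trans (abs_le_of_sq_le_sq' ?_ (by positivity)).2
    rw [norm_sqrt_apply_sq hC, mul_pow, Real.sq_sqrt (entrySum_nonneg C)]
    exact quadForm_le_entrySum C x

/-- The exponent is linear with complex coefficients b + it, so the integral factorises over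
coordinates into one-dimensional complex moment generating functions. Real exponent and
characteristic function are treated together because the tilted measure is identified through its
characteristic function. -/
theorem integral_cexp_stdGaussian (b t : Vec N) :
    ∫ x, Complex.exp ((inner ℝ b x : ℝ) + (inner ℝ x t : ℝ) * Complex.I) ∂stdGaussian (Vec N) =
      Complex.exp ((‖b‖ ^ 2 / 2 : ℝ) + (inner ℝ b t : ℝ) * Complex.I - (‖t‖ ^ 2 / 2 : ℝ)) := by
  rw [← map_pi_eq_stdGaussian, integral_map (by fun_prop) (by fun_prop)]
  have h : ∀ x : Fin N → ℝ, Complex.exp ((inner ℝ b (WithLp.toLp 2 x) : ℝ) +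
      (inner ℝ (WithLp.toLp 2 x) t : ℝ) * Complex.I) =
      ∏ i, Complex.exp (((b i : ℂ) + t i * Complex.I) * (x i : ℂ)) := fun x => by
    rw [← Complex.exp_sum]
    congr 1
    simp only [PiLp.inner_apply, RCLike.inner_apply, conj_trivial]
    push_cast
    rw [Finset.sum_mul, ← Finset.sum_add_distrib]
    exact Finset.sum_congr rfl fun i _ => by ring
  simp_rw [h]
  rw [integral_fintype_prod_eq_prod
    (f := fun i (y : ℝ) => Complex.exp (((b i : ℂ) + t i * Complex.I) * (y : ℂ)))]
  have h2 : ∀ z : ℂ, ∫ y : ℝ, Complex.exp (z * (y : ℂ)) ∂gaussianReal 0 1 =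
      Complex.exp (z ^ 2 / 2) := fun z => by
    have := complexMGF_id_gaussianReal (μ := 0) (v := 1) z
    simpa [complexMGF] using this
  simp_rw [h2]
  rw [← Complex.exp_sum]
  congr 1
  simp only [EuclideanSpace.real_norm_sq_eq, PiLp.inner_apply, RCLike.inner_apply, conj_trivial]
  push_cast
  rw [Finset.sum_mul, Finset.sum_div, Finset.sum_div, ← Finset.sum_add_distrib,
    ← Finset.sum_sub_distrib]
  refine Finset.sum_congr rfl fun i _ => ?_
  linear_combination ((t i : ℂ) ^ 2 / 2) * Complex.I_sq

theorem integrable_exp_inner_stdGaussian (b : Vec N) :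
    Integrable (fun x => Real.exp (inner ℝ b x)) (stdGaussian (Vec N)) := by
  -- The integral of a non-integrable function is 0 by convention, but the closed formula is an
  -- exponential and cannot vanish.
  by_contra hc
  have h := integral_cexp_stdGaussian b 0
  have h2 : ∀ x : Vec N, Complex.exp ((inner ℝ b x : ℝ) + (inner ℝ x (0 : Vec N) : ℝ) * Complex.I)
      = ((Real.exp (inner ℝ b x) : ℝ) : ℂ) := fun x => by simp
  simp_rw [h2] at h
  rw [integral_complex_ofReal, integral_undef hc] at h
  exact absurd h.symm (by simp)

theorem integral_exp_inner_stdGaussian (b : Vec N) :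
    ∫ x, Real.exp (inner ℝ b x) ∂stdGaussian (Vec N) = Real.exp (‖b‖ ^ 2 / 2) := by
  have h := integral_cexp_stdGaussian b 0
  have h2 : ∀ x : Vec N, Complex.exp ((inner ℝ b x : ℝ) + (inner ℝ x (0 : Vec N) : ℝ) * Complex.I)
      = ((Real.exp (inner ℝ b x) : ℝ) : ℂ) := fun x => by simp
  simp_rw [h2] at h
  rw [integral_complex_ofReal] at h
  have h3 : ((∫ x, Real.exp (inner ℝ b x) ∂stdGaussian (Vec N) : ℝ) : ℂ) =
      ((Real.exp (‖b‖ ^ 2 / 2) : ℝ) : ℂ) := by rw [h]; simp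
  exact_mod_cast h3

theorem stdGaussian_tilted (b : Vec N) :
    (stdGaussian (Vec N)).tilted (fun x => inner ℝ b x) =
      (stdGaussian (Vec N)).map (fun x => x + b) := by
  have := isProbabilityMeasure_tilted (integrable_exp_inner_stdGaussian b)
  have : IsProbabilityMeasure ((stdGaussian (Vec N)).map (fun x => x + b)) :=
    Measure.isProbabilityMeasure_map (by fun_prop)
  apply Measure.ext_of_charFun
  ext t
  rw [charFun_apply, charFun_apply, integral_tilted, integral_map (by fun_prop) (by fun_prop),
    integral_exp_inner_stdGaussian]
  have h1 : ∀ x : Vec N, (Real.exp (inner ℝ b x) / Real.exp (‖b‖ ^ 2 / 2)) •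
      Complex.exp ((inner ℝ x t : ℝ) * Complex.I) = Complex.exp (-(‖b‖ ^ 2 / 2 : ℝ)) *
      Complex.exp ((inner ℝ b x : ℝ) + (inner ℝ x t : ℝ) * Complex.I) := fun x => by
    rw [← Real.exp_sub, ← Complex.exp_add, Complex.real_smul, Complex.ofReal_exp,
      ← Complex.exp_add]
    congr 1
    push_cast
    ring
  have h2 : ∀ x : Vec N, Complex.exp ((inner ℝ (x + b) t : ℝ) * Complex.I) =
      Complex.exp ((inner ℝ b t : ℝ) * Complex.I) *
      Complex.exp ((inner ℝ (0 : Vec N) x : ℝ) + (inner ℝ x t : ℝ) * Complex.I) := fun x => by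
    rw [← Complex.exp_add, inner_add_left, inner_zero_left]
    congr 1
    push_cast
    ring
  simp_rw [h1, h2]
  rw [integral_const_mul, integral_const_mul, integral_cexp_stdGaussian, integral_cexp_stdGaussian,
    ← Complex.exp_add, ← Complex.exp_add]
  congr 1
  simp
  ring

theorem integral_stdGaussian_add {W : Type*} [NormedAddCommGroup W] [NormedSpace ℝ W]
    (b : Vec N) {f : Vec N → W} (hf : Continuous f) :
    ∫ x, f (x + b) ∂stdGaussian (Vec N) =
      ∫ x, Real.exp (inner ℝ b x - ‖b‖ ^ 2 / 2) • f x ∂stdGaussian (Vec N) := by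
  rw [← integral_map (φ := fun x => x + b) (by fun_prop) hf.aestronglyMeasurable,
    ← stdGaussian_tilted, integral_tilted, integral_exp_inner_stdGaussian]
  simp_rw [Real.exp_sub]

open scoped MatrixOrder in
/-- The Cameron–Martin formula for the Gaussian measure on `X`. -/
theorem integral_gaussian_shift {W : Type*} [NormedAddCommGroup W] [NormedSpace ℝ W] {C : Mat N}
    (hC : C.PosSemidef) (a : fieldSpace dC) {f : fieldSpace dC → W} (hf : Continuous f) :
    ∫ ζ, f (ζ + toX dC (Matrix.toEuclideanLin C (a : Vec N))) ∂gaussian dC C =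
      ∫ ζ, Real.exp (inner ℝ a ζ - quadForm C (a : Vec N) / 2) • f ζ ∂gaussian dC C := by
  have hs : IsSelfAdjoint (Matrix.toEuclideanCLM (𝕜 := ℝ) (n := Fin N) (CFC.sqrt C)) :=
    (CFC.sqrt_nonneg C).isSelfAdjoint.map _
  have hcont := continuous_toX dC
  set S := Matrix.toEuclideanCLM (𝕜 := ℝ) (n := Fin N) (CFC.sqrt C) with hS
  have hSS : Matrix.toEuclideanLin C (a : Vec N) = S (S (a : Vec N)) := by
    rw [← ContinuousLinearMap.comp_apply, ← ContinuousLinearMap.mul_def, hS, ← map_mul,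
      CFC.sqrt_mul_sqrt_self _ hC.nonneg]
    rfl
  have hf1 : Continuous fun ζ => f (ζ + toX dC (Matrix.toEuclideanLin C (a : Vec N))) := by
    fun_prop
  have hf2 : Continuous fun ζ : fieldSpace dC =>
      Real.exp (inner ℝ a ζ - quadForm C (a : Vec N) / 2) • f ζ := by fun_prop
  rw [integral_gaussian dC C hf1.aestronglyMeasurable,
    integral_gaussian dC C hf2.aestronglyMeasurable, multivariateGaussian,
    integral_map (by fun_prop) (Continuous.aestronglyMeasurable (by fun_prop)),
    integral_map (by fun_prop) (Continuous.aestronglyMeasurable (by fun_prop))]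
  simp only [zero_add, ← hS]
  -- With S = √C, translating the standard Gaussian by S a translates its image under S by S(S a) =
  -- C a.
  have h := integral_stdGaussian_add (S (a : Vec N)) (f := fun x => f (toX dC (S x)))
    (by fun_prop)
  rw [hSS]
  have e1 : ∀ x, toX dC (S (x + S (a : Vec N))) = toX dC (S x) + toX dC (S (S (a : Vec N))) :=
    fun x => by simp only [← projX_apply, map_add]
  simp_rw [e1] at h
  rw [h]
  refine integral_congr_ae (Eventually.of_forall fun x => ?_)
  have e2 : inner ℝ (S (a : Vec N)) x = inner ℝ a (toX dC (S x)) := by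
    rw [real_inner_comm, real_inner_comm _ a, inner_toX, ← ContinuousLinearMap.adjoint_inner_right,
      hs.adjoint_eq]
  have e3 : ‖S (a : Vec N)‖ ^ 2 = quadForm C (a : Vec N) := norm_sqrt_apply_sq hC _
  simp only [e2, e3]

end GaussianLayer

/-! ### Averages of bounded functions over translates -/

section Averages

variable {E W : Type} [NormedAddCommGroup E] [NormedSpace ℝ E] [FiniteDimensional ℝ E]
  [MeasurableSpace E] [BorelSpace E] [NormedAddCommGroup W] [NormedSpace ℝ W] [CompleteSpace W]

/-- The average `φ ↦ ∫ f (φ + ζ) dμ(ζ)`. -/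
def avg (μ : Measure E) (f : E → W) (φ : E) : W := ∫ ζ, f (φ + ζ) ∂μ

theorem aestronglyMeasurable_of_continuous {f : E → W} (hf : Continuous f) (μ : Measure E) :
    AEStronglyMeasurable f μ :=
  have := FiniteDimensional.proper ℝ E
  hf.aestronglyMeasurable

theorem integrable_of_continuous_of_bound {f : E → W} (hf : Continuous f) {M : ℝ}
    (hM : ∀ x, ‖f x‖ ≤ M) (μ : Measure E) [IsFiniteMeasure μ] : Integrable f μ :=
  Integrable.of_bound (aestronglyMeasurable_of_continuous hf μ) M (Eventually.of_forall hM)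

theorem integrable_shift {f : E → W} (hf : Continuous f) {M : ℝ} (hM : ∀ x, ‖f x‖ ≤ M)
    (μ : Measure E) [IsFiniteMeasure μ] (φ : E) : Integrable (fun ζ => f (φ + ζ)) μ :=
  integrable_of_continuous_of_bound (by fun_prop) (fun _ => hM _) μ

theorem continuous_avg {f : E → W} (hf : Continuous f) {M : ℝ} (hM : ∀ x, ‖f x‖ ≤ M)
    (μ : Measure E) [IsFiniteMeasure μ] : Continuous (avg μ f) :=
  continuous_of_dominated (bound := fun _ => M)
    (fun φ => aestronglyMeasurable_of_continuous (by fun_prop) μ)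
    (fun φ => Eventually.of_forall fun _ => hM _) (integrable_const M)
    (Eventually.of_forall fun ζ => by fun_prop)

theorem norm_avg_le {f : E → W} {g : E → ℝ} (hg : Continuous g) {M : ℝ}
    (hM : ∀ x, ‖g x‖ ≤ M) (hfg : ∀ x, ‖f x‖ ≤ g x) (μ : Measure E) [IsFiniteMeasure μ] (φ : E) :
    ‖avg μ f φ‖ ≤ avg μ g φ :=
  norm_integral_le_of_norm_le (integrable_shift hg hM μ φ) (Eventually.of_forall fun _ => hfg _)

theorem avg_mono {f g : E → ℝ} (hf : Continuous f) (hg : Continuous g) {M M' : ℝ}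
    (hM : ∀ x, ‖f x‖ ≤ M) (hM' : ∀ x, ‖g x‖ ≤ M') (hfg : ∀ x, f x ≤ g x) (μ : Measure E)
    [IsFiniteMeasure μ] (φ : E) : avg μ f φ ≤ avg μ g φ :=
  integral_mono (integrable_shift hf hM μ φ) (integrable_shift hg hM' μ φ) fun _ => hfg _

theorem avg_const (μ : Measure E) [IsProbabilityMeasure μ] (c : W) (φ : E) :
    avg μ (fun _ => c) φ = c := by simp [avg]

theorem avg_const_mul (μ : Measure E) (c : ℝ) (f : E → ℝ) (φ : E) :
    avg μ (fun x => c * f x) φ = c * avg μ f φ := integral_const_mul _ _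

theorem norm_avg_le_const {f : E → W} {M : ℝ} (hM : ∀ x, ‖f x‖ ≤ M) (μ : Measure E)
    [IsProbabilityMeasure μ] (φ : E) : ‖avg μ f φ‖ ≤ M := by
  have h := norm_avg_le (g := fun _ => M) continuous_const (M := ‖M‖) (fun _ => le_rfl) hM μ φ
  rwa [avg_const] at h

theorem hasFDerivAt_avg {f : E → W} (hf : ContDiff ℝ 1 f) {M M' : ℝ} (hM : ∀ x, ‖f x‖ ≤ M)
    (hM' : ∀ x, ‖fderiv ℝ f x‖ ≤ M') (μ : Measure E) [IsFiniteMeasure μ] (φ : E) :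
    HasFDerivAt (avg μ f) (avg μ (fderiv ℝ f) φ) φ := by
  have hd : Continuous (fderiv ℝ f) := hf.continuous_fderiv one_ne_zero
  have hc := hf.continuous
  refine hasFDerivAt_integral_of_dominated_of_fderiv_le (bound := fun _ => M')
    (F' := fun x ζ => fderiv ℝ f (x + ζ)) Filter.univ_mem
    (Eventually.of_forall fun x => aestronglyMeasurable_of_continuous (by fun_prop) μ)
    (integrable_shift hc hM μ φ) (aestronglyMeasurable_of_continuous (by fun_prop) μ)
    (Eventually.of_forall fun ζ x _ => hM' _) (integrable_const _)
    (Eventually.of_forall fun ζ x _ => ?_)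
  exact ((hf.differentiable one_ne_zero) (x + ζ)).hasFDerivAt.comp x
    ((hasFDerivAt_id x).add_const ζ)

theorem fderiv_avg {f : E → W} (hf : ContDiff ℝ 1 f) {M M' : ℝ} (hM : ∀ x, ‖f x‖ ≤ M)
    (hM' : ∀ x, ‖fderiv ℝ f x‖ ≤ M') (μ : Measure E) [IsFiniteMeasure μ] :
    fderiv ℝ (avg μ f) = avg μ (fderiv ℝ f) :=
  funext fun φ => (hasFDerivAt_avg hf hM hM' μ φ).fderiv

/-- Jensen's inequality for the concave power x^θ. It is the reason why a bound by powers of a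
weight survives averaging with the same constant. -/
theorem avg_rpow_le {ρ : E → ℝ} (hρ : Continuous ρ) {M : ℝ} (h0 : ∀ x, 0 ≤ ρ x)
    (hM : ∀ x, ρ x ≤ M) {θ : ℝ} (hθ : 0 < θ) (hθ1 : θ ≤ 1) (μ : Measure E)
    [IsProbabilityMeasure μ] (φ : E) :
    avg μ (fun x => ρ x ^ θ) φ ≤ avg μ ρ φ ^ θ := by
  have hn : ∀ x, ‖ρ x‖ ≤ M := fun x => by rw [Real.norm_of_nonneg (h0 x)]; exact hM x
  have hc : Continuous fun x => ρ x ^ θ := hρ.rpow_const fun x => Or.inr hθ.le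
  have hnpow : ∀ x, ‖ρ x ^ θ‖ ≤ M ^ θ := fun x => by
    rw [Real.norm_of_nonneg (Real.rpow_nonneg (h0 x) θ)]
    exact Real.rpow_le_rpow (h0 x) (hM x) hθ.le
  exact (Real.concaveOn_rpow hθ.le hθ1).le_map_integral
    (Real.continuous_rpow_const hθ.le).continuousOn isClosed_Ici
    (Eventually.of_forall fun ζ => h0 _) (integrable_shift hρ hn μ φ)
    (integrable_shift hc hnpow μ φ)

/-- `n` times continuously differentiable with bounded derivatives. -/
def BddSmooth (n : ℕ) (f : E → W) : Prop :=
  ContDiff ℝ n f ∧ ∀ j ≤ n, ∃ M, ∀ x, ‖iteratedFDeriv ℝ j f x‖ ≤ M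

theorem BddSmooth.bound {n : ℕ} {f : E → W} (h : BddSmooth n f) : ∃ M, ∀ x, ‖f x‖ ≤ M := by
  simpa using h.2 0 (Nat.zero_le n)

theorem BddSmooth.fderiv {n : ℕ} {f : E → W} (h : BddSmooth (n + 1) f) :
    BddSmooth n (fderiv ℝ f) := by
  refine ⟨h.1.fderiv_right (by norm_cast), fun j hj => ?_⟩
  obtain ⟨M, hM⟩ := h.2 (j + 1) (by lia)
  exact ⟨M, fun x => by rw [norm_iteratedFDeriv_fderiv]; exact hM x⟩

/-- Induction on the order, passing from f to its derivative. The target space changes at each step,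
so the induction quantifies over all of them. -/
theorem contDiff_avg_and_norm_iteratedFDeriv_avg_le (n : ℕ) :
    ∀ {W : Type} [NormedAddCommGroup W] [NormedSpace ℝ W] [CompleteSpace W] {f : E → W},
      BddSmooth n f → ∀ (μ : Measure E) [IsFiniteMeasure μ], ContDiff ℝ n (avg μ f) ∧
        ∀ j ≤ n, ∀ φ, ‖iteratedFDeriv ℝ j (avg μ f) φ‖ ≤
          avg μ (fun x => ‖iteratedFDeriv ℝ j f x‖) φ := by
  induction n with
  | zero =>
    intro W _ _ _ f hf μ _
    obtain ⟨M, hM⟩ := hf.bound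
    have hc : Continuous f := hf.1.continuous
    refine ⟨contDiff_zero.2 (continuous_avg hc hM μ), fun j hj φ => ?_⟩
    obtain rfl : j = 0 := by lia
    simp only [norm_iteratedFDeriv_zero]
    exact norm_avg_le (M := M) (by fun_prop) (fun x => by simpa using hM x) (fun x => le_rfl) μ φ
  | succ n ih =>
    intro W _ _ _ f hf μ _
    obtain ⟨M, hM⟩ := hf.bound
    obtain ⟨M', hM'⟩ := hf.fderiv.bound
    have hc : Continuous f := hf.1.continuous
    have hf1 : ContDiff ℝ 1 f := hf.1.of_le (by norm_cast; lia)
    obtain ⟨h1, h2⟩ := ih hf.fderiv μ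
    rw [← fderiv_avg hf1 hM hM'] at h1 h2
    refine ⟨?_, fun j hj φ => ?_⟩
    · push_cast
      exact contDiff_succ_iff_fderiv.2
        ⟨fun φ => (hasFDerivAt_avg hf1 hM hM' μ φ).differentiableAt, by simp, h1⟩
    · cases j with
      | zero =>
        simp only [norm_iteratedFDeriv_zero]
        exact norm_avg_le (M := M) (by fun_prop) (fun x => by simpa using hM x)
          (fun x => le_rfl) μ φ
      | succ j =>
        have := h2 j (by lia) φ
        simpa only [norm_iteratedFDeriv_fderiv] using this

end Averages

/-! ### Calculus of functions controlled by powers of a weight -/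

section Tame

variable {E : Type} [NormedAddCommGroup E] [NormedSpace ℝ E]
  {W W₁ W₂ : Type} [NormedAddCommGroup W] [NormedSpace ℝ W]
  [NormedAddCommGroup W₁] [NormedSpace ℝ W₁] [NormedAddCommGroup W₂] [NormedSpace ℝ W₂]
  {ι : Type}

/-- A family of functions whose derivatives up to order `n` are bounded by every power less
than one of the weight `ρ`, uniformly in the family. -/
def Tame (n : ℕ) (ρ : ι → E → ℝ) (f : ι → E → W) : Prop :=
  (∀ i, ContDiff ℝ n (f i)) ∧ ∀ j ≤ n, ∀ θ : ℝ, 0 < θ → θ < 1 →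
    ∃ c, 0 ≤ c ∧ ∀ i x, ‖iteratedFDeriv ℝ j (f i) x‖ ≤ c * ρ i x ^ θ

/-- A family of functions whose derivatives up to order `n` are bounded by every negative power
of the weight `ρ`, uniformly in the family. -/
def Mild (n : ℕ) (ρ : ι → E → ℝ) (f : ι → E → W) : Prop :=
  (∀ i, ContDiff ℝ n (f i)) ∧ ∀ j ≤ n, ∀ θ : ℝ, 0 < θ →
    ∃ c, 0 ≤ c ∧ ∀ i x, ‖iteratedFDeriv ℝ j (f i) x‖ ≤ c * ρ i x ^ (-θ)

variable {n : ℕ} {ρ : ι → E → ℝ}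

theorem Tame.mono {m : ℕ} {f : ι → E → W} (h : Tame n ρ f) (hm : m ≤ n) : Tame m ρ f :=
  ⟨fun i => (h.1 i).of_le (by exact_mod_cast hm), fun j hj => h.2 j (hj.trans hm)⟩

theorem Mild.mono {m : ℕ} {f : ι → E → W} (h : Mild n ρ f) (hm : m ≤ n) : Mild m ρ f :=
  ⟨fun i => (h.1 i).of_le (by exact_mod_cast hm), fun j hj => h.2 j (hj.trans hm)⟩

theorem Tame.fderiv {f : ι → E → W} (h : Tame (n + 1) ρ f) :
    Tame n ρ (fun i => fderiv ℝ (f i)) := by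
  refine ⟨fun i => (h.1 i).fderiv_right (by norm_cast), fun j hj θ h0 h1 => ?_⟩
  simpa only [norm_iteratedFDeriv_fderiv] using h.2 (j + 1) (by lia) θ h0 h1

theorem Mild.fderiv {f : ι → E → W} (h : Mild (n + 1) ρ f) :
    Mild n ρ (fun i => fderiv ℝ (f i)) := by
  refine ⟨fun i => (h.1 i).fderiv_right (by norm_cast), fun j hj θ h0 => ?_⟩
  simpa only [norm_iteratedFDeriv_fderiv] using h.2 (j + 1) (by lia) θ h0

theorem Mild.succ {f : ι → E → W} (hd : ∀ i, Differentiable ℝ (f i)) (h0 : Mild 0 ρ f)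
    (h : Mild n ρ (fun i => _root_.fderiv ℝ (f i))) : Mild (n + 1) ρ f := by
  refine ⟨fun i => ?_, fun j hj θ hθ => ?_⟩
  · push_cast
    exact contDiff_succ_iff_fderiv.2 ⟨hd i, by simp, h.1 i⟩
  · cases j with
    | zero => exact h0.2 0 le_rfl θ hθ
    | succ j =>
      simpa only [norm_iteratedFDeriv_fderiv] using h.2 j (by lia) θ hθ

theorem Mild.sub {f g : ι → E → W} (hf : Mild n ρ f) (hg : Mild n ρ g) :
    Mild n ρ (fun i x => f i x - g i x) := by
  refine ⟨fun i => (hf.1 i).sub (hg.1 i), fun j hj θ h0 => ?_⟩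
  obtain ⟨c, hc, h⟩ := hf.2 j hj θ h0
  obtain ⟨c', hc', h'⟩ := hg.2 j hj θ h0
  refine ⟨c + c', by positivity, fun i x => ?_⟩
  have e : iteratedFDeriv ℝ j (fun x => f i x - g i x) x =
      iteratedFDeriv ℝ j (f i) x - iteratedFDeriv ℝ j (g i) x :=
    iteratedFDeriv_sub_apply (((hf.1 i).of_le (by exact_mod_cast hj)).contDiffAt)
      (((hg.1 i).of_le (by exact_mod_cast hj)).contDiffAt)
  rw [e, add_mul]
  exact (norm_sub_le _ _).trans (add_le_add (h i x) (h' i x))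

theorem norm_iteratedFDeriv_bilin_le (B : W₁ →L[ℝ] W₂ →L[ℝ] W) {f : ι → E → W₁} {g : ι → E → W₂}
    (hf : ∀ i, ContDiff ℝ n (f i)) (hg : ∀ i, ContDiff ℝ n (g i)) {j : ℕ} (hj : j ≤ n)
    {α β : ℝ} (hρ : ∀ i x, 0 < ρ i x)
    (hf' : ∀ k ≤ j, ∃ c, 0 ≤ c ∧ ∀ i x, ‖iteratedFDeriv ℝ k (f i) x‖ ≤ c * ρ i x ^ α)
    (hg' : ∀ k ≤ j, ∃ c, 0 ≤ c ∧ ∀ i x, ‖iteratedFDeriv ℝ k (g i) x‖ ≤ c * ρ i x ^ β) :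
    ∃ c, 0 ≤ c ∧ ∀ i x, ‖iteratedFDeriv ℝ j (fun x => B (f i x) (g i x)) x‖ ≤
      c * ρ i x ^ (α + β) := by
  choose! c hc hfc using hf'
  choose! d hd hgd using hg'
  refine ⟨‖B‖ * ∑ k ∈ Finset.range (j + 1), (j.choose k : ℝ) * c k * d (j - k), ?_,
    fun i x => ?_⟩
  · refine mul_nonneg B.opNorm_nonneg (Finset.sum_nonneg fun k hk => ?_)
    have := hc k (by simp at hk; lia)
    have := hd (j - k) (by lia)
    positivity
  · refine (B.norm_iteratedFDeriv_le_of_bilinear (hf i) (hg i) x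
      (by exact_mod_cast hj)).trans ?_
    rw [mul_assoc, Finset.sum_mul]
    refine mul_le_mul_of_nonneg_left (Finset.sum_le_sum fun k hk => ?_) B.opNorm_nonneg
    rw [Real.rpow_add (hρ i x)]
    have h1 := hfc k (by simp at hk; lia) i x
    have h2 := hgd (j - k) (by lia) i x
    calc (j.choose k : ℝ) * ‖iteratedFDeriv ℝ k (f i) x‖ * ‖iteratedFDeriv ℝ (j - k) (g i) x‖
        ≤ (j.choose k : ℝ) * (c k * ρ i x ^ α) * (d (j - k) * ρ i x ^ β) := by
          have := hc k (by simp at hk; lia)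
          have := Real.rpow_nonneg (hρ i x).le α
          gcongr
      _ = _ := by ring

theorem Mild.bilin (B : W₁ →L[ℝ] W₂ →L[ℝ] W) {f : ι → E → W₁} {g : ι → E → W₂}
    (hρ : ∀ i x, 0 < ρ i x) (hf : Mild n ρ f) (hg : Mild n ρ g) :
    Mild n ρ (fun i x => B (f i x) (g i x)) := by
  refine ⟨fun i => B.isBoundedBilinearMap.contDiff.comp ((hf.1 i).prodMk (hg.1 i)),
    fun j hj θ h0 => ?_⟩
  have := norm_iteratedFDeriv_bilin_le B hf.1 hg.1 hj hρ
    (fun k hk => hf.2 k (hk.trans hj) (θ / 2) (by positivity))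
    (fun k hk => hg.2 k (hk.trans hj) (θ / 2) (by positivity))
  simpa [show -(θ / 2) + -(θ / 2) = -θ by ring] using this

theorem Tame.bilin (B : W₁ →L[ℝ] W₂ →L[ℝ] W) {f : ι → E → W₁} {g : ι → E → W₂}
    (hρ : ∀ i x, 0 < ρ i x) (hf : Tame n ρ f) (hg : Mild n ρ g) :
    Tame n ρ (fun i x => B (f i x) (g i x)) := by
  refine ⟨fun i => B.isBoundedBilinearMap.contDiff.comp ((hf.1 i).prodMk (hg.1 i)),
    fun j hj θ h0 h1 => ?_⟩
  -- The exponent θ is split as (1+θ)/2 - (1-θ)/2: the first is still below 1, as tameness requires,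
  -- and the loss is arbitrarily small for a mild factor.
  have := norm_iteratedFDeriv_bilin_le B hf.1 hg.1 hj hρ
    (fun k hk => hf.2 k (hk.trans hj) ((1 + θ) / 2) (by linarith) (by linarith))
    (fun k hk => hg.2 k (hk.trans hj) ((1 - θ) / 2) (by linarith))
  simpa [show (1 + θ) / 2 + -((1 - θ) / 2) = θ by ring] using this

theorem Mild.mul {f g : ι → E → ℝ} (hρ : ∀ i x, 0 < ρ i x) (hf : Mild n ρ f)
    (hg : Mild n ρ g) : Mild n ρ (fun i x => f i x * g i x) :=
  hf.bilin (ContinuousLinearMap.mul ℝ ℝ) hρ hg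

theorem Tame.mul {f g : ι → E → ℝ} (hρ : ∀ i x, 0 < ρ i x) (hf : Tame n ρ f)
    (hg : Mild n ρ g) : Tame n ρ (fun i x => f i x * g i x) :=
  hf.bilin (ContinuousLinearMap.mul ℝ ℝ) hρ hg

theorem Tame.clm_apply {f : ι → E → W →L[ℝ] W₁} (hf : Tame n ρ f) (a : W) :
    Tame n ρ (fun i x => f i x a) := by
  refine ⟨fun i => (hf.1 i).clm_apply contDiff_const, fun j hj θ h0 h1 => ?_⟩
  obtain ⟨c, hc, h⟩ := hf.2 j hj θ h0 h1
  refine ⟨‖a‖ * c, by positivity, fun i x => ?_⟩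
  rw [mul_assoc]
  exact (norm_iteratedFDeriv_clm_apply_const ((hf.1 i).contDiffAt)
    (by exact_mod_cast hj)).trans (mul_le_mul_of_nonneg_left (h i x) (norm_nonneg a))

theorem Mild.clm_apply {f : ι → E → W →L[ℝ] W₁} (hf : Mild n ρ f) (a : W) :
    Mild n ρ (fun i x => f i x a) := by
  refine ⟨fun i => (hf.1 i).clm_apply contDiff_const, fun j hj θ h0 => ?_⟩
  obtain ⟨c, hc, h⟩ := hf.2 j hj θ h0
  refine ⟨‖a‖ * c, by positivity, fun i x => ?_⟩
  rw [mul_assoc]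
  exact (norm_iteratedFDeriv_clm_apply_const ((hf.1 i).contDiffAt)
    (by exact_mod_cast hj)).trans (mul_le_mul_of_nonneg_left (h i x) (norm_nonneg a))

/-- The quotient of tame families is mild if the denominator dominates the weight. -/
theorem Tame.inv_smul (hρ : ∀ i x, 0 < ρ i x) {M : ℝ} (hM0 : 0 ≤ M) (hM : ∀ i x, ρ i x ≤ M)
    {g : ι → E → ℝ} {ε : ℝ} (hε : 0 < ε)
    (hg : ∀ i x, ε * ρ i x ≤ g i x) (n : ℕ) : Tame n ρ g →
    ∀ {W : Type} [NormedAddCommGroup W] [NormedSpace ℝ W] {f : ι → E → W}, Tame n ρ f →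
      Mild n ρ (fun i x => (g i x)⁻¹ • f i x) := by
  have hpos : ∀ i x, 0 < g i x := fun i x => (mul_pos hε (hρ i x)).trans_le (hg i x)
  have h0 : Tame 0 ρ g → ∀ {W : Type} [NormedAddCommGroup W] [NormedSpace ℝ W] {f : ι → E → W},
      Tame 0 ρ f → Mild 0 ρ (fun i x => (g i x)⁻¹ • f i x) := by
    intro ht W _ _ f hf
    refine ⟨fun i => ((ht.1 i).inv fun x => (hpos i x).ne').smul (hf.1 i), fun j hj θ hθ => ?_⟩
    obtain rfl : j = 0 := by lia
    -- Dividing ρ^{1-θ'} by ρ leaves ρ^{-θ'}. The truncation θ' = min θ ½ keeps 1 - θ' inside (0,1)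
    -- for large θ; the excess ρ^{θ-θ'} is bounded because ρ ≤ M.
    obtain ⟨c', hc', h'⟩ := hf.2 0 le_rfl (1 - min θ (1 / 2))
      (by have := min_le_right θ (1 / 2); linarith)
      (by have := lt_min hθ (by norm_num : (0 : ℝ) < 1 / 2); linarith)
    set θ' := min θ (1 / 2) with hθ'
    refine ⟨ε⁻¹ * c' * M ^ (θ - θ'), by positivity, fun i x => ?_⟩
    · have hx := h' i x
      rw [norm_iteratedFDeriv_zero] at hx ⊢
      rw [norm_smul, norm_inv, Real.norm_of_nonneg (hpos i x).le]
      have h3 : ρ i x ^ (θ - θ') ≤ M ^ (θ - θ') :=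
        Real.rpow_le_rpow (hρ i x).le (hM i x) (by have := min_le_left θ (1 / 2); linarith)
      calc (g i x)⁻¹ * ‖f i x‖ ≤ (ε * ρ i x)⁻¹ * (c' * ρ i x ^ (1 - θ')) := by
            have := mul_pos hε (hρ i x)
            have := hpos i x
            gcongr
            exact hg i x
        _ = ε⁻¹ * c' * ρ i x ^ (θ - θ') * ρ i x ^ (-θ) := by
            rw [mul_assoc _ (ρ i x ^ (θ - θ')), ← Real.rpow_add (hρ i x), mul_inv,
              show θ - θ' + -θ = -1 + (1 - θ') by ring, Real.rpow_add (hρ i x), Real.rpow_neg_one]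
            ring
        _ ≤ _ := by
            have := Real.rpow_nonneg (hρ i x).le (-θ)
            gcongr
  induction n with
  | zero => exact h0
  | succ n ih =>
    intro ht W _ _ f hf
    have hgd : ∀ i, Differentiable ℝ (g i) := fun i => (ht.1 i).differentiable (by simp)
    have hfd : ∀ i, Differentiable ℝ (f i) := fun i => (hf.1 i).differentiable (by simp)
    refine Mild.succ (fun i => ((hgd i).inv fun x => (hpos i x).ne').smul (hfd i))
      (h0 (ht.mono (by lia)) (hf.mono (by lia))) ?_
    -- The derivative of f/g is f'/g - (g'/g)(f/g), and each quotient has a tame numerator of one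
    -- order less.
    have hA := ih (ht.mono (by lia)) hf.fderiv
    have hB := ih (ht.mono (by lia)) (hf.mono (by lia : n ≤ n + 1))
    have hC := ih (ht.mono (by lia)) ht.fderiv
    have hD := Mild.bilin (ContinuousLinearMap.smulRightL ℝ E W) hρ hC hB
    convert hA.sub hD using 3 with i x
    have h1 : HasFDerivAt (fun x => (g i x)⁻¹ • f i x) _ x :=
      ((hasDerivAt_inv (hpos i x).ne').comp_hasFDerivAt x (hgd i x).hasFDerivAt).smul
        (hfd i x).hasFDerivAt
    rw [h1.fderiv]
    ext v
    simp only [Function.comp_apply, add_apply, smul_apply, ContinuousLinearMap.smulRight_apply,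
      neg_smul, neg_apply, smul_eq_mul, sub_eq_add_neg, map_smul,
      ContinuousLinearMap.smulRightL_apply_apply, smul_smul]
    congr 2
    ring_nf

theorem Tame.const_le {f : ι → E → W} (h : Tame n ρ f) (hρ : ∀ i x, 0 ≤ ρ i x) {M : ℝ}
    (hM0 : 0 ≤ M) (hM : ∀ i x, ρ i x ≤ M) {j : ℕ} (hj : j ≤ n) :
    ∃ c, 0 ≤ c ∧ ∀ i x, ‖iteratedFDeriv ℝ j (f i) x‖ ≤ c := by
  obtain ⟨c, hc, h⟩ := h.2 j hj (1 / 2) (by norm_num) (by norm_num)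
  refine ⟨c * M ^ (1 / 2 : ℝ), by positivity, fun i x => (h i x).trans ?_⟩
  gcongr
  · exact hρ i x
  · exact hM i x

theorem Tame.bddSmooth {f : ι → E → W} (h : Tame n ρ f) (hρ : ∀ i x, 0 ≤ ρ i x) {M : ℝ}
    (hM0 : 0 ≤ M) (hM : ∀ i x, ρ i x ≤ M) (i : ι) : BddSmooth n (f i) :=
  ⟨h.1 i, fun _ hj => let ⟨c, _, hc⟩ := h.const_le hρ hM0 hM hj; ⟨c, fun x => hc i x⟩⟩

/-- Averaging preserves tameness. -/
theorem Tame.avg [FiniteDimensional ℝ E] [MeasurableSpace E] [BorelSpace E] [CompleteSpace W]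
    {f : ι → E → W} (h : Tame n ρ f) (hρc : ∀ i, Continuous (ρ i)) (hρ : ∀ i x, 0 ≤ ρ i x) {M : ℝ}
    (hM0 : 0 ≤ M) (hM : ∀ i x, ρ i x ≤ M) {κ : Type} (e : κ → ι) (μ : κ → Measure E)
    [∀ k, IsProbabilityMeasure (μ k)] :
    Tame n (fun k => Polchinski.avg (μ k) (ρ (e k))) (fun k => Polchinski.avg (μ k) (f (e k))) := by
  have hb := h.bddSmooth hρ hM0 hM
  refine ⟨fun k => (contDiff_avg_and_norm_iteratedFDeriv_avg_le n (hb (e k)) (μ k)).1,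
    fun j hj θ h0 h1 => ?_⟩
  obtain ⟨c, hc, hfc⟩ := h.2 j hj θ h0 h1
  refine ⟨c, hc, fun k x => ?_⟩
  refine ((contDiff_avg_and_norm_iteratedFDeriv_avg_le n (hb (e k)) (μ k)).2 j hj x).trans ?_
  obtain ⟨b, hb'⟩ := (hb (e k)).2 j hj
  have hcont : Continuous fun x => ρ (e k) x ^ θ := (hρc _).rpow_const fun x => Or.inr h0.le
  have hbd : ∀ x, ‖c * ρ (e k) x ^ θ‖ ≤ c * M ^ θ := fun x => by
    rw [Real.norm_of_nonneg (mul_nonneg hc (Real.rpow_nonneg (hρ _ x) θ))]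
    gcongr
    · exact hρ _ x
    · exact hM _ x
  refine (avg_mono (g := fun x => c * ρ (e k) x ^ θ)
    ((h.1 (e k)).continuous_iteratedFDeriv (by exact_mod_cast hj)).norm
    (by fun_prop) (fun x => by simpa using hb' x) hbd (hfc (e k)) (μ k) x).trans ?_
  rw [avg_const_mul]
  exact mul_le_mul_of_nonneg_left (avg_rpow_le (hρc _) (hρ _) (hM _) h0 h1.le (μ k) x) hc

end Tame

/-- Fernique's theorem gives an exponential moment of c‖x‖², and k‖x‖ ≤ k²/(4c) + c‖x‖² by
completing the square. These exponentials dominate the derivatives of the Cameron–Martin density. -/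
theorem integrable_exp_norm {E : Type*} [NormedAddCommGroup E] [NormedSpace ℝ E] [CompleteSpace E]
    [SecondCountableTopology E] [MeasurableSpace E] [BorelSpace E] (μ : Measure E) [IsGaussian μ]
    (k : ℝ) : Integrable (fun x => Real.exp (k * ‖x‖)) μ := by
  obtain ⟨c, hc, hi⟩ := IsGaussian.exists_integrable_exp_sq μ
  refine (hi.const_mul (Real.exp (k ^ 2 / (4 * c)))).mono' (by fun_prop)
    (Eventually.of_forall fun x => ?_)
  rw [Real.norm_of_nonneg (Real.exp_pos _).le, ← Real.exp_add]
  refine Real.exp_le_exp.2 ?_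
  have : k ^ 2 / (4 * c) + c * ‖x‖ ^ 2 - k * ‖x‖ = (k - 2 * c * ‖x‖) ^ 2 / (4 * c) := by
    field_simp; ring
  have h2 : 0 ≤ (k - 2 * c * ‖x‖) ^ 2 / (4 * c) := by positivity
  linarith

/-! ### Regularisation by nondegenerate Gaussian measures -/

section CameronMartin

variable {E : Type} [NormedAddCommGroup E] [InnerProductSpace ℝ E] [FiniteDimensional ℝ E]
  [MeasurableSpace E] [BorelSpace E]

/-- The Cameron–Martin formula for `γ`, where `R` is the inverse of the covariance operator. -/
def CameronMartin (γ : Measure E) (R : E →L[ℝ] E) : Prop :=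
  (∀ v, 0 ≤ inner ℝ (R v) v) ∧ ∀ (v : E) {W : Type} [NormedAddCommGroup W] [NormedSpace ℝ W]
    (f : E → W), Continuous f → ∫ ζ, f (ζ + v) ∂γ =
      ∫ ζ, Real.exp (inner ℝ (R v) ζ - inner ℝ (R v) v / 2) • f ζ ∂γ

/-- The Cameron–Martin formula moves the translation from f to the exponential density, which is
smooth in the shift. Thus f need only be continuous and bounded; the derivative is Gaussian
integration by parts. -/
theorem CameronMartin.hasFDerivAt_avg {γ : Measure E} [IsGaussian γ] {R : E →L[ℝ] E}
    (h : CameronMartin γ R) {W : Type} [NormedAddCommGroup W] [NormedSpace ℝ W] [CompleteSpace W]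
    {f : E → W} (hf : Continuous f) {M : ℝ} (hM : ∀ x, ‖f x‖ ≤ M)
    (φ : E) :
    HasFDerivAt (avg γ f)
      (∫ ζ, ((innerSL ℝ ζ).comp R).smulRight (f (φ + ζ)) ∂γ) φ := by
  have hM0 : 0 ≤ M := (norm_nonneg _).trans (hM 0)
  have hshift : ∀ v, avg γ f (φ + v) =
      ∫ ζ, Real.exp (inner ℝ (R v) ζ - inner ℝ (R v) v / 2) • f (φ + ζ) ∂γ := fun v => by
    rw [← h.2 v (fun ζ => f (φ + ζ)) (by fun_prop), avg]
    congr 1 with ζ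
    congr 1
    abel
  -- It suffices to differentiate in the shift at v = 0. On the unit ball the density is at most
  -- e^{‖R‖‖ζ‖}, since the quadratic term in the exponent has a favourable sign, and the derivative
  -- of the exponent is at most ‖R‖(1 + ‖ζ‖).
  have hmain : HasFDerivAt (fun v => ∫ ζ, Real.exp (inner ℝ (R v) ζ - inner ℝ (R v) v / 2) •
      f (φ + ζ) ∂γ) (∫ ζ, ((innerSL ℝ ζ).comp R).smulRight (f (φ + ζ)) ∂γ) 0 := by
    let A : E → E → E →L[ℝ] ℝ := fun v ζ =>
      (innerSL ℝ ζ).comp R - (1 / 2 : ℝ) • (innerSL ℝ (R v) + (innerSL ℝ v).comp R)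
    have key := hasFDerivAt_integral_of_dominated_of_fderiv_le (𝕜 := ℝ) (μ := γ)
      (F := fun v ζ => Real.exp (inner ℝ (R v) ζ - inner ℝ (R v) v / 2) • f (φ + ζ))
      (F' := fun v ζ => (Real.exp (inner ℝ (R v) ζ - inner ℝ (R v) v / 2) • A v ζ).smulRight
        (f (φ + ζ)))
      (bound := fun ζ => (Real.exp (‖R‖ * ‖ζ‖) * (‖R‖ * Real.exp (1 * ‖ζ‖))) * M)
      (x₀ := 0) (Metric.ball_mem_nhds 0 one_pos)
      (Eventually.of_forall fun v => Continuous.aestronglyMeasurable (by fun_prop)) ?_ ?_ ?_ ?_ ?_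
    · convert key using 4 with ζ
      simp [A]
    · simpa using integrable_shift hf hM γ φ
    · refine aestronglyMeasurable_of_continuous ?_ γ
      change Continuous fun ζ => ContinuousLinearMap.smulRightL ℝ (E) W
        (Real.exp (inner ℝ (R 0) ζ - inner ℝ (R 0) 0 / 2) •
          ((innerSL ℝ ζ).comp R - (1 / 2 : ℝ) • (innerSL ℝ (R 0) + (innerSL ℝ 0).comp R)))
        (f (φ + ζ))
      fun_prop
    · refine Eventually.of_forall fun ζ v hv => ?_
      have hv : ‖v‖ ≤ 1 := by simpa using (mem_ball_zero_iff.1 hv).le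
      rw [ContinuousLinearMap.norm_smulRight_apply, norm_smul, Real.norm_of_nonneg (Real.exp_pos _).le]
      have hq : 0 ≤ inner ℝ (R v) v := h.1 v
      have hRv : ‖R v‖ ≤ ‖R‖ := (R.le_opNorm v).trans (by nlinarith [norm_nonneg R])
      have h1 : inner ℝ (R v) ζ ≤ ‖R‖ * ‖ζ‖ :=
        (real_inner_le_norm _ _).trans (by gcongr)
      have h2 : ‖A v ζ‖ ≤ ‖R‖ * Real.exp (1 * ‖ζ‖) := by
        have e1 : ‖(innerSL ℝ ζ).comp R‖ ≤ ‖ζ‖ * ‖R‖ :=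
          (ContinuousLinearMap.opNorm_comp_le _ _).trans (by rw [innerSL_apply_norm])
        have e2 : ‖(innerSL ℝ v).comp R‖ ≤ ‖R‖ :=
          (ContinuousLinearMap.opNorm_comp_le _ _).trans
            (by rw [innerSL_apply_norm]; nlinarith [norm_nonneg R])
        have e3 : ‖innerSL ℝ (R v)‖ ≤ ‖R‖ := by rwa [innerSL_apply_norm]
        calc ‖A v ζ‖ ≤ ‖ζ‖ * ‖R‖ + 1 / 2 * (‖R‖ + ‖R‖) := by
              refine (norm_sub_le _ _).trans (add_le_add e1 ?_)
              rw [norm_smul, Real.norm_of_nonneg (by norm_num)]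
              gcongr
              exact (norm_add_le _ _).trans (add_le_add e3 e2)
          _ = ‖R‖ * (1 * ‖ζ‖ + 1) := by ring
          _ ≤ _ := by gcongr; exact Real.add_one_le_exp _
      have h3 : Real.exp (inner ℝ (R v) ζ - inner ℝ (R v) v / 2) ≤ Real.exp (‖R‖ * ‖ζ‖) :=
        Real.exp_le_exp.2 (by linarith)
      gcongr
      exact hM _
    · have : ∀ ζ : E, Real.exp (‖R‖ * ‖ζ‖) * (‖R‖ * Real.exp (1 * ‖ζ‖)) * M =
          Real.exp ((‖R‖ + 1) * ‖ζ‖) * (‖R‖ * M) := fun ζ => by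
        rw [add_mul, Real.exp_add]; ring
      simp_rw [this]
      exact (integrable_exp_norm γ _).mul_const _
    · refine Eventually.of_forall fun ζ v hv => ?_
      have e1 : HasFDerivAt (fun v => inner ℝ (R v) ζ - inner ℝ (R v) v / 2) (A v ζ) v := by
        have d1 : HasFDerivAt (fun v => inner ℝ (R v) ζ) ((innerSL ℝ ζ).comp R) v := by
          refine ((innerSL ℝ ζ).comp R).hasFDerivAt.congr_of_eventuallyEq
            (Eventually.of_forall fun x => ?_)
          simp [real_inner_comm]
        have d2 := (R.hasFDerivAt (x := v)).inner ℝ (hasFDerivAt_id v)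
        refine (d1.sub (d2.mul_const (1 / 2 : ℝ))).congr_fderiv ?_ |>.congr_of_eventuallyEq
          (Eventually.of_forall fun x => by simp [div_eq_mul_inv])
        ext w
        simp [A, real_inner_comm]
        ring
      exact (e1.exp).smul_const (f (φ + ζ))
  have h2 : HasFDerivAt (fun x => x - φ) (ContinuousLinearMap.id ℝ (E)) φ :=
    (hasFDerivAt_id φ).sub_const φ
  have h3 := HasFDerivAt.comp φ (f := fun x => x - φ) (by rw [sub_self]; exact hmain) h2
  rw [ContinuousLinearMap.comp_id] at h3
  refine h3.congr_of_eventuallyEq (Eventually.of_forall fun x => ?_)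
  simp only [Function.comp_apply]
  rw [← hshift, add_sub_cancel]

theorem CameronMartin.contDiff_one_avg {γ : Measure E} [IsGaussian γ] {R : E →L[ℝ] E}
    (h : CameronMartin γ R) {W : Type} [NormedAddCommGroup W] [NormedSpace ℝ W] [CompleteSpace W]
    {f : E → W} (hf : Continuous f) {M : ℝ} (hM : ∀ x, ‖f x‖ ≤ M) : ContDiff ℝ 1 (avg γ f) := by
  have hM0 : 0 ≤ M := (norm_nonneg _).trans (hM 0)
  rw [contDiff_one_iff_fderiv]
  refine ⟨fun φ => (h.hasFDerivAt_avg hf hM φ).differentiableAt, ?_⟩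
  rw [funext fun φ => (h.hasFDerivAt_avg hf hM φ).fderiv]
  refine continuous_of_dominated (bound := fun ζ => ‖R‖ * Real.exp (1 * ‖ζ‖) * M) (fun φ => ?_)
    (fun φ => Eventually.of_forall fun ζ => ?_) (((integrable_exp_norm γ 1).const_mul _).mul_const _)
    (Eventually.of_forall fun ζ => ?_)
  · refine aestronglyMeasurable_of_continuous ?_ γ
    change Continuous fun ζ => ContinuousLinearMap.smulRightL ℝ E W
      ((innerSL ℝ ζ).comp R) (f (φ + ζ))
    fun_prop
  · rw [ContinuousLinearMap.norm_smulRight_apply]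
    have e1 : ‖(innerSL ℝ ζ).comp R‖ ≤ ‖R‖ * Real.exp (1 * ‖ζ‖) := by
      refine (ContinuousLinearMap.opNorm_comp_le _ _).trans ?_
      rw [innerSL_apply_norm, mul_comm]
      gcongr
      have := Real.add_one_le_exp (1 * ‖ζ‖)
      linarith
    gcongr
    exact hM _
  · change Continuous fun φ => ContinuousLinearMap.smulRightL ℝ E W
      ((innerSL ℝ ζ).comp R) (f (φ + ζ))
    fun_prop

/-- Hölder's inequality with exponent 1/(1-θ) for ‖ζ‖ and 1/θ for ρ, followed by ρ^{1/θ} ≤ M^{1/θ-1}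
ρ. The constant depends only on the measure, R, M and θ, which makes the bound uniform over
families. -/
theorem CameronMartin.norm_fderiv_avg_le {γ : Measure E} [IsGaussian γ] {R : E →L[ℝ] E}
    (h : CameronMartin γ R) {M : ℝ} (hM0 : 0 ≤ M) {θ : ℝ} (h0 : 0 < θ) (h1 : θ < 1) :
    ∃ c, 0 ≤ c ∧ ∀ {W : Type} [NormedAddCommGroup W] [NormedSpace ℝ W] [CompleteSpace W]
      {f : E → W} {ρ : E → ℝ}, Continuous f → Continuous ρ → (∀ x, ‖f x‖ ≤ ρ x) →
      (∀ x, ρ x ≤ M) → ∀ φ, ‖fderiv ℝ (avg γ f) φ‖ ≤ c * avg γ ρ φ ^ θ := by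
  have hpq : (1 / θ).HolderConjugate (1 / (1 - θ)) := by
    rw [Real.holderConjugate_iff]
    refine ⟨by rw [lt_div_iff₀ h0]; linarith, by simp⟩
  set q := 1 / (1 - θ) with hq
  have hq0 : 0 < q := hpq.symm.pos
  have hL : MemLp (fun ζ : E => ‖ζ‖) (ENNReal.ofReal q) γ :=
    (IsGaussian.memLp_id γ (ENNReal.ofReal q) (by simp)).norm
  refine ⟨‖R‖ * ((∫ ζ, ‖ζ‖ ^ q ∂γ) ^ (1 / q) * M ^ (1 - θ)), ?_, ?_⟩
  · have : 0 ≤ ∫ ζ, ‖ζ‖ ^ q ∂γ := integral_nonneg fun ζ => by positivity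
    positivity
  intro W _ _ _ f ρ hf hρ hfρ hρM φ
  have hρ0 : ∀ x, 0 ≤ ρ x := fun x => (norm_nonneg _).trans (hfρ x)
  have hρM' : ∀ x, ‖ρ x‖ ≤ M := fun x => by rw [Real.norm_of_nonneg (hρ0 x)]; exact hρM x
  have hint : Integrable (fun ζ : E => ‖ζ‖ * ρ (φ + ζ)) γ := by
    refine ((integrable_exp_norm γ 1).mul_const M).mono'
      (aestronglyMeasurable_of_continuous (by fun_prop) γ) (Eventually.of_forall fun ζ => ?_)
    rw [norm_mul, norm_norm]
    have := Real.add_one_le_exp (1 * ‖ζ‖)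
    gcongr
    · linarith
    · exact hρM' _
  rw [(h.hasFDerivAt_avg hf (fun x => (hfρ x).trans (hρM x)) φ).fderiv]
  have s1 : ‖∫ ζ, ((innerSL ℝ ζ).comp R).smulRight (f (φ + ζ)) ∂γ‖ ≤
      ∫ ζ, ‖R‖ * (‖ζ‖ * ρ (φ + ζ)) ∂γ := by
    refine norm_integral_le_of_norm_le (hint.const_mul _) (Eventually.of_forall fun ζ => ?_)
    rw [ContinuousLinearMap.norm_smulRight_apply, ← mul_assoc]
    have e1 : ‖(innerSL ℝ ζ).comp R‖ ≤ ‖R‖ * ‖ζ‖ := by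
      refine (ContinuousLinearMap.opNorm_comp_le _ _).trans ?_
      rw [innerSL_apply_norm, mul_comm]
    gcongr
    exact hfρ _
  refine s1.trans ?_
  rw [integral_const_mul, mul_assoc]
  refine mul_le_mul_of_nonneg_left ?_ (norm_nonneg R)
  have hρLp : MemLp (fun ζ => ρ (φ + ζ)) (ENNReal.ofReal (1 / θ)) γ :=
    MemLp.of_bound (aestronglyMeasurable_of_continuous (by fun_prop) γ) M
      (Eventually.of_forall fun ζ => hρM' _)
  have s2 := integral_mul_le_Lp_mul_Lq_of_nonneg hpq.symm
    (Eventually.of_forall fun ζ : E => norm_nonneg ζ)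
    (Eventually.of_forall fun ζ => hρ0 (φ + ζ)) hL hρLp
  refine s2.trans ?_
  rw [mul_assoc]
  refine mul_le_mul_of_nonneg_left ?_
    (Real.rpow_nonneg (integral_nonneg fun ζ => by positivity) _)
  rw [one_div_one_div]
  have s3 : ∫ ζ, ρ (φ + ζ) ^ (1 / θ) ∂γ ≤ M ^ (1 / θ - 1) * avg γ ρ φ := by
    rw [avg, ← integral_const_mul]
    refine integral_mono_of_nonneg (Eventually.of_forall fun ζ => Real.rpow_nonneg (hρ0 _) _)
      ((integrable_shift hρ hρM' γ φ).const_mul _) (Eventually.of_forall fun ζ => ?_)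
    have hx := hρ0 (φ + ζ)
    have hθ' : 0 ≤ 1 / θ - 1 := by rw [sub_nonneg, le_div_iff₀ h0]; linarith
    calc ρ (φ + ζ) ^ (1 / θ) = ρ (φ + ζ) ^ (1 / θ - 1) * ρ (φ + ζ) := by
          conv_rhs => rw [← Real.rpow_one (ρ (φ + ζ)), ← Real.rpow_mul hx]
          rw [← Real.rpow_add_of_nonneg hx (by simpa using hθ') zero_le_one]
          norm_num
      _ ≤ _ := mul_le_mul_of_nonneg_right (Real.rpow_le_rpow hx (hρM _) hθ') hx
  have hA : 0 ≤ avg γ ρ φ := integral_nonneg fun ζ => hρ0 _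
  refine (Real.rpow_le_rpow (integral_nonneg fun ζ => Real.rpow_nonneg (hρ0 _) _) s3 h0.le).trans
    (le_of_eq ?_)
  rw [Real.mul_rpow (by positivity) hA, ← Real.rpow_mul hM0]
  congr 2
  field_simp

/-- Gaussian measures which gain `k` derivatives. -/
def Smoother : ℕ → Measure E → Prop
  | 0, γ => IsProbabilityMeasure γ
  | k + 1, γ => ∃ γ₁ γ₂ : Measure E, IsGaussian γ₁ ∧ IsProbabilityMeasure γ₂ ∧ γ = γ₂.conv γ₁ ∧
      (∃ R, CameronMartin γ₁ R) ∧ Smoother k γ₂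

theorem avg_conv {W : Type} [NormedAddCommGroup W] [NormedSpace ℝ W] [CompleteSpace W]
    (γ₁ γ₂ : Measure E) [IsProbabilityMeasure γ₁] [IsProbabilityMeasure γ₂] {f : E → W}
    (hf : Continuous f) {M : ℝ} (hM : ∀ x, ‖f x‖ ≤ M) :
    avg (γ₂.conv γ₁) f = avg γ₂ (avg γ₁ f) := by
  funext φ
  rw [avg, integral_conv (integrable_shift hf hM _ φ)]
  simp only [avg, add_assoc]

/-- One Gaussian factor pays for one derivative, at the price of replacing the weight by a power θ
of its average. The derivative is again a continuous function dominated by a bounded weight, so the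
remaining factors handle it by induction. -/
theorem Smoother.tame_avg {ι : Type} (k : ℕ) : ∀ {γ : Measure E}, Smoother k γ →
    ∀ {W : Type} [NormedAddCommGroup W] [NormedSpace ℝ W] [CompleteSpace W] {f : ι → E → W}
      {ρ : ι → E → ℝ} {M : ℝ}, (∀ i, Continuous (f i)) → (∀ i, Continuous (ρ i)) →
      (∀ i x, ‖f i x‖ ≤ ρ i x) → 0 ≤ M → (∀ i x, ρ i x ≤ M) →
      Tame k (fun i => avg γ (ρ i)) (fun i => avg γ (f i)) := by
  have hzero : ∀ {γ : Measure E}, IsProbabilityMeasure γ →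
      ∀ {W : Type} [NormedAddCommGroup W] [NormedSpace ℝ W] [CompleteSpace W] {f : ι → E → W}
      {ρ : ι → E → ℝ} {M : ℝ}, (∀ i, Continuous (f i)) → (∀ i, Continuous (ρ i)) →
      (∀ i x, ‖f i x‖ ≤ ρ i x) → 0 ≤ M → (∀ i x, ρ i x ≤ M) →
      Tame 0 (fun i => avg γ (ρ i)) (fun i => avg γ (f i)) := by
    intro γ _ W _ _ _ f ρ M hf hρ hfρ hM0 hM
    have hρ0 : ∀ i x, 0 ≤ ρ i x := fun i x => (norm_nonneg _).trans (hfρ i x)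
    have hρM : ∀ i x, ‖ρ i x‖ ≤ M := fun i x => by
      rw [Real.norm_of_nonneg (hρ0 i x)]; exact hM i x
    refine ⟨fun i => contDiff_zero.2
      (continuous_avg (hf i) (fun x => (hfρ i x).trans (hM i x)) γ), fun j hj θ h0 h1 => ?_⟩
    obtain rfl : j = 0 := by lia
    refine ⟨M ^ (1 - θ), by positivity, fun i x => ?_⟩
    rw [norm_iteratedFDeriv_zero]
    have hA : 0 ≤ avg γ (ρ i) x := integral_nonneg fun ζ => hρ0 i _
    have hA' : avg γ (ρ i) x ≤ M := by
      have := norm_avg_le_const (hρM i) γ x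
      rwa [Real.norm_of_nonneg hA] at this
    refine (norm_avg_le (hρ i) (hρM i) (hfρ i) γ x).trans ?_
    calc avg γ (ρ i) x = avg γ (ρ i) x ^ (1 - θ) * avg γ (ρ i) x ^ θ := by
          rw [← Real.rpow_add_of_nonneg hA (by linarith) h0.le]
          norm_num
      _ ≤ _ := by
          gcongr
  induction k with
  | zero => exact fun h => hzero h
  | succ k ih =>
    intro γ hγ W _ _ _ f ρ M hf hρ hfρ hM0 hM
    obtain ⟨γ₁, γ₂, hγ₁, hγ₂, rfl, ⟨R, hR⟩, hS⟩ := hγ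
    have hρ0 : ∀ i x, 0 ≤ ρ i x := fun i x => (norm_nonneg _).trans (hfρ i x)
    have hρM : ∀ i x, ‖ρ i x‖ ≤ M := fun i x => by
      rw [Real.norm_of_nonneg (hρ0 i x)]; exact hM i x
    have hfM : ∀ i x, ‖f i x‖ ≤ M := fun i x => (hfρ i x).trans (hM i x)
    have eρ : ∀ i, avg (γ₂.conv γ₁) (ρ i) = avg γ₂ (avg γ₁ (ρ i)) := fun i =>
      avg_conv γ₁ γ₂ (hρ i) (hρM i)
    have ef : ∀ i, avg (γ₂.conv γ₁) (f i) = avg γ₂ (avg γ₁ (f i)) := fun i =>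
      avg_conv γ₁ γ₂ (hf i) (hfM i)
    set g : ι → E → E →L[ℝ] W := fun i => fderiv ℝ (avg γ₁ (f i)) with hg
    have hC1 : ∀ i, ContDiff ℝ 1 (avg γ₁ (f i)) := fun i => hR.contDiff_one_avg (hf i) (hfM i)
    have hgc : ∀ i, Continuous (g i) := fun i => (hC1 i).continuous_fderiv one_ne_zero
    have hA : ∀ i x, 0 ≤ avg γ₁ (ρ i) x := fun i x => integral_nonneg fun ζ => hρ0 i _
    have hA' : ∀ i x, avg γ₁ (ρ i) x ≤ M := fun i x => by
      have := norm_avg_le_const (hρM i) γ₁ x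
      rwa [Real.norm_of_nonneg (hA i x)] at this
    have hAc : ∀ i, Continuous (avg γ₁ (ρ i)) := fun i => continuous_avg (hρ i) (hρM i) γ₁
    have htame : ∀ θ : ℝ, 0 < θ → θ < 1 → ∃ c, 0 ≤ c ∧
        Tame k (fun i => avg γ₂ (fun x => c * avg γ₁ (ρ i) x ^ θ)) (fun i => avg γ₂ (g i)) ∧
        ∀ i x, ‖g i x‖ ≤ c * avg γ₁ (ρ i) x ^ θ := by
      intro θ h0 h1
      obtain ⟨c, hc, hcg⟩ := hR.norm_fderiv_avg_le hM0 h0 h1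
      have hle : ∀ i x, ‖g i x‖ ≤ c * avg γ₁ (ρ i) x ^ θ := fun i x =>
        hcg (hf i) (hρ i) (hfρ i) (hM i) x
      refine ⟨c, hc, ih hS (M := c * M ^ θ) hgc (fun i => ?_) hle (by positivity)
        (fun i x => ?_), hle⟩
      · exact continuous_const.mul ((hAc i).rpow_const fun x => Or.inr h0.le)
      · have := hA i x
        have := hA' i x
        gcongr
    obtain ⟨c, hc, ht, hle⟩ := htame (1 / 2) (by norm_num) (by norm_num)
    have hgM : ∀ i x, ‖g i x‖ ≤ c * M ^ (1 / 2 : ℝ) := fun i x => (hle i x).trans (by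
      have := hA i x
      have := hA' i x
      gcongr)
    have hfd : ∀ i, fderiv ℝ (avg γ₂ (avg γ₁ (f i))) = avg γ₂ (g i) := fun i =>
      fderiv_avg (hC1 i) (fun x => norm_avg_le_const (hfM i) γ₁ x) (hgM i) γ₂
    simp_rw [eρ, ef]
    refine ⟨fun i => ?_, fun j hj θ h0 h1 => ?_⟩
    · push_cast
      refine contDiff_succ_iff_fderiv.2 ⟨fun φ => (hasFDerivAt_avg (hC1 i)
        (fun x => norm_avg_le_const (hfM i) γ₁ x) (hgM i) γ₂ φ).differentiableAt, by simp, ?_⟩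
      rw [hfd]
      exact ht.1 i
    · cases j with
      | zero =>
        exact (hzero hγ₂ (fun i => (hC1 i).continuous) hAc (fun i x =>
          norm_avg_le (hρ i) (hρM i) (hfρ i) γ₁ x) hM0 hA').2 0 le_rfl θ h0 h1
      | succ j =>
        -- The exponent is lost twice, once in the first derivative and once in the induction
        -- hypothesis. Using √θ each time gives θ in total.
        have hs0 : 0 < Real.sqrt θ := Real.sqrt_pos.2 h0
        have hs1 : Real.sqrt θ < 1 := by rw [Real.sqrt_lt' one_pos]; simpa using h1
        obtain ⟨c, hc, ht, hle⟩ := htame (Real.sqrt θ) hs0 hs1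
        obtain ⟨c', hc', hb⟩ := ht.2 j (by lia) (Real.sqrt θ) hs0 hs1
        refine ⟨c' * c ^ Real.sqrt θ, by positivity, fun i x => ?_⟩
        rw [← norm_iteratedFDeriv_fderiv, hfd, mul_assoc]
        refine (hb i x).trans (mul_le_mul_of_nonneg_left ?_ hc')
        have hB : 0 ≤ avg γ₂ (avg γ₁ (ρ i)) x := integral_nonneg fun ζ => hA i _
        have hBθ : 0 ≤ avg γ₂ (fun x => avg γ₁ (ρ i) x ^ Real.sqrt θ) x :=
          integral_nonneg fun ζ => Real.rpow_nonneg (hA i _) _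
        beta_reduce
        rw [avg_const_mul, Real.mul_rpow hc hBθ]
        refine mul_le_mul_of_nonneg_left ?_ (by positivity)
        have := avg_rpow_le (hAc i) (hA i) (hA' i) hs0 hs1.le γ₂ x
        calc avg γ₂ (fun x => avg γ₁ (ρ i) x ^ Real.sqrt θ) x ^ Real.sqrt θ
            ≤ (avg γ₂ (avg γ₁ (ρ i)) x ^ Real.sqrt θ) ^ Real.sqrt θ := by gcongr
          _ = avg γ₂ (avg γ₁ (ρ i)) x ^ θ := by
            rw [← Real.rpow_mul hB, Real.mul_self_sqrt h0.le]

end CameronMartin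

/-! ### Positive definite covariances on X are smoothing -/

section Smoothing

variable {N : ℕ} (dC : ℝ → Mat N)

/-- Positive definiteness on `X`. -/
def PosOn (C : Mat N) : Prop := ∀ a : fieldSpace dC, a ≠ 0 → 0 < quadForm C (a : Vec N)

/-- The compression of `C` to `X`. -/
def compress (C : Mat N) : fieldSpace dC →ₗ[ℝ] fieldSpace dC :=
  (projX dC).toLinearMap ∘ₗ Matrix.toEuclideanLin C ∘ₗ (fieldSpace dC).subtype

theorem compress_apply (C : Mat N) (a : fieldSpace dC) :
    compress dC C a = toX dC (Matrix.toEuclideanLin C (a : Vec N)) := rfl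

theorem inner_compress (C : Mat N) (a : fieldSpace dC) :
    inner ℝ a (compress dC C a) = quadForm C (a : Vec N) := by
  rw [compress_apply, real_inner_comm, inner_toX, real_inner_comm, quadForm_eq_inner]

/-- A kernel vector of the compression would be a null vector of the form on X. In finite dimension
injectivity suffices, and the inverse is the operator R of the Cameron–Martin formula. -/
theorem PosOn.exists_inverse {C : Mat N} (h : PosOn dC C) :
    ∃ R : fieldSpace dC →L[ℝ] fieldSpace dC, ∀ v, compress dC C (R v) = v := by
  have hinj : Function.Injective (compress dC C) := by
    rw [← LinearMap.ker_eq_bot, LinearMap.ker_eq_bot']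
    intro a ha
    by_contra hne
    have := h a hne
    rw [← inner_compress, ha, inner_zero_right] at this
    exact lt_irrefl _ this
  refine ⟨LinearMap.toContinuousLinearMap
    (LinearEquiv.ofInjectiveEndo _ hinj).symm.toLinearMap, fun v => ?_⟩
  exact (LinearEquiv.ofInjectiveEndo _ hinj).apply_symm_apply v

theorem quadForm_nonneg {C : Mat N} (hC : C.PosSemidef) (u : Vec N) : 0 ≤ quadForm C u := by
  rw [← norm_sqrt_apply_sq hC]; positivity

theorem PosOn.exists_cameronMartin {C : Mat N} (hC : C.PosSemidef) (h : PosOn dC C) :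
    ∃ R, CameronMartin (gaussian dC C) R := by
  obtain ⟨R, hR⟩ := h.exists_inverse
  have hq : ∀ v, inner ℝ (R v) v = quadForm C (R v : Vec N) := fun v => by
    rw [← inner_compress, hR]
  refine ⟨R, fun v => by rw [hq]; exact quadForm_nonneg hC _, fun v W _ _ f hf => ?_⟩
  have := integral_gaussian_shift dC hC (R v) hf
  rw [← compress_apply, hR] at this
  rw [this, hq]

theorem quadForm_smul (r : ℝ) (C : Mat N) (u : Vec N) :
    quadForm (r • C) u = r * quadForm C u := by
  simp only [quadForm, Finset.mul_sum, Matrix.smul_apply, smul_eq_mul]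
  exact Finset.sum_congr rfl fun i _ => Finset.sum_congr rfl fun j _ => by ring

/-- Halving the covariance splits the measure into two nondegenerate Gaussians, and one of them is
split again. Any number of derivatives can be gained in this way. -/
theorem PosOn.smoother {C : Mat N} (hC : C.PosSemidef) (h : PosOn dC C) (k : ℕ) :
    Smoother k (gaussian dC C) := by
  induction k generalizing C with
  | zero => exact isProbabilityMeasure_gaussian dC C
  | succ k ih =>
    have hC2 : ((1 / 2 : ℝ) • C).PosSemidef := hC.smul (by norm_num)
    have h2 : PosOn dC ((1 / 2 : ℝ) • C) := fun a ha => by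
      rw [quadForm_smul]
      have := h a ha
      positivity
    refine ⟨gaussian dC ((1 / 2 : ℝ) • C), gaussian dC ((1 / 2 : ℝ) • C), inferInstance,
      inferInstance, ?_, h2.exists_cameronMartin dC hC2, ih hC2 h2⟩
    rw [← gaussian_add dC hC2 hC2, ← add_smul]
    norm_num

end Smoothing

/-! ### Taylor estimates for functions with three bounded derivatives -/

section Taylor

variable {E W : Type} [NormedAddCommGroup E] [NormedSpace ℝ E] [NormedAddCommGroup W]
  [NormedSpace ℝ W]

theorem norm_sub_le_of_fderiv_bound {f : E → W} (hf : Differentiable ℝ f) {c : ℝ}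
    (hc : ∀ x, ‖fderiv ℝ f x‖ ≤ c) (x y : E) : ‖f (x + y) - f x‖ ≤ c * ‖y‖ := by
  have := convex_univ.norm_image_sub_le_of_norm_fderiv_le (f := f) (𝕜 := ℝ) (x := x) (y := x + y)
    (fun z _ => hf z) (fun z _ => hc z) (mem_univ _) (mem_univ _)
  simpa using this

/-- `C³` with derivatives bounded by `c`. -/
def BddC3 (c : ℝ) (f : E → W) : Prop :=
  ContDiff ℝ 3 f ∧ ∀ j ≤ 3, ∀ x, ‖iteratedFDeriv ℝ j f x‖ ≤ c

theorem BddC3.norm_le {c : ℝ} {f : E → W} (h : BddC3 c f) (x : E) : ‖f x‖ ≤ c := by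
  simpa using h.2 0 (by norm_num) x

theorem BddC3.norm_fderiv_le {c : ℝ} {f : E → W} (h : BddC3 c f) (x : E) :
    ‖fderiv ℝ f x‖ ≤ c := by
  have := h.2 1 (by norm_num) x
  rwa [← norm_iteratedFDeriv_fderiv, norm_iteratedFDeriv_zero] at this

theorem BddC3.norm_fderiv_fderiv_le {c : ℝ} {f : E → W} (h : BddC3 c f) (x : E) :
    ‖fderiv ℝ (fderiv ℝ f) x‖ ≤ c := by
  have := h.2 2 (by norm_num) x
  rwa [← norm_iteratedFDeriv_fderiv, ← norm_iteratedFDeriv_fderiv, norm_iteratedFDeriv_zero] at this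

theorem BddC3.norm_fderiv_fderiv_fderiv_le {c : ℝ} {f : E → W} (h : BddC3 c f) (x : E) :
    ‖fderiv ℝ (fderiv ℝ (fderiv ℝ f)) x‖ ≤ c := by
  have := h.2 3 (by norm_num) x
  rwa [← norm_iteratedFDeriv_fderiv, ← norm_iteratedFDeriv_fderiv, ← norm_iteratedFDeriv_fderiv,
    norm_iteratedFDeriv_zero] at this

theorem BddC3.continuous {c : ℝ} {f : E → W} (h : BddC3 c f) : Continuous f := h.1.continuous

theorem BddC3.nonneg {c : ℝ} {f : E → W} (h : BddC3 c f) : 0 ≤ c :=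
  (norm_nonneg _).trans (h.norm_le 0)

theorem BddC3.contDiff_fderiv {c : ℝ} {f : E → W} (h : BddC3 c f) : ContDiff ℝ 2 (fderiv ℝ f) :=
  h.1.fderiv_right (by norm_num)

theorem BddC3.contDiff_fderiv_fderiv {c : ℝ} {f : E → W} (h : BddC3 c f) :
    ContDiff ℝ 1 (fderiv ℝ (fderiv ℝ f)) :=
  h.contDiff_fderiv.fderiv_right (by norm_num)

theorem norm_fderiv_add_sub_le {f : E → W} (hf : ContDiff ℝ 2 f) {c : ℝ}
    (hc : ∀ x, ‖fderiv ℝ (fderiv ℝ f) x‖ ≤ c) (x y : E) :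
    ‖f (x + y) - f x - fderiv ℝ f x y‖ ≤ c * ‖y‖ ^ 2 := by
  have hf1 : Differentiable ℝ f := hf.differentiable (by norm_num)
  have hf2 : Differentiable ℝ (fderiv ℝ f) :=
    (hf.fderiv_right (m := 1) (by norm_num)).differentiable (by norm_num)
  have hc0 : 0 ≤ c := (norm_nonneg _).trans (hc 0)
  have := (convex_closedBall (0 : E) ‖y‖).norm_image_sub_le_of_norm_hasFDerivWithin_le (𝕜 := ℝ)
    (f := fun z => f (x + z) - fderiv ℝ f x z) (f' := fun z => fderiv ℝ f (x + z) - fderiv ℝ f x)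
    (C := c * ‖y‖) (x := 0) (y := y)
    (fun z _ => by
      refine HasFDerivAt.hasFDerivWithinAt ?_
      refine HasFDerivAt.sub ?_ (fderiv ℝ f x).hasFDerivAt
      exact (hf1 (x + z)).hasFDerivAt.comp z ((hasFDerivAt_id z).const_add x))
    (fun z hz => (norm_sub_le_of_fderiv_bound hf2 hc x z).trans
      (mul_le_mul_of_nonneg_left (by simpa using hz) hc0)) (by simp) (by simp)
  simp only [add_zero, map_zero, sub_zero] at this
  calc ‖f (x + y) - f x - fderiv ℝ f x y‖ = ‖f (x + y) - fderiv ℝ f x y - f x‖ := by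
        congr 1; abel
    _ ≤ _ := by rw [pow_two, ← mul_assoc]; exact this

/-- Taylor's formula of order two. -/
theorem BddC3.taylor {c : ℝ} {f : E → ℝ} (h : BddC3 c f) (x y : E) :
    |f (x + y) - f x - fderiv ℝ f x y - fderiv ℝ (fderiv ℝ f) x y y / 2| ≤ c * ‖y‖ ^ 3 := by
  have hf1 : Differentiable ℝ f := h.1.differentiable (by norm_num)
  have hf2 : Differentiable ℝ (fderiv ℝ f) := h.contDiff_fderiv.differentiable (by norm_num)
  have hsymm : ∀ v w, fderiv ℝ (fderiv ℝ f) x v w = fderiv ℝ (fderiv ℝ f) x w v := fun v w =>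
    second_derivative_symmetric (fun y => (hf1 y).hasFDerivAt) (hf2 x).hasFDerivAt v w
  set B := fderiv ℝ (fderiv ℝ f) x with hB
  have := (convex_closedBall (0 : E) ‖y‖).norm_image_sub_le_of_norm_hasFDerivWithin_le (𝕜 := ℝ)
    (f := fun z => f (x + z) - fderiv ℝ f x z - B z z / 2)
    (f' := fun z => fderiv ℝ f (x + z) - fderiv ℝ f x - B z)
    (C := c * ‖y‖ ^ 2) (x := 0) (y := y)
    (fun z _ => by
      refine HasFDerivAt.hasFDerivWithinAt ?_
      have e1 : HasFDerivAt (fun z => f (x + z)) (fderiv ℝ f (x + z)) z :=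
        (hf1 (x + z)).hasFDerivAt.comp z ((hasFDerivAt_id z).const_add x)
      have e2 := ((B.hasFDerivAt (x := z)).clm_apply (hasFDerivAt_id z)).mul_const (1 / 2 : ℝ)
      have e3 := (e1.sub (fderiv ℝ f x).hasFDerivAt).sub e2
      refine (e3.congr_fderiv ?_).congr_of_eventuallyEq (Eventually.of_forall fun w => ?_)
      · ext v
        simp [hsymm v z]
        ring
      · simp [div_eq_mul_inv])
    (fun z hz => (norm_fderiv_add_sub_le h.contDiff_fderiv h.norm_fderiv_fderiv_fderiv_le x z).trans
      (mul_le_mul_of_nonneg_left (by gcongr; simpa using hz) h.nonneg)) (by simp) (by simp)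
  simp only [add_zero, map_zero, sub_zero, zero_div] at this
  rw [Real.norm_eq_abs] at this
  calc |f (x + y) - f x - fderiv ℝ f x y - B y y / 2|
      = |f (x + y) - fderiv ℝ f x y - B y y / 2 - f x| := by congr 1; ring
    _ ≤ _ := by rw [pow_succ, ← mul_assoc]; exact this

end Taylor

/-! ### Estimates for the second order operator of a covariance matrix -/

section TraceForm

variable {N : ℕ} {E : Type} [NormedAddCommGroup E] [NormedSpace ℝ E]

/-- `∑_{i,j} ‖e_i‖ ‖e_j‖`. -/
def frameSize (e : Fin N → E) : ℝ := ∑ i, ∑ j, ‖e i‖ * ‖e j‖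

theorem frameSize_nonneg (e : Fin N → E) : 0 ≤ frameSize e :=
  Finset.sum_nonneg fun _ _ => Finset.sum_nonneg fun _ _ => by positivity

theorem abs_traceForm_le (e : Fin N → E) {A : Mat N} {a : ℝ} (hA : ∀ i j, |A i j| ≤ a)
    (B : E →L[ℝ] E →L[ℝ] ℝ) : |traceForm e A B| ≤ a * frameSize e * ‖B‖ := by
  rw [traceForm, frameSize, mul_assoc, Finset.sum_mul, Finset.mul_sum]
  refine (Finset.abs_sum_le_sum_abs _ _).trans (Finset.sum_le_sum fun i _ => ?_)
  rw [Finset.sum_mul, Finset.mul_sum]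
  refine (Finset.abs_sum_le_sum_abs _ _).trans (Finset.sum_le_sum fun j _ => ?_)
  rw [abs_mul]
  have h1 := B.le_opNorm₂ (e i) (e j)
  rw [Real.norm_eq_abs] at h1
  have := (abs_nonneg _).trans (hA i j)
  calc |A i j| * |B (e i) (e j)| ≤ a * (‖B‖ * ‖e i‖ * ‖e j‖) := by
        gcongr
        exact hA i j
    _ = _ := by ring

theorem traceForm_sub_left (e : Fin N → E) (A A' : Mat N) (B : E →L[ℝ] E →L[ℝ] ℝ) :
    traceForm e (A - A') B = traceForm e A B - traceForm e A' B := by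
  simp only [traceForm, Matrix.sub_apply, sub_mul, Finset.sum_sub_distrib]

theorem traceForm_sub_right (e : Fin N → E) (A : Mat N) (B B' : E →L[ℝ] E →L[ℝ] ℝ) :
    traceForm e A (B - B') = traceForm e A B - traceForm e A B' := by
  simp only [traceForm, sub_apply, mul_sub, Finset.sum_sub_distrib]

theorem continuous_traceForm (e : Fin N → E) (A : Mat N) :
    Continuous fun B : E →L[ℝ] E →L[ℝ] ℝ => traceForm e A B := by
  unfold traceForm
  fun_prop

theorem hasDerivAt_traceForm (e : Fin N → E) {C : ℝ → Mat N} {dC : Mat N} {t : ℝ}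
    (h : ∀ i j, HasDerivAt (fun t => C t i j) (dC i j) t) (B : E →L[ℝ] E →L[ℝ] ℝ) :
    HasDerivAt (fun s => traceForm e (C s) B) (traceForm e dC B) t :=
  HasDerivAt.fun_sum fun i _ => HasDerivAt.fun_sum fun j _ => (h i j).mul_const _

end TraceForm

/-- An increment of order |s-t|^{3/2} is negligible against s - t. The third moment of a Gaussian
increment produces errors of exactly this order. -/
theorem hasDerivAt_zero_of_bound {g : ℝ → ℝ} {t c : ℝ}
    (h : ∀ᶠ s in 𝓝 t, |g s - g t| ≤ c * (|s - t| * √|s - t|)) : HasDerivAt g 0 t := by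
  rw [hasDerivAt_iff_isLittleO]
  have h1 : (fun s => g s - g t - (s - t) • (0 : ℝ)) =O[𝓝 t] fun s => (s - t) * √|s - t| := by
    refine Asymptotics.IsBigO.of_bound c ?_
    filter_upwards [h] with s hs
    simpa [abs_mul, abs_of_nonneg (Real.sqrt_nonneg _)] using hs
  refine h1.trans_isLittleO ?_
  have h2 : (fun s => √|s - t|) =o[𝓝 t] fun _ => (1 : ℝ) := by
    rw [Asymptotics.isLittleO_one_iff]
    have : Continuous fun s => √|s - t| := by fun_prop
    simpa using this.tendsto t
  simpa using (Asymptotics.isBigO_refl (fun s => s - t) (𝓝 t)).mul_isLittleO h2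

/-! ### Averages of functions with three bounded derivatives -/

section AverageC3

variable {E W : Type} [NormedAddCommGroup E] [NormedSpace ℝ E] [FiniteDimensional ℝ E]
  [MeasurableSpace E] [BorelSpace E] [NormedAddCommGroup W] [NormedSpace ℝ W] [CompleteSpace W]

theorem BddC3.bddSmooth {c : ℝ} {f : E → W} (h : BddC3 c f) : BddSmooth 3 f :=
  ⟨h.1, fun j hj => ⟨c, h.2 j hj⟩⟩

theorem BddC3.avg {c : ℝ} {f : E → W} (h : BddC3 c f) (μ : Measure E) [IsProbabilityMeasure μ] :
    BddC3 c (Polchinski.avg μ f) := by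
  obtain ⟨h1, h2⟩ := contDiff_avg_and_norm_iteratedFDeriv_avg_le 3 h.bddSmooth μ
  refine ⟨h1, fun j hj x => (h2 j hj x).trans ?_⟩
  have := norm_avg_le_const (f := fun x => ‖iteratedFDeriv ℝ j f x‖)
    (fun y => by simpa using h.2 j hj y) μ x
  exact (le_abs_self _).trans this

theorem BddC3.fderiv_avg {c : ℝ} {f : E → W} (h : BddC3 c f) (μ : Measure E)
    [IsProbabilityMeasure μ] : fderiv ℝ (Polchinski.avg μ f) = Polchinski.avg μ (fderiv ℝ f) :=
  Polchinski.fderiv_avg (h.1.of_le (by norm_num)) h.norm_le h.norm_fderiv_le μ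

theorem BddC3.fderiv_fderiv_avg {c : ℝ} {f : E → W} (h : BddC3 c f) (μ : Measure E)
    [IsProbabilityMeasure μ] : fderiv ℝ (fderiv ℝ (Polchinski.avg μ f)) =
      Polchinski.avg μ (fderiv ℝ (fderiv ℝ f)) := by
  rw [h.fderiv_avg]
  exact Polchinski.fderiv_avg (h.contDiff_fderiv.of_le (by norm_num)) h.norm_fderiv_le
    h.norm_fderiv_fderiv_le μ

end AverageC3

/-! ### The heat equation and integration against the decreasing Gaussian measures -/

section Flow

variable {N : ℕ} {E : Type} [NormedAddCommGroup E] [NormedSpace ℝ E] [FiniteDimensional ℝ E]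
  [MeasurableSpace E] [BorelSpace E]

/-- A flow of centred Gaussian measures `μ s t` with covariance `C t - C s` in the frame `e`,
together with the remaining measures `D t`, such that `D s` is the convolution of `D t` and
`μ s t`. -/
structure GaussianFlow (e : Fin N → E) (dC C : ℝ → Mat N) (μ : ℝ → ℝ → Measure E)
    (D : ℝ → Measure E) (K : ℝ) : Prop where
  prob : ∀ s t, IsProbabilityMeasure (μ s t)
  probD : ∀ t, IsProbabilityMeasure (D t)
  conv : ∀ r s t, 0 ≤ r → r ≤ s → s ≤ t → μ r t = (μ s t).conv (μ r s)
  convD : ∀ s t, 0 ≤ s → s ≤ t → D s = (D t).conv (μ s t)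
  centred : ∀ s t, 0 ≤ s → s ≤ t → ∀ ℓ : E →L[ℝ] ℝ, ∫ ζ, ℓ ζ ∂μ s t = 0
  second : ∀ s t, 0 ≤ s → s ≤ t → ∀ B : E →L[ℝ] E →L[ℝ] ℝ,
    ∫ ζ, B ζ ζ ∂μ s t = traceForm e (C t - C s) B
  integrable : ∀ s t, ∀ p : ℕ, Integrable (fun ζ => ‖ζ‖ ^ p) (μ s t)
  moment : ∀ s t, 0 ≤ s → s ≤ t → ∀ p ≤ 4, ∫ ζ, ‖ζ‖ ^ p ∂μ s t ≤ K * √(t - s) ^ p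
  lip : ∀ s t, 0 ≤ s → s ≤ t → ∀ i j, |C t i j - C s i j| ≤ K * (t - s)
  deriv : ∀ t, 0 < t → ∀ i j, HasDerivAt (fun t => C t i j) (dC t i j) t
  bound : ∀ t, 0 < t → ∀ i j, |dC t i j| ≤ K

namespace GaussianFlow

variable {e : Fin N → E} {dC C : ℝ → Mat N} {μ : ℝ → ℝ → Measure E} {D : ℝ → Measure E} {K : ℝ}
  (H : GaussianFlow e dC C μ D K)
include H

theorem K_nonneg : 0 ≤ K := by
  have := H.prob 0 1
  have h := H.moment 0 1 le_rfl zero_le_one 0 (by norm_num)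
  simp at h
  linarith

theorem avg_avg {W : Type} [NormedAddCommGroup W] [NormedSpace ℝ W] [CompleteSpace W]
    {r s t : ℝ} (hr : 0 ≤ r) (hrs : r ≤ s) (hst : s ≤ t) {f : E → W} (hf : Continuous f) {M : ℝ}
    (hM : ∀ x, ‖f x‖ ≤ M) : avg (μ r t) f = avg (μ s t) (avg (μ r s) f) := by
  have := H.prob s t
  have := H.prob r s
  rw [H.conv r s t hr hrs hst]
  funext φ
  rw [avg, integral_conv (integrable_shift hf hM _ φ)]
  simp only [avg, add_assoc]

theorem integral_D {s t : ℝ} (hs : 0 ≤ s) (hst : s ≤ t) {f : E → ℝ} (hf : Continuous f) {M : ℝ}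
    (hM : ∀ x, ‖f x‖ ≤ M) : ∫ φ, f φ ∂D s = ∫ φ, avg (μ s t) f φ ∂D t := by
  have := H.probD t
  have := H.prob s t
  rw [H.convD s t hs hst, integral_conv (integrable_of_continuous_of_bound hf hM _)]
  rfl

theorem integrable_D {f : E → ℝ} (hf : Continuous f) {M : ℝ}
    (hM : ∀ x, ‖f x‖ ≤ M) (t : ℝ) : Integrable f (D t) :=
  have := H.probD t
  integrable_of_continuous_of_bound hf hM _

theorem norm_avg_sub_le {W : Type} [NormedAddCommGroup W] [NormedSpace ℝ W] [CompleteSpace W]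
    {s t : ℝ} (hs : 0 ≤ s) (hst : s ≤ t) {f : E → W} (hf : Continuous f) {M c : ℝ}
    (hM : ∀ x, ‖f x‖ ≤ M) (hc0 : 0 ≤ c) (hc : ∀ x y, ‖f (x + y) - f x‖ ≤ c * ‖y‖) (φ : E) :
    ‖avg (μ s t) f φ - f φ‖ ≤ c * (K * √(t - s)) := by
  have := H.prob s t
  have h1 : avg (μ s t) f φ - f φ = ∫ ζ, (f (φ + ζ) - f φ) ∂μ s t := by
    rw [integral_sub (integrable_shift hf hM _ φ) (integrable_const _)]
    simp [avg]
  rw [h1]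
  have h2 := H.integrable s t 1
  have h3 := H.moment s t hs hst 1 (by norm_num)
  simp only [pow_one] at h2 h3
  refine (norm_integral_le_of_norm_le (h2.const_mul c)
    (Eventually.of_forall fun ζ => hc φ ζ)).trans ?_
  rw [integral_const_mul]
  gcongr

/-- In the Taylor expansion the linear term averages to zero, the quadratic one to the trace against
the covariance increment, and the remainder is controlled by the third moment. -/
theorem abs_avg_taylor_le {s t : ℝ} (hs : 0 ≤ s) (hst : s ≤ t) {f : E → ℝ} {c : ℝ}
    (hf : BddC3 c f) (φ : E) :
    |avg (μ s t) f φ - f φ - traceForm e (C t - C s) (fderiv ℝ (fderiv ℝ f) φ) / 2| ≤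
      c * (K * ((t - s) * √(t - s))) := by
  have := H.prob s t
  have hc := hf.continuous
  have i1 := H.integrable s t 1
  have i2 := H.integrable s t 2
  have i3 := H.integrable s t 3
  simp only [pow_one] at i1
  set ℓ := fderiv ℝ f φ
  set B := fderiv ℝ (fderiv ℝ f) φ
  have iℓ : Integrable (fun ζ => ℓ ζ) (μ s t) :=
    (i1.const_mul ‖ℓ‖).mono' (aestronglyMeasurable_of_continuous (by fun_prop) _)
      (Eventually.of_forall fun ζ => ℓ.le_opNorm ζ)
  have iB : Integrable (fun ζ => B ζ ζ) (μ s t) :=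
    (i2.const_mul ‖B‖).mono' (aestronglyMeasurable_of_continuous (by fun_prop) _)
      (Eventually.of_forall fun ζ => by
        have := B.le_opNorm₂ ζ ζ
        rwa [mul_assoc, ← pow_two] at this)
  have is := integrable_shift hc hf.norm_le (μ s t) φ
  have h1 : avg (μ s t) f φ - f φ - traceForm e (C t - C s) B / 2 =
      ∫ ζ, (f (φ + ζ) - f φ - ℓ ζ - B ζ ζ / 2) ∂μ s t := by
    have j1 : Integrable (fun ζ => f (φ + ζ) - f φ) (μ s t) := is.sub (integrable_const _)
    have j2 : Integrable (fun ζ => f (φ + ζ) - f φ - ℓ ζ) (μ s t) := j1.sub iℓ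
    rw [integral_sub j2 (iB.div_const 2), integral_sub j1 iℓ, integral_sub is (integrable_const _),
      H.centred s t hs hst, integral_div, H.second s t hs hst]
    simp [avg]
  rw [h1, ← Real.norm_eq_abs]
  have h3 := H.moment s t hs hst 3 (by norm_num)
  refine (norm_integral_le_of_norm_le (i3.const_mul c)
    (Eventually.of_forall fun ζ => hf.taylor φ ζ)).trans ?_
  rw [integral_const_mul]
  have hn := hf.nonneg
  have : √(t - s) ^ 3 = (t - s) * √(t - s) := by
    rw [pow_succ, Real.sq_sqrt (by linarith)]
  rw [this] at h3
  gcongr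

/-- The heat equation for averages of smooth functions. -/
theorem hasDerivAt_avg {t₀ t : ℝ} (h0 : 0 ≤ t₀) (ht : t₀ < t) {f : E → ℝ} {c : ℝ}
    (hf : BddC3 c f) (φ : E) :
    HasDerivAt (fun t => avg (μ t₀ t) f φ)
      (traceForm e (dC t) (fderiv ℝ (fderiv ℝ (avg (μ t₀ t) f)) φ) / 2) t := by
  have hprob := H.prob
  have hK := H.K_nonneg
  have hc0 := hf.nonneg
  set F : ℝ → E → ℝ := fun t => avg (μ t₀ t) f with hF
  have hF3 : ∀ t, BddC3 c (F t) := fun t => hf.avg (μ t₀ t)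
  have hstep : ∀ s t, t₀ ≤ s → s ≤ t → F t = avg (μ s t) (F s) := fun s t h1 h2 =>
    H.avg_avg h0 h1 h2 hf.continuous hf.norm_le
  set B := fderiv ℝ (fderiv ℝ (F t)) φ with hB
  have hbd : ∀ s, t₀ ≤ s → |F s φ - F t φ - traceForm e (C s - C t) B / 2| ≤
      (c * K + K * frameSize e * (c * K)) * (|s - t| * √|s - t|) := by
    intro s hs
    -- For s ≥ t the expansion starts from F t itself. For s ≤ t it starts from F s, whose Hessian
    -- B' must be exchanged for B; since B is an average of B', this costs √(t-s), in addition to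
    -- the factor t - s of the covariance increment.
    rcases le_total t s with hts | hst
    · have h := H.abs_avg_taylor_le (h0.trans ht.le) hts (hF3 t) φ
      rw [← hstep t s ht.le hts] at h
      rw [abs_of_nonneg (sub_nonneg.2 hts)]
      refine h.trans ?_
      have := frameSize_nonneg e
      have h4 : 0 ≤ (s - t) * √(s - t) := mul_nonneg (by linarith) (Real.sqrt_nonneg _)
      have : 0 ≤ K * frameSize e * (c * K) * ((s - t) * √(s - t)) := by positivity
      linarith
    · have h := H.abs_avg_taylor_le (h0.trans hs) hst (hF3 s) φ
      rw [← hstep s t hs hst] at h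
      set B' := fderiv ℝ (fderiv ℝ (F s)) φ with hB'
      have hBB : ‖B - B'‖ ≤ c * (K * √(t - s)) := by
        have := H.norm_avg_sub_le (h0.trans hs) hst (f := fderiv ℝ (fderiv ℝ (F s)))
          ((hF3 s).contDiff_fderiv_fderiv.continuous) (hF3 s).norm_fderiv_fderiv_le hc0
          (norm_sub_le_of_fderiv_bound ((hF3 s).contDiff_fderiv_fderiv.differentiable (by norm_num))
            (hF3 s).norm_fderiv_fderiv_fderiv_le) φ
        rwa [← (hF3 s).fderiv_fderiv_avg, ← hstep s t hs hst] at this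
      have h2 := abs_traceForm_le e (A := C t - C s) (a := K * (t - s))
        (fun i j => H.lip s t (h0.trans hs) hst i j) (B - B')
      rw [traceForm_sub_right] at h2
      have h3 : |traceForm e (C t - C s) B - traceForm e (C t - C s) B'| ≤
          K * (t - s) * frameSize e * (c * (K * √(t - s))) := by
        refine h2.trans (mul_le_mul_of_nonneg_left hBB ?_)
        have := frameSize_nonneg e
        have : 0 ≤ t - s := by linarith
        positivity
      rw [abs_sub_comm s t, abs_of_nonneg (sub_nonneg.2 hst)]
      have h5 : F s φ - F t φ - traceForm e (C s - C t) B / 2 =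
          -(F t φ - F s φ - traceForm e (C t - C s) B' / 2) +
            (traceForm e (C t - C s) B - traceForm e (C t - C s) B') / 2 := by
        simp only [traceForm_sub_left]; ring
      rw [h5]
      refine (abs_add_le _ _).trans ?_
      rw [abs_neg, abs_div, abs_of_pos (by norm_num : (0 : ℝ) < 2)]
      have h6 := (abs_nonneg _).trans h3
      calc _ ≤ c * (K * ((t - s) * √(t - s))) +
            K * (t - s) * frameSize e * (c * (K * √(t - s))) / 2 := by gcongr
        _ ≤ c * (K * ((t - s) * √(t - s))) +
            K * (t - s) * frameSize e * (c * (K * √(t - s))) := by linarith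
        _ = _ := by ring
  have hz : HasDerivAt (fun s => F s φ - traceForm e (C s) B / 2) 0 t := by
    refine hasDerivAt_zero_of_bound (c := c * K + K * frameSize e * (c * K)) ?_
    filter_upwards [lt_mem_nhds ht] with s hs
    convert hbd s hs.le using 2
    rw [traceForm_sub_left]; ring
  have h1 := hz.fun_add ((hasDerivAt_traceForm e (H.deriv t (h0.trans_lt ht)) B).div_const 2)
  simpa using h1

/-- Differentiation of `t ↦ ∫ ψ_t dD_t`. -/
theorem hasDerivAt_integral_D {t₀ t : ℝ} (h0 : 0 ≤ t₀) (ht : t₀ < t) {ψ b : ℝ → E → ℝ} {c : ℝ}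
    (hψ : ∀ s, t₀ < s → BddC3 c (ψ s))
    (hd : ∀ s, t₀ < s → ∀ φ, HasDerivAt (fun s => ψ s φ) (b s φ) s)
    (hb : ∀ s, t₀ < s → ∀ φ, |b s φ| ≤ c)
    (hb' : ∀ s, t₀ < s → ∀ φ v, |b s (φ + v) - b s φ| ≤ c * ‖v‖) :
    HasDerivAt (fun s => ∫ φ, ψ s φ ∂D s)
      (∫ φ, (b t φ - traceForm e (dC t) (fderiv ℝ (fderiv ℝ (ψ t)) φ) / 2) ∂D t) t := by
  have hprob := H.prob
  have hprobD := H.probD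
  have hK := H.K_nonneg
  have hc0 := (hψ t ht).nonneg
  have hS := frameSize_nonneg e
  have hB := (hψ t ht).contDiff_fderiv_fderiv
  set B := fderiv ℝ (fderiv ℝ (ψ t)) with hBdef
  have hBb : ∀ φ, ‖B φ‖ ≤ c := (hψ t ht).norm_fderiv_fderiv_le
  have hBl : ∀ φ v, ‖B (φ + v) - B φ‖ ≤ c * ‖v‖ :=
    norm_sub_le_of_fderiv_bound (hB.differentiable (by norm_num))
      (hψ t ht).norm_fderiv_fderiv_fderiv_le
  have hTc : ∀ A : Mat N, Continuous fun φ => traceForm e A (B φ) := fun A =>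
    (continuous_traceForm e A).comp hB.continuous
  have hTb : ∀ (A : Mat N) (a : ℝ), (∀ i j, |A i j| ≤ a) → ∀ φ,
      ‖traceForm e A (B φ)‖ ≤ |a| * frameSize e * c := fun A a hA φ => by
    refine (abs_traceForm_le e (fun i j => (hA i j).trans (le_abs_self a)) (B φ)).trans ?_
    exact mul_le_mul_of_nonneg_left (hBb φ) (by positivity)
  have hTi : ∀ A : Mat N, Integrable (fun φ => traceForm e A (B φ)) (D t) := fun A => by
    refine H.integrable_D (hTc A) (hTb A (entrySum A) fun i j => ?_) t
    exact (Finset.single_le_sum (f := fun j => |A i j|) (fun _ _ => abs_nonneg _)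
      (Finset.mem_univ j)).trans (Finset.single_le_sum (f := fun i => ∑ j, |A i j|)
        (fun _ _ => Finset.sum_nonneg fun _ _ => abs_nonneg _) (Finset.mem_univ i))
  -- the time increments of `ψ` are Lipschitz with a small constant
  have hinc : ∀ s, t₀ < s → ∀ φ v, |(ψ s (φ + v) - ψ s φ) - (ψ t (φ + v) - ψ t φ)| ≤
      c * |s - t| * ‖v‖ := by
    intro s hs φ v
    have := (convex_Ioi t₀).norm_image_sub_le_of_norm_hasDerivWithin_le
      (f := fun s => ψ s (φ + v) - ψ s φ) (f' := fun s => b s (φ + v) - b s φ) (C := c * ‖v‖)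
      (x := t) (y := s) (fun r hr => ((hd r hr _).sub (hd r hr _)).hasDerivWithinAt)
      (fun r hr => hb' r hr φ v) ht hs
    rw [Real.norm_eq_abs, Real.norm_eq_abs] at this
    linarith
  -- The averaging defect of ψ u is compared with that of ψ t. Their difference has Lipschitz
  -- constant c|u-t|, so its defect is again of order 3/2, and the Hessian can be taken at the fixed
  -- time t.
  have havg : ∀ r s, 0 ≤ r → r ≤ s → ∀ u, t₀ < u → |u - t| ≤ s - r → ∀ φ,
      |(avg (μ r s) (ψ u) φ - ψ u φ) - traceForm e (C s - C r) (B φ) / 2| ≤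
        (2 * c * K) * ((s - r) * √(s - r)) := by
    intro r s hr hrs u hu hut φ
    have h1 := H.abs_avg_taylor_le hr hrs (hψ t ht) φ
    have h2 : |(avg (μ r s) (ψ u) φ - ψ u φ) - (avg (μ r s) (ψ t) φ - ψ t φ)| ≤
        c * |u - t| * (K * √(s - r)) := by
      have := H.norm_avg_sub_le hr hrs (f := fun x => ψ u x - ψ t x) (c := c * |u - t|)
        (M := c + c) ((hψ u hu).continuous.sub (hψ t ht).continuous)
        (fun x => (norm_sub_le _ _).trans (add_le_add ((hψ u hu).norm_le x) ((hψ t ht).norm_le x)))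
        (by positivity) (fun x y => by
          convert hinc u hu x y using 1
          rw [Real.norm_eq_abs]; congr 1; ring) φ
      rw [Real.norm_eq_abs] at this
      convert this using 2
      rw [avg, avg, avg, integral_sub (integrable_shift (hψ u hu).continuous (hψ u hu).norm_le _ φ)
        (integrable_shift (hψ t ht).continuous (hψ t ht).norm_le _ φ)]
      ring
    have h3 : c * |u - t| * (K * √(s - r)) ≤ c * (s - r) * (K * √(s - r)) := by gcongr
    rw [abs_le] at *
    constructor <;> nlinarith [h1.1, h1.2, h2.1, h2.2, h3]
  have hmain : ∀ s, t₀ < s → |(∫ φ, ψ s φ ∂D s) - (∫ φ, ψ s φ ∂D t) +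
      (∫ φ, traceForm e (C s - C t) (B φ) ∂D t) / 2| ≤
        (2 * c * K + K * frameSize e * c * K) * (|s - t| * √|s - t|) := by
    intro s hs
    have hs0 : 0 ≤ s := h0.trans hs.le
    have ht0 : 0 ≤ t := h0.trans ht.le
    have hψs := hψ s hs
    -- The integral over the measure of the earlier time is rewritten over that of the later time.
    -- In the second case everything is moved to `D s`, including the trace term T, whose own
    -- averaging defect must then be estimated.
    rcases le_total s t with hst | hts
    · rw [H.integral_D hs0 hst hψs.continuous hψs.norm_le]
      have hi1 : Integrable (avg (μ s t) (ψ s)) (D t) :=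
        H.integrable_D (hψs.avg (μ s t)).continuous (hψs.avg (μ s t)).norm_le t
      have hi2 := H.integrable_D hψs.continuous hψs.norm_le t
      have e1 : (∫ φ, avg (μ s t) (ψ s) φ ∂D t) - (∫ φ, ψ s φ ∂D t) +
          (∫ φ, traceForm e (C s - C t) (B φ) ∂D t) / 2 =
          ∫ φ, ((avg (μ s t) (ψ s) φ - ψ s φ) - traceForm e (C t - C s) (B φ) / 2) ∂D t := by
        have hi3 : Integrable (fun φ => avg (μ s t) (ψ s) φ - ψ s φ) (D t) := hi1.sub hi2
        rw [integral_sub hi3 ((hTi _).div_const 2), integral_sub hi1 hi2,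
          integral_div]
        have : ∀ φ, traceForm e (C s - C t) (B φ) = -traceForm e (C t - C s) (B φ) := fun φ => by
          simp only [traceForm_sub_left]; ring
        simp_rw [this]
        rw [integral_neg]; ring
      rw [e1, ← Real.norm_eq_abs]
      refine (norm_integral_le_of_norm_le_const (Eventually.of_forall fun φ =>
        havg s t hs0 hst s hs (by rw [abs_sub_comm, abs_of_nonneg]; linarith) φ)).trans ?_
      rw [abs_sub_comm s t, abs_of_nonneg (sub_nonneg.2 hst)]
      have : 0 ≤ (t - s) * √(t - s) := mul_nonneg (by linarith) (Real.sqrt_nonneg _)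
      have : 0 ≤ K * frameSize e * c * K * ((t - s) * √(t - s)) := by positivity
      simp
      linarith
    · have hst := sub_nonneg.2 hts
      rw [H.integral_D ht0 hts hψs.continuous hψs.norm_le]
      have hAl : ∀ i j, |(C s - C t) i j| ≤ K * (s - t) := fun i j => H.lip t s ht0 hts i j
      set T : E → ℝ := fun φ => traceForm e (C s - C t) (B φ) with hT
      have hTl : ∀ φ v, ‖T (φ + v) - T φ‖ ≤ (K * (s - t) * frameSize e * c) * ‖v‖ := fun φ v => by
        rw [hT, ← traceForm_sub_right, Real.norm_eq_abs, mul_assoc _ c]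
        refine (abs_traceForm_le e hAl _).trans (mul_le_mul_of_nonneg_left (hBl φ v) ?_)
        positivity
      rw [H.integral_D ht0 hts (hTc (C s - C t)) (hTb _ _ hAl)]
      have hi1 : Integrable (avg (μ t s) (ψ s)) (D s) :=
        H.integrable_D (hψs.avg (μ t s)).continuous (hψs.avg (μ t s)).norm_le s
      have hi2 := H.integrable_D hψs.continuous hψs.norm_le s
      have hi3 : Integrable (avg (μ t s) T) (D s) :=
        H.integrable_D (continuous_avg (hTc _) (hTb _ _ hAl) _)
          (fun x => norm_avg_le_const (hTb _ _ hAl) (μ t s) x) s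
      have e1 : (∫ φ, ψ s φ ∂D s) - (∫ φ, avg (μ t s) (ψ s) φ ∂D s) +
          (∫ φ, avg (μ t s) T φ ∂D s) / 2 =
          ∫ φ, (ψ s φ - avg (μ t s) (ψ s) φ + avg (μ t s) T φ / 2) ∂D s := by
        have hi4 : Integrable (fun φ => ψ s φ - avg (μ t s) (ψ s) φ) (D s) := hi2.sub hi1
        rw [integral_add hi4 (hi3.div_const 2), integral_sub hi2 hi1, integral_div]
      rw [e1, ← Real.norm_eq_abs, abs_of_nonneg hst]
      have hpt : ∀ φ, ‖ψ s φ - avg (μ t s) (ψ s) φ + avg (μ t s) T φ / 2‖ ≤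
          (2 * c * K + K * frameSize e * c * K) * ((s - t) * √(s - t)) := fun φ => by
        have h1 := havg t s ht0 hts s hs (by rw [abs_of_nonneg hst]) φ
        have h2 := H.norm_avg_sub_le ht0 hts (hTc _) (hTb _ _ hAl) (by positivity) hTl φ
        have h3 : ψ s φ - avg (μ t s) (ψ s) φ + avg (μ t s) T φ / 2 =
            -(avg (μ t s) (ψ s) φ - ψ s φ - T φ / 2) + (avg (μ t s) T φ - T φ) / 2 := by ring
        rw [h3]
        refine (norm_add_le _ _).trans ?_
        rw [norm_neg, norm_div, Real.norm_eq_abs, RCLike.norm_ofNat]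
        have := (norm_nonneg _).trans h2
        calc _ ≤ (2 * c * K) * ((s - t) * √(s - t)) +
              (K * (s - t) * frameSize e * c) * (K * √(s - t)) / 2 := by
              gcongr
          _ ≤ (2 * c * K) * ((s - t) * √(s - t)) +
              (K * (s - t) * frameSize e * c) * (K * √(s - t)) := by linarith
          _ = _ := by ring
      refine (norm_integral_le_of_norm_le_const (Eventually.of_forall hpt)).trans ?_
      simp
  -- Changing only the measure contributes minus half the trace term. What remains is the derivative
  -- of ψ under the fixed measure `D t`, obtained by domination.
  have hz : HasDerivAt (fun s => (∫ φ, ψ s φ ∂D s) - (∫ φ, ψ s φ ∂D t) +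
      (∫ φ, traceForm e (C s - C t) (B φ) ∂D t) / 2) 0 t := by
    refine hasDerivAt_zero_of_bound (c := 2 * c * K + K * frameSize e * c * K) ?_
    filter_upwards [lt_mem_nhds ht] with s hs
    convert hmain s hs using 2
    simp [traceForm]
  have hd1 := (hasDerivAt_integral_of_dominated_loc_of_deriv_le (μ := D t) (F := ψ) (F' := b)
    (x₀ := t) (s := Ioi t₀) (bound := fun _ => c) (Ioi_mem_nhds ht)
    (by filter_upwards [lt_mem_nhds ht] with s hs
        exact aestronglyMeasurable_of_continuous (hψ s hs).continuous _)
    (H.integrable_D (hψ t ht).continuous (hψ t ht).norm_le t)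
    (by
      refine aestronglyMeasurable_of_continuous ?_ _
      have : LipschitzWith c.toNNReal (b t) := LipschitzWith.of_dist_le_mul fun x y => by
        have := hb' t ht y (x - y)
        rw [Real.coe_toNNReal _ hc0, dist_eq_norm, dist_eq_norm, Real.norm_eq_abs]
        simpa using this
      exact this.continuous)
    (Eventually.of_forall fun φ s hs => hb s hs φ) (integrable_const c)
    (Eventually.of_forall fun φ s hs => hd s hs φ))
  have hT : ∀ s, ∫ φ, traceForm e (C s - C t) (B φ) ∂D t =
      (∫ φ, traceForm e (C s) (B φ) ∂D t) - ∫ φ, traceForm e (C t) (B φ) ∂D t := fun s => by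
    rw [← integral_sub (hTi _) (hTi _)]
    simp_rw [traceForm_sub_left]
  have hBi : ∀ i j, Integrable (fun φ => B φ (e i) (e j)) (D t) := fun i j => by
    have hBc := hB.continuous
    refine H.integrable_D (M := c * ‖e i‖ * ‖e j‖) (by fun_prop) (fun φ => ?_) t
    refine ((B φ).le_opNorm₂ _ _).trans ?_
    gcongr
    exact hBb φ
  have hT2 : ∀ A : Mat N, ∫ φ, traceForm e A (B φ) ∂D t =
      ∑ i, ∑ j, A i j * ∫ φ, B φ (e i) (e j) ∂D t := fun A => by
    simp only [traceForm]
    refine (integral_finsetSum _ fun i _ => integrable_finsetSum _ fun j _ =>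
      (hBi i j).const_mul _).trans (Finset.sum_congr rfl fun i _ => ?_)
    refine (integral_finsetSum _ fun j _ => (hBi i j).const_mul _).trans ?_
    exact Finset.sum_congr rfl fun j _ => integral_const_mul _ _
  have hd2 : HasDerivAt (fun s => ∫ φ, traceForm e (C s - C t) (B φ) ∂D t)
      (∫ φ, traceForm e (dC t) (B φ) ∂D t) t := by
    simp_rw [hT, hT2]
    refine HasDerivAt.sub_const _ ?_
    exact HasDerivAt.fun_sum fun i _ => HasDerivAt.fun_sum fun j _ =>
      (H.deriv t (h0.trans_lt ht) i j).mul_const _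
  have hfin := (hz.fun_add hd1.2).fun_sub (hd2.div_const 2)
  rw [integral_sub hd1.1 ((hTi _).div_const 2), integral_div]
  exact (hfin.congr_deriv (by ring)).congr_of_eventuallyEq (Eventually.of_forall fun s => by ring)

end GaussianFlow

end Flow

/-! ### Directional derivatives of exponentials and products -/

section Directional

variable {E : Type} [NormedAddCommGroup E] [NormedSpace ℝ E]

/-- The directional derivative of `f` along `v`. -/
def dir (v : E) (f : E → ℝ) : E → ℝ := fun φ => fderiv ℝ f φ v

theorem contDiff_dir {n : ℕ} {f : E → ℝ} (hf : ContDiff ℝ (n + 1 : ℕ) f) (v : E) :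
    ContDiff ℝ n (dir v f) :=
  (hf.fderiv_right (by norm_cast)).clm_apply contDiff_const

theorem dir_mul {f g : E → ℝ} (hf : Differentiable ℝ f) (hg : Differentiable ℝ g) (v : E) :
    dir v (fun x => f x * g x) = fun x => dir v f x * g x + f x * dir v g x := by
  funext x
  have h := ((hf x).hasFDerivAt.fun_mul (hg x).hasFDerivAt).fderiv
  rw [dir, h]
  simp [dir, mul_comm, add_comm]

theorem dir_add {f g : E → ℝ} (hf : Differentiable ℝ f) (hg : Differentiable ℝ g) (v : E) :
    dir v (fun x => f x + g x) = fun x => dir v f x + dir v g x := by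
  funext x
  rw [dir, ((hf x).hasFDerivAt.fun_add (hg x).hasFDerivAt).fderiv]
  rfl

theorem dir_sub {f g : E → ℝ} (hf : Differentiable ℝ f) (hg : Differentiable ℝ g) (v : E) :
    dir v (fun x => f x - g x) = fun x => dir v f x - dir v g x := by
  funext x
  rw [dir, ((hf x).hasFDerivAt.fun_sub (hg x).hasFDerivAt).fderiv]
  rfl

theorem dir_exp {f : E → ℝ} (hf : Differentiable ℝ f) (v : E) :
    dir v (fun x => Real.exp (f x)) = fun x => Real.exp (f x) * dir v f x := by
  funext x
  rw [dir, ((hf x).hasFDerivAt.exp).fderiv]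
  rfl

theorem dir_log {f : E → ℝ} (hf : Differentiable ℝ f) (h0 : ∀ x, 0 < f x) (v : E) :
    dir v (fun x => Real.log (f x)) = fun x => (f x)⁻¹ * dir v f x := by
  funext x
  rw [dir, ((hf x).hasFDerivAt.log (h0 x).ne').fderiv]
  rfl

theorem fderiv_fderiv_eq_dir {f : E → ℝ} (hf : ContDiff ℝ 2 f) (φ v w : E) :
    fderiv ℝ (fderiv ℝ f) φ v w = dir v (dir w f) φ := by
  have h : DifferentiableAt ℝ (fderiv ℝ f) φ :=
    (hf.fderiv_right (m := 1) (by norm_num)).differentiable (by norm_num) φ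
  have := h.hasFDerivAt.clm_apply (hasFDerivAt_const w φ)
  change _ = fderiv ℝ (fun y => fderiv ℝ f y w) φ v
  rw [this.fderiv]
  simp

theorem dir_comm {f : E → ℝ} (hf : ContDiff ℝ 2 f) (v w : E) :
    dir v (dir w f) = dir w (dir v f) := by
  funext φ
  rw [← fderiv_fderiv_eq_dir hf, ← fderiv_fderiv_eq_dir hf]
  exact second_derivative_symmetric
    (fun y => ((hf.differentiable (by norm_num)) y).hasFDerivAt)
    ((hf.fderiv_right (m := 1) (by norm_num)).differentiable (by norm_num) φ).hasFDerivAt v w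

theorem dir_dir_exp {z : E → ℝ} (hz : ContDiff ℝ 2 z) (k : E) :
    dir k (dir k fun x => Real.exp (z x)) = fun x =>
      Real.exp (z x) * (dir k (dir k z) x + dir k z x ^ 2) := by
  have h0 : Differentiable ℝ z := hz.differentiable (by norm_num)
  have h1 : Differentiable ℝ (dir k z) :=
    (contDiff_dir (n := 1) hz k).differentiable (by norm_num)
  rw [dir_exp h0, dir_mul h0.exp h1, dir_exp h0]
  funext x
  ring

theorem dir_dir_dir_exp {z : E → ℝ} (hz : ContDiff ℝ 3 z) (k a : E) :
    dir k (dir k (dir a fun x => Real.exp (z x))) = fun x =>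
      Real.exp (z x) * (dir k z x * (dir k (dir a z) x + dir a z x * dir k z x) +
        dir k (dir k (dir a z)) x + dir k (dir a z) x * dir k z x +
        dir a z x * dir k (dir k z) x) := by
  have h0 : Differentiable ℝ z := hz.differentiable (by norm_num)
  have h1 : ∀ v, ContDiff ℝ 2 (dir v z) := fun v => contDiff_dir (n := 2) hz v
  have h1' : ∀ v, Differentiable ℝ (dir v z) := fun v => (h1 v).differentiable (by norm_num)
  have h2 : Differentiable ℝ (dir k (dir a z)) :=
    (contDiff_dir (n := 1) (h1 a) k).differentiable (by norm_num)
  rw [dir_exp h0, dir_mul h0.exp (h1' a), dir_exp h0]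
  have e : (fun x => Real.exp (z x) * dir k z x * dir a z x +
      Real.exp (z x) * dir k (dir a z) x) =
      fun x => Real.exp (z x) * (dir k z x * dir a z x + dir k (dir a z) x) := by
    funext x; ring
  rw [e, dir_mul h0.exp (((h1' k).fun_mul (h1' a)).fun_add h2), dir_exp h0,
    dir_add ((h1' k).fun_mul (h1' a)) h2, dir_mul (h1' k) (h1' a)]
  funext x
  ring

/-- The second derivative of `e^g w_a w_b`. -/
theorem dir_dir_exp_mul_mul {g u w : E → ℝ} (hg : ContDiff ℝ 2 g) (hu : ContDiff ℝ 2 u)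
    (hw : ContDiff ℝ 2 w) (k : E) :
    dir k (dir k fun x => Real.exp (g x) * (u x * w x)) = fun x =>
      Real.exp (g x) * ((dir k (dir k g) x + dir k g x ^ 2) * (u x * w x) +
        2 * dir k g x * (dir k u x * w x + u x * dir k w x) +
        (dir k (dir k u) x * w x + 2 * (dir k u x * dir k w x) + u x * dir k (dir k w) x)) := by
  have hg0 : Differentiable ℝ g := hg.differentiable (by norm_num)
  have hu0 : Differentiable ℝ u := hu.differentiable (by norm_num)
  have hw0 : Differentiable ℝ w := hw.differentiable (by norm_num)
  have hg1 : Differentiable ℝ (dir k g) :=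
    (contDiff_dir (n := 1) hg k).differentiable (by norm_num)
  have hu1 : Differentiable ℝ (dir k u) :=
    (contDiff_dir (n := 1) hu k).differentiable (by norm_num)
  have hw1 : Differentiable ℝ (dir k w) :=
    (contDiff_dir (n := 1) hw k).differentiable (by norm_num)
  rw [dir_mul hg0.exp (hu0.fun_mul hw0), dir_exp hg0, dir_mul hu0 hw0]
  rw [dir_add ((hg0.exp.fun_mul hg1).fun_mul (hu0.fun_mul hw0))
    (hg0.exp.fun_mul ((hu1.fun_mul hw0).fun_add (hu0.fun_mul hw1))),
    dir_mul (hg0.exp.fun_mul hg1) (hu0.fun_mul hw0), dir_mul hg0.exp hg1, dir_exp hg0, dir_mul hu0 hw0,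
    dir_mul hg0.exp ((hu1.fun_mul hw0).fun_add (hu0.fun_mul hw1)), dir_exp hg0,
    dir_add (hu1.fun_mul hw0) (hu0.fun_mul hw1), dir_mul hu1 hw0, dir_mul hu0 hw1]
  funext x
  ring

end Directional

/-! ### Further stability properties of tame and mild families -/

section TameClosure

variable {E : Type} [NormedAddCommGroup E] [NormedSpace ℝ E]
  {W : Type} [NormedAddCommGroup W] [NormedSpace ℝ W] {ι : Type} {n : ℕ} {ρ : ι → E → ℝ}

theorem Tame.add {f g : ι → E → W} (hf : Tame n ρ f) (hg : Tame n ρ g) :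
    Tame n ρ (fun i x => f i x + g i x) := by
  refine ⟨fun i => (hf.1 i).add (hg.1 i), fun j hj θ h0 h1 => ?_⟩
  obtain ⟨c, hc, h⟩ := hf.2 j hj θ h0 h1
  obtain ⟨c', hc', h'⟩ := hg.2 j hj θ h0 h1
  refine ⟨c + c', by positivity, fun i x => ?_⟩
  have e : iteratedFDeriv ℝ j (fun x => f i x + g i x) x =
      iteratedFDeriv ℝ j (f i) x + iteratedFDeriv ℝ j (g i) x :=
    iteratedFDeriv_add_apply (((hf.1 i).of_le (by exact_mod_cast hj)).contDiffAt)
      (((hg.1 i).of_le (by exact_mod_cast hj)).contDiffAt)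
  rw [e, add_mul]
  exact (norm_add_le _ _).trans (add_le_add (h i x) (h' i x))

theorem Tame.comp_left {W' : Type} [NormedAddCommGroup W'] [NormedSpace ℝ W'] {f : ι → E → W}
    (hf : Tame n ρ f) (L : ι → W →L[ℝ] W') {c : ℝ} (hL : ∀ i, ‖L i‖ ≤ c) (hc0 : 0 ≤ c) :
    Tame n ρ (fun i x => L i (f i x)) := by
  refine ⟨fun i => (L i).contDiff.comp (hf.1 i), fun j hj θ h0 h1 => ?_⟩
  obtain ⟨c', hc', h⟩ := hf.2 j hj θ h0 h1
  refine ⟨c * c', by positivity, fun i x => ?_⟩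
  refine ((L i).norm_iteratedFDeriv_comp_left (hf.1 i).contDiffAt
    (by exact_mod_cast hj)).trans ?_
  rw [mul_assoc]
  exact mul_le_mul (hL i) (h i x) (norm_nonneg _) hc0

theorem Tame.dir {f : ι → E → ℝ} (hf : Tame (n + 1) ρ f) (v : E) :
    Tame n ρ (fun i => dir v (f i)) := hf.fderiv.clm_apply v

theorem Mild.dir {f : ι → E → ℝ} (hf : Mild (n + 1) ρ f) (v : E) :
    Mild n ρ (fun i => dir v (f i)) := hf.fderiv.clm_apply v

/-- `traceForm` as a continuous linear map in the bilinear form. -/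
def traceFormL {N : ℕ} (e : Fin N → E) (A : Mat N) : (E →L[ℝ] E →L[ℝ] ℝ) →L[ℝ] ℝ :=
  LinearMap.mkContinuous
    { toFun := traceForm e A
      map_add' := fun B B' => by
        simp only [traceForm, add_apply, mul_add, Finset.sum_add_distrib]
      map_smul' := fun r B => by
        simp only [traceForm, smul_apply, smul_eq_mul, RingHom.id_apply, Finset.mul_sum]
        exact Finset.sum_congr rfl fun i _ => Finset.sum_congr rfl fun j _ => by ring }
    (entrySum A * frameSize e) fun B => by
      refine abs_traceForm_le e (fun i j => ?_) B
      exact (Finset.single_le_sum (f := fun j => |A i j|) (fun _ _ => abs_nonneg _)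
        (Finset.mem_univ j)).trans (Finset.single_le_sum (f := fun i => ∑ j, |A i j|)
          (fun _ _ => Finset.sum_nonneg fun _ _ => abs_nonneg _) (Finset.mem_univ i))

theorem norm_traceFormL_le {N : ℕ} (e : Fin N → E) {A : Mat N} {a : ℝ} (ha : 0 ≤ a)
    (hA : ∀ i j, |A i j| ≤ a) : ‖traceFormL e A‖ ≤ a * frameSize e :=
  ContinuousLinearMap.opNorm_le_bound _ (mul_nonneg ha (frameSize_nonneg e))
    fun B => abs_traceForm_le e hA B

theorem Tame.traceForm {N : ℕ} (e : Fin N → E) {f : ι → E → ℝ} (hf : Tame (n + 2) ρ f)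
    {A : ι → Mat N} {K : ℝ} (hK : 0 ≤ K) (hA : ∀ i k l, |A i k l| ≤ K) :
    Tame n ρ (fun i x => Polchinski.traceForm e (A i) (_root_.fderiv ℝ (_root_.fderiv ℝ (f i)) x)) :=
  hf.fderiv.fderiv.comp_left (fun i => traceFormL e (A i))
    (fun i => norm_traceFormL_le e hK (hA i)) (mul_nonneg hK (frameSize_nonneg e))

/-- Since ρ ≤ M, negative powers of ρ are bounded below by those of M. -/
theorem Mild.of_bounded {f : ι → E → W} (hf : ∀ i, Continuous (f i)) {L M : ℝ} (hL0 : 0 ≤ L)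
    (hL : ∀ i x, ‖f i x‖ ≤ L) (hM0 : 0 ≤ M) (hρ : ∀ i x, 0 < ρ i x) (hM : ∀ i x, ρ i x ≤ M) :
    Mild 0 ρ f := by
  refine ⟨fun i => contDiff_zero.2 (hf i), fun j hj θ hθ => ?_⟩
  obtain rfl : j = 0 := by lia
  refine ⟨L * M ^ θ, by positivity, fun i x => ?_⟩
  rw [norm_iteratedFDeriv_zero, mul_assoc]
  have h1 : 1 ≤ M ^ θ * ρ i x ^ (-θ) := by
    rw [Real.rpow_neg (hρ i x).le, ← div_eq_mul_inv, one_le_div (Real.rpow_pos_of_pos (hρ i x) θ)]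
    exact Real.rpow_le_rpow (hρ i x).le (hM i x) hθ.le
  calc ‖f i x‖ ≤ L * 1 := by simpa using hL i x
    _ ≤ _ := by gcongr

theorem Tame.exists_uniform_bddC3 {f : ι → E → W} (h : Tame 3 ρ f) (hρ : ∀ i x, 0 < ρ i x) {M : ℝ}
    (hM0 : 0 ≤ M) (hM : ∀ i x, ρ i x ≤ M) : ∃ c, ∀ i, BddC3 c (f i) := by
  have h2 : ∀ j : ℕ, ∃ c, 0 ≤ c ∧ (j ≤ 3 → ∀ i x, ‖iteratedFDeriv ℝ j (f i) x‖ ≤ c) := fun j => by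
    by_cases hj : j ≤ 3
    · obtain ⟨c, hc, hcc⟩ := h.const_le (fun i x => (hρ i x).le) hM0 hM hj
      exact ⟨c, hc, fun _ => hcc⟩
    · exact ⟨0, le_rfl, fun h => absurd h hj⟩
  choose c hc0 hc using h2
  refine ⟨∑ j ∈ Finset.range 4, c j, fun i => ⟨h.1 i, fun j hj x => ?_⟩⟩
  exact (hc j hj i x).trans
    (Finset.single_le_sum (fun k _ => hc0 k) (Finset.mem_range.2 (by lia)))

theorem Tame.exists_bddC3 {t₀ : ℝ} {ρ : Ioi t₀ → E → ℝ} {f : ℝ → E → ℝ}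
    (h : Tame 3 ρ (fun t : Ioi t₀ => f t)) (hρ : ∀ i x, 0 < ρ i x) {M : ℝ} (hM0 : 0 ≤ M)
    (hM : ∀ i x, ρ i x ≤ M) : ∃ c, ∀ t, t₀ < t → BddC3 c (f t) :=
  (h.exists_uniform_bddC3 hρ hM0 hM).imp fun _ hc t ht => hc ⟨t, ht⟩

theorem Tame.exists_lipschitz {t₀ : ℝ} {ρ : Ioi t₀ → E → ℝ} {f : ℝ → E → ℝ}
    (h : Tame 1 ρ (fun t : Ioi t₀ => f t)) (hρ : ∀ i x, 0 < ρ i x) {M : ℝ} (hM0 : 0 ≤ M)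
    (hM : ∀ i x, ρ i x ≤ M) : ∃ c, (∀ t, t₀ < t → ∀ x, |f t x| ≤ c) ∧
      ∀ t, t₀ < t → ∀ x v, |f t (x + v) - f t x| ≤ c * ‖v‖ := by
  obtain ⟨c, hc, h0⟩ := h.const_le (fun i x => (hρ i x).le) hM0 hM (Nat.zero_le 1)
  obtain ⟨c', hc', h1⟩ := h.const_le (fun i x => (hρ i x).le) hM0 hM le_rfl
  refine ⟨c + c', fun t ht x => ?_, fun t ht x v => ?_⟩
  · have := h0 ⟨t, ht⟩ x
    rw [norm_iteratedFDeriv_zero, Real.norm_eq_abs] at this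
    linarith
  · have hd : Differentiable ℝ (f t) := (h.1 ⟨t, ht⟩).differentiable (by norm_num)
    refine (norm_sub_le_of_fderiv_bound hd (c := c') (fun y => ?_) x v).trans ?_
    · have := h1 ⟨t, ht⟩ y
      rwa [← norm_iteratedFDeriv_fderiv, norm_iteratedFDeriv_zero] at this
    · gcongr
      linarith

end TameClosure

/-! ### Pointwise identities for the entropy and Fisher information densities -/

section Bochner

variable {E : Type} [NormedAddCommGroup E] [NormedSpace ℝ E]

theorem dir_dir_sub {g z : E → ℝ} (hg : ContDiff ℝ 2 g) (hz : ContDiff ℝ 2 z) (k a : E) :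
    dir k (dir a fun y => g y - z y) = fun x => dir k (dir a g) x - dir k (dir a z) x := by
  have hd : ∀ {f : E → ℝ}, ContDiff ℝ 2 f → Differentiable ℝ f := fun h =>
    h.differentiable (by norm_num)
  have hd1 : ∀ {f : E → ℝ}, ContDiff ℝ 2 f → Differentiable ℝ (dir a f) := fun h =>
    (contDiff_dir (n := 1) h a).differentiable (by norm_num)
  rw [dir_sub (hd hg) (hd hz), dir_sub (hd1 hg) (hd1 hz)]

/-- The carré du champ identity for the entropy density, in one direction. -/
theorem entropy_density_identity {g z : E → ℝ} (hg : ContDiff ℝ 2 g) (hz : ContDiff ℝ 2 z)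
    (k x : E) :
    (dir k (dir k fun y => Real.exp (g y)) x * (g x - z x) +
        dir k (dir k fun y => Real.exp (g y)) x -
        Real.exp (g x) * ((Real.exp (z x))⁻¹ * dir k (dir k fun y => Real.exp (z y)) x)) -
      dir k (dir k fun y => Real.exp (g y) * (g y - z y)) x =
    -(Real.exp (g x) * dir k (fun y => g y - z y) x ^ 2) := by
  have h := dir_dir_exp_mul_mul hg (hg.sub hz) (contDiff_const (c := (1 : ℝ))) k
  have h1 : dir k (fun _ : E => (1 : ℝ)) = fun _ => 0 := by funext x; simp [dir]
  have h2 : dir k (fun _ : E => (0 : ℝ)) = fun _ => 0 := by funext x; simp [dir]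
  have h0 := dir_sub (hg.differentiable (by norm_num)) (hz.differentiable (by norm_num)) k
  simp only [mul_one, h1, h2] at h
  change dir k (dir k fun y => Real.exp (g y) * (g y - z y)) = _ at h
  have h3 := dir_dir_sub hg hz k k
  rw [h, dir_dir_exp hg, dir_dir_exp hz]
  simp only [h3]
  simp only [h0]
  have := Real.exp_ne_zero (z x)
  field_simp
  ring

/-- The Bochner identity for `e^g ∂_a w ∂_b w` with `w = g - z`, in one direction. -/
theorem bochner_identity {g z : E → ℝ} (hg : ContDiff ℝ 3 g) (hz : ContDiff ℝ 3 z)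
    {w : E → ℝ} (hw : w = fun y => g y - z y) {A : E → ℝ} {k x : E}
    (hA : ∀ a, A a =
      (Real.exp (g x))⁻¹ * dir k (dir k (dir a fun y => Real.exp (g y))) x -
      ((Real.exp (g x))⁻¹ * dir k (dir k fun y => Real.exp (g y)) x) *
        ((Real.exp (g x))⁻¹ * dir a (fun y => Real.exp (g y)) x) -
      ((Real.exp (z x))⁻¹ * dir k (dir k (dir a fun y => Real.exp (z y))) x -
      ((Real.exp (z x))⁻¹ * dir k (dir k fun y => Real.exp (z y)) x) *
        ((Real.exp (z x))⁻¹ * dir a (fun y => Real.exp (z y)) x))) (a b : E) :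
    (dir k (dir k fun y => Real.exp (g y)) x * (dir a w x * dir b w x) +
      Real.exp (g x) * (A a * dir b w x + dir a w x * A b)) -
      dir k (dir k fun y => Real.exp (g y) * (dir a w y * dir b w y)) x =
    2 * (Real.exp (g x) * (dir a w x * dir k w x * dir k (dir b z) x +
      dir b w x * dir k w x * dir k (dir a z) x -
      dir k (dir a w) x * dir k (dir b w) x)) := by
  have hg2 : ContDiff ℝ 2 g := hg.of_le (by norm_num)
  have hz2 : ContDiff ℝ 2 z := hz.of_le (by norm_num)
  have hg0 : Differentiable ℝ g := hg.differentiable (by norm_num)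
  have hz0 : Differentiable ℝ z := hz.differentiable (by norm_num)
  have hw3 : ContDiff ℝ 3 w := by rw [hw]; exact hg.sub hz
  have hA' : ∀ c, A c = 2 * dir k g x * dir k (dir c g) x + dir k (dir k (dir c g)) x -
      (2 * dir k z x * dir k (dir c z) x + dir k (dir k (dir c z)) x) := fun c => by
    rw [hA, dir_dir_dir_exp hg, dir_dir_dir_exp hz, dir_dir_exp hg2, dir_dir_exp hz2,
      dir_exp hg0, dir_exp hz0]
    have := Real.exp_ne_zero (z x)
    have := Real.exp_ne_zero (g x)
    field_simp
    ring
  have w1 : ∀ c, dir c w = fun y => dir c g y - dir c z y := fun c => by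
    rw [hw, dir_sub hg0 hz0]
  have w2 : ∀ c, dir k (dir c w) x = dir k (dir c g) x - dir k (dir c z) x := fun c => by
    rw [hw, dir_dir_sub hg2 hz2]
  have w3 : ∀ c, dir k (dir k (dir c w)) x = dir k (dir k (dir c g)) x -
      dir k (dir k (dir c z)) x := fun c => by
    rw [w1, dir_dir_sub (contDiff_dir (n := 2) hg c) (contDiff_dir (n := 2) hz c)]
  rw [dir_dir_exp_mul_mul hg2 (contDiff_dir (n := 2) hw3 a) (contDiff_dir (n := 2) hw3 b),
    dir_dir_exp hg2, hA', hA']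
  simp only [w2, w3]
  simp only [w1]
  ring

end Bochner

/-! ### Entropy and Fisher information along a pair of heat flows -/

section HeatPair

variable {N : ℕ} {E : Type} [NormedAddCommGroup E] [NormedSpace ℝ E]

theorem integrable_sum_sum [MeasurableSpace E] {μ : Measure E} (c : Mat N)
    {f : Fin N → Fin N → E → ℝ} (hf : ∀ i j, Integrable (f i j) μ) :
    Integrable (fun φ => ∑ i, ∑ j, c i j * f i j φ) μ :=
  integrable_finsetSum _ fun i _ => integrable_finsetSum _ fun j _ => (hf i j).const_mul _

theorem integral_sum_sum [MeasurableSpace E] {μ : Measure E} (c : Mat N)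
    {f : Fin N → Fin N → E → ℝ} (hf : ∀ i j, Integrable (f i j) μ) :
    ∫ φ, ∑ i, ∑ j, c i j * f i j φ ∂μ = ∑ i, ∑ j, c i j * ∫ φ, f i j φ ∂μ := by
  refine (integral_finsetSum _ fun i _ => integrable_finsetSum _ fun j _ =>
    (hf i j).const_mul _).trans (Finset.sum_congr rfl fun i _ => ?_)
  refine (integral_finsetSum _ fun j _ => (hf i j).const_mul _).trans ?_
  exact Finset.sum_congr rfl fun j _ => integral_const_mul _ _

/-- Two positive, comparable solutions `Z`, `G` of the heat equation on `(t₀, ∞)`, tame with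
respect to the weight `Z`. -/
structure HeatPair (e : Fin N → E) (dC : ℝ → Mat N) (t₀ : ℝ) (Z G : ℝ → E → ℝ) (ε M K : ℝ) :
    Prop where
  eps_pos : 0 < ε
  Z_pos : ∀ t, t₀ < t → ∀ φ, 0 < Z t φ
  Z_le : ∀ t, t₀ < t → ∀ φ, Z t φ ≤ M
  le_G : ∀ t, t₀ < t → ∀ φ, ε * Z t φ ≤ G t φ
  G_le : ∀ t, t₀ < t → ∀ φ, G t φ ≤ M * Z t φ
  M_nonneg : 0 ≤ M
  tame_Z : Tame 4 (fun t : Ioi t₀ => Z t) (fun t : Ioi t₀ => Z t)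
  tame_G : Tame 4 (fun t : Ioi t₀ => Z t) (fun t : Ioi t₀ => G t)
  heat_Z : ∀ t, t₀ < t → ∀ φ, HasDerivAt (fun s => Z s φ)
    (traceForm e (dC t) (fderiv ℝ (fderiv ℝ (Z t)) φ) / 2) t
  heat_G : ∀ t, t₀ < t → ∀ φ, HasDerivAt (fun s => G s φ)
    (traceForm e (dC t) (fderiv ℝ (fderiv ℝ (G t)) φ) / 2) t
  heat_dir_Z : ∀ a, ∀ t, t₀ < t → ∀ φ, HasDerivAt (fun s => dir a (Z s) φ)
    (traceForm e (dC t) (fderiv ℝ (fderiv ℝ (dir a (Z t))) φ) / 2) t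
  heat_dir_G : ∀ a, ∀ t, t₀ < t → ∀ φ, HasDerivAt (fun s => dir a (G s) φ)
    (traceForm e (dC t) (fderiv ℝ (fderiv ℝ (dir a (G t))) φ) / 2) t
  bound_nonneg : 0 ≤ K
  bound : ∀ t, t₀ < t → ∀ i j, |dC t i j| ≤ K
  factor : ∀ t, t₀ < t → ∃ v : Fin N → E, ∀ B : E →L[ℝ] E →L[ℝ] ℝ,
    traceForm e (dC t) B = ∑ k, B (v k) (v k)

/-- The logarithm of the quotient of two positive functions. -/
def logQuot (Z G : ℝ → E → ℝ) (t : ℝ) (φ : E) : ℝ := Real.log (G t φ) - Real.log (Z t φ)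

/-- The integrand of the time derivative of `∫ G ∂_a w ∂_b w`. -/
def bochnerForm (Z G : ℝ → E → ℝ) (v : Fin N → E) (t : ℝ) (φ a b : E) : ℝ :=
  ∑ k, G t φ * (dir a (logQuot Z G t) φ * dir (v k) (logQuot Z G t) φ *
      dir (v k) (dir b fun y => Real.log (Z t y)) φ +
    dir b (logQuot Z G t) φ * dir (v k) (logQuot Z G t) φ *
      dir (v k) (dir a fun y => Real.log (Z t y)) φ -
    dir (v k) (dir a (logQuot Z G t)) φ * dir (v k) (dir b (logQuot Z G t)) φ)

/-- `I(t) = ∫ G (∇w)²_{Ċ_t} dD_t`. -/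
def fisher [MeasurableSpace E] (e : Fin N → E) (dC : ℝ → Mat N) (D : ℝ → Measure E)
    (Z G : ℝ → E → ℝ) (t : ℝ) : ℝ :=
  ∑ i, ∑ j, dC t i j * ∫ φ, G t φ * (dir (e i) (logQuot Z G t) φ *
    dir (e j) (logQuot Z G t) φ) ∂D t

namespace HeatPair

variable {e : Fin N → E} {dC : ℝ → Mat N} {t₀ : ℝ} {Z G : ℝ → E → ℝ} {ε M K : ℝ}
  (P : HeatPair e dC t₀ Z G ε M K)
include P

theorem G_pos {t : ℝ} (ht : t₀ < t) (φ : E) : 0 < G t φ :=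
  (mul_pos P.eps_pos (P.Z_pos t ht φ)).trans_le (P.le_G t ht φ)

theorem Z_pos' (t : Ioi t₀) (φ : E) : 0 < Z t φ := P.Z_pos t t.2 φ

theorem Z_le' (t : Ioi t₀) (φ : E) : Z t φ ≤ M := P.Z_le t t.2 φ

theorem contDiff_Z {t : ℝ} (ht : t₀ < t) : ContDiff ℝ 4 (Z t) := P.tame_Z.1 ⟨t, ht⟩

theorem contDiff_G {t : ℝ} (ht : t₀ < t) : ContDiff ℝ 4 (G t) := P.tame_G.1 ⟨t, ht⟩

theorem contDiff_log_Z {t : ℝ} (ht : t₀ < t) : ContDiff ℝ 4 (fun x => Real.log (Z t x)) :=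
  (P.contDiff_Z ht).log fun x => (P.Z_pos t ht x).ne'

theorem contDiff_log_G {t : ℝ} (ht : t₀ < t) : ContDiff ℝ 4 (fun x => Real.log (G t x)) :=
  (P.contDiff_G ht).log fun x => (P.G_pos ht x).ne'

theorem exp_log_Z {t : ℝ} (ht : t₀ < t) : (fun x => Real.exp (Real.log (Z t x))) = Z t := by
  funext x; exact Real.exp_log (P.Z_pos t ht x)

theorem exp_log_G {t : ℝ} (ht : t₀ < t) : (fun x => Real.exp (Real.log (G t x))) = G t := by
  funext x; exact Real.exp_log (P.G_pos ht x)

theorem mild_inv_Z {n : ℕ} (hn : n ≤ 4) {W : Type} [NormedAddCommGroup W] [NormedSpace ℝ W]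
    {f : ℝ → E → W} (hf : Tame n (fun t : Ioi t₀ => Z t) (fun t : Ioi t₀ => f t)) :
    Mild n (fun t : Ioi t₀ => Z t) (fun (t : Ioi t₀) x => (Z t x)⁻¹ • f t x) :=
  Tame.inv_smul P.Z_pos' P.M_nonneg P.Z_le' one_pos (fun i x => by rw [one_mul]) n
    (P.tame_Z.mono hn) hf

theorem mild_inv_G {n : ℕ} (hn : n ≤ 4) {W : Type} [NormedAddCommGroup W] [NormedSpace ℝ W]
    {f : ℝ → E → W} (hf : Tame n (fun t : Ioi t₀ => Z t) (fun t : Ioi t₀ => f t)) :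
    Mild n (fun t : Ioi t₀ => Z t) (fun (t : Ioi t₀) x => (G t x)⁻¹ • f t x) :=
  Tame.inv_smul P.Z_pos' P.M_nonneg P.Z_le' P.eps_pos (fun i x => P.le_G i i.2 x) n
    (P.tame_G.mono hn) hf

theorem hasFDerivAt_logQuot {t : ℝ} (ht : t₀ < t) (φ : E) : HasFDerivAt (logQuot Z G t)
    ((G t φ)⁻¹ • fderiv ℝ (G t) φ - (Z t φ)⁻¹ • fderiv ℝ (Z t) φ) φ :=
  ((((P.contDiff_G ht).differentiable (by norm_num)) φ).hasFDerivAt.log (P.G_pos ht φ).ne').sub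
    ((((P.contDiff_Z ht).differentiable (by norm_num)) φ).hasFDerivAt.log (P.Z_pos t ht φ).ne')

theorem dir_logQuot {t : ℝ} (ht : t₀ < t) (a φ : E) : dir a (logQuot Z G t) φ =
    (G t φ)⁻¹ * dir a (G t) φ - (Z t φ)⁻¹ * dir a (Z t) φ := by
  rw [dir, (P.hasFDerivAt_logQuot ht φ).fderiv]
  rfl

theorem abs_logQuot_le : ∃ L, 0 ≤ L ∧ ∀ t, t₀ < t → ∀ φ, |logQuot Z G t φ| ≤ L := by
  refine ⟨|Real.log ε| + |Real.log M|, by positivity, fun t ht φ => ?_⟩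
  have hZ := P.Z_pos t ht φ
  have hG := P.G_pos ht φ
  have h1 : ε ≤ G t φ / Z t φ := (le_div_iff₀ hZ).2 (P.le_G t ht φ)
  have h2 : G t φ / Z t φ ≤ M := (div_le_iff₀ hZ).2 (P.G_le t ht φ)
  rw [logQuot, ← Real.log_div hG.ne' hZ.ne']
  have h3 := Real.log_le_log P.eps_pos h1
  have h4 := Real.log_le_log (P.eps_pos.trans_le h1) h2
  rw [abs_le]
  constructor <;> linarith [neg_abs_le (Real.log ε), le_abs_self (Real.log M),
    abs_nonneg (Real.log ε), abs_nonneg (Real.log M)]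

/-- The quotient G/Z stays in [ε, M], so w is bounded although log Z and log G need not be. Its
derivative G⁻¹∇G - Z⁻¹∇Z is a difference of tame quotients. -/
theorem mild_logQuot :
    Mild 4 (fun t : Ioi t₀ => Z t) (fun t : Ioi t₀ => logQuot Z G t) := by
  obtain ⟨L, hL0, hL⟩ := P.abs_logQuot_le
  refine Mild.succ (fun t x => (P.hasFDerivAt_logQuot t.2 x).differentiableAt)
    (Mild.of_bounded (fun t => ?_) hL0 (fun t x => hL t t.2 x) P.M_nonneg P.Z_pos' P.Z_le') ?_
  · exact (show Differentiable ℝ (logQuot Z G t) from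
      fun x => (P.hasFDerivAt_logQuot t.2 x).differentiableAt).continuous
  · have h := (P.mild_inv_G (n := 3) (by norm_num) (f := fun t => fderiv ℝ (G t))
      P.tame_G.fderiv).sub (P.mild_inv_Z (n := 3) (by norm_num) (f := fun t => fderiv ℝ (Z t))
      P.tame_Z.fderiv)
    convert h using 3 with t x
    exact (P.hasFDerivAt_logQuot t.2 x).fderiv

/-- The derivative of `Ent`. -/
theorem hasDerivAt_entropy [FiniteDimensional ℝ E] [MeasurableSpace E] [BorelSpace E]
    {C : ℝ → Mat N} {μ : ℝ → ℝ → Measure E} {D : ℝ → Measure E} {K' : ℝ}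
    (H : GaussianFlow e dC C μ D K') (h0 : 0 ≤ t₀) {t : ℝ} (ht : t₀ < t) :
    HasDerivAt (fun s => ∫ φ, G s φ * logQuot Z G s φ ∂D s)
      (∫ φ, -(1 / 2 * (∑ i, ∑ j, dC t i j * (G t φ * (dir (e i) (logQuot Z G t) φ *
        dir (e j) (logQuot Z G t) φ)))) ∂D t) t := by
  -- This is the time derivative of G w, computed from both heat equations as G'w + G' - G Z'/Z.
  set b : ℝ → E → ℝ := fun t φ =>
    (traceForm e (dC t) (fderiv ℝ (fderiv ℝ (G t)) φ) * (logQuot Z G t φ) +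
      (traceForm e (dC t) (fderiv ℝ (fderiv ℝ (G t)) φ) -
      G t φ * ((Z t φ)⁻¹ * traceForm e (dC t) (fderiv ℝ (fderiv ℝ (Z t)) φ)))) * (1 / 2) with hb
  have hw := P.mild_logQuot
  have hTG := P.tame_G.traceForm (n := 2) e (A := fun t : Ioi t₀ => dC t) P.bound_nonneg
    (fun t => P.bound t t.2)
  have hTZ := P.tame_Z.traceForm (n := 2) e (A := fun t : Ioi t₀ => dC t) P.bound_nonneg
    (fun t => P.bound t t.2)
  have hψ : Tame 3 (fun t : Ioi t₀ => Z t) (fun (t : Ioi t₀) φ => G t φ * logQuot Z G t φ) :=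
    (P.tame_G.mul P.Z_pos' hw).mono (by norm_num)
  have hbt : Tame 1 (fun t : Ioi t₀ => Z t) (fun t : Ioi t₀ => b t) := by
    have h1 := (hTG.mul P.Z_pos' (hw.mono (by norm_num))).mono (m := 1) (by norm_num)
    have h2 := hTG.mono (m := 1) (by norm_num)
    have h3 := (P.tame_G.mono (m := 1) (by norm_num)).mul P.Z_pos'
      (P.mild_inv_Z (n := 1) (by norm_num)
        (f := fun t x => traceForm e (dC t) (fderiv ℝ (fderiv ℝ (Z t)) x))
        (hTZ.mono (by norm_num)))
    have h4 := (h1.add (h2.add (h3.comp_left (fun _ => -ContinuousLinearMap.id ℝ ℝ)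
      (fun _ => le_rfl) (norm_nonneg _)))).comp_left
        (fun _ => (1 / 2 : ℝ) • ContinuousLinearMap.id ℝ ℝ) (fun _ => le_rfl) (norm_nonneg _)
    convert h4 using 3 with t x
    simp [hb]
    ring
  obtain ⟨c₁, hc₁⟩ := hψ.exists_bddC3 (f := fun t φ => G t φ * logQuot Z G t φ) P.Z_pos'
    P.M_nonneg P.Z_le'
  obtain ⟨c₂, hc₂, hc₂'⟩ := hbt.exists_lipschitz P.Z_pos' P.M_nonneg P.Z_le'
  have hmax : ∀ s, t₀ < s → BddC3 (max c₁ c₂) (fun φ => G s φ * logQuot Z G s φ) := fun s hs =>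
    ⟨(hc₁ s hs).1, fun j hj x => ((hc₁ s hs).2 j hj x).trans (le_max_left _ _)⟩
  have key := H.hasDerivAt_integral_D h0 ht (b := b) hmax (fun s hs φ => ?_)
    (fun s hs φ => (hc₂ s hs φ).trans (le_max_right _ _)) (fun s hs φ v =>
      (hc₂' s hs φ v).trans (mul_le_mul_of_nonneg_right (le_max_right _ _) (norm_nonneg _)))
  · refine key.congr_deriv (integral_congr_ae (Eventually.of_forall fun φ => ?_))
    obtain ⟨v, hv⟩ := P.factor t ht
    have hg := (P.contDiff_log_G ht).of_le (show (2 : WithTop ℕ∞) ≤ 4 by norm_num)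
    have hz := (P.contDiff_log_Z ht).of_le (show (2 : WithTop ℕ∞) ≤ 4 by norm_num)
    -- The factorisation of Ċ_t, applied to the rank one form dw ⊗ dw, reduces the claim to one
    -- direction v_k at a time, where `entropy_density_identity` applies.
    have hsq : (∑ i, ∑ j, dC t i j * (G t φ * (dir (e i) (logQuot Z G t) φ *
        dir (e j) (logQuot Z G t) φ))) =
        ∑ k, G t φ * (dir (v k) (logQuot Z G t) φ * dir (v k) (logQuot Z G t) φ) := by
      have := hv (G t φ • (fderiv ℝ (logQuot Z G t) φ).smulRight (fderiv ℝ (logQuot Z G t) φ))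
      simpa [traceForm, dir] using this
    have hψ2 : ContDiff ℝ 2 (fun φ => G t φ * logQuot Z G t φ) :=
      (hmax t ht).1.of_le (by norm_num)
    have hG2 : ContDiff ℝ 2 (G t) := (P.contDiff_G ht).of_le (by norm_num)
    have hZ2 : ContDiff ℝ 2 (Z t) := (P.contDiff_Z ht).of_le (by norm_num)
    simp only [hb]
    rw [hsq, hv, hv, hv, Finset.sum_mul, Finset.mul_sum, Finset.mul_sum, ← Finset.sum_sub_distrib,
      ← Finset.sum_add_distrib, Finset.sum_mul, Finset.sum_div, ← Finset.sum_sub_distrib,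
      Finset.mul_sum, ← Finset.sum_neg_distrib]
    refine Finset.sum_congr rfl fun k _ => ?_
    have hid := entropy_density_identity hg hz (v k) φ
    simp only [P.exp_log_G ht, P.exp_log_Z ht, Real.exp_log (P.G_pos ht φ),
      Real.exp_log (P.Z_pos t ht φ)] at hid
    have e1 : (fun y => G t y * (Real.log (G t y) - Real.log (Z t y))) =
      fun y => G t y * logQuot Z G t y := rfl
    have e2 : (fun y => Real.log (G t y) - Real.log (Z t y)) = logQuot Z G t := rfl
    have e3 : Real.log (G t φ) - Real.log (Z t φ) = logQuot Z G t φ := rfl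
    have e4 : (fun y => Real.exp (Real.log (G t y)) * (Real.log (G t y) - Real.log (Z t y))) =
      fun y => G t y * logQuot Z G t y := by
      funext y; rw [Real.exp_log (P.G_pos ht y)]; rfl
    rw [fderiv_fderiv_eq_dir hG2, fderiv_fderiv_eq_dir hZ2, fderiv_fderiv_eq_dir hψ2]
    simp only [e2, e3, e4] at hid
    linarith
  · have hd := ((P.heat_G s hs φ).log (P.G_pos hs φ).ne').fun_sub
      ((P.heat_Z s hs φ).log (P.Z_pos s hs φ).ne')
    refine ((P.heat_G s hs φ).fun_mul hd).congr_deriv ?_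
    have := (P.G_pos hs φ).ne'
    have := (P.Z_pos s hs φ).ne'
    simp only [hb, logQuot]
    field_simp

/-- The derivative of `t ↦ ∫ G ∂_a w ∂_b w dD_t`. -/
theorem hasDerivAt_integral_dir_dir [FiniteDimensional ℝ E] [MeasurableSpace E] [BorelSpace E]
    {C : ℝ → Mat N} {μ : ℝ → ℝ → Measure E} {D : ℝ → Measure E} {K' : ℝ}
    (H : GaussianFlow e dC C μ D K') (h0 : 0 ≤ t₀) {t : ℝ} (ht : t₀ < t) {v : Fin N → E}
    (hv : ∀ B : E →L[ℝ] E →L[ℝ] ℝ, traceForm e (dC t) B = ∑ k, B (v k) (v k)) (a b : E) :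
    HasDerivAt (fun s => ∫ φ, G s φ * (dir a (logQuot Z G s) φ * dir b (logQuot Z G s) φ) ∂D s)
      (∫ φ, bochnerForm Z G v t φ a b ∂D t) t := by
  set TG : ℝ → E → ℝ := fun t φ => traceForm e (dC t) (fderiv ℝ (fderiv ℝ (G t)) φ) with hTG
  set TZ : ℝ → E → ℝ := fun t φ => traceForm e (dC t) (fderiv ℝ (fderiv ℝ (Z t)) φ) with hTZ
  set TGd : E → ℝ → E → ℝ := fun a t φ =>
    traceForm e (dC t) (fderiv ℝ (fderiv ℝ (dir a (G t))) φ) with hTGd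
  set TZd : E → ℝ → E → ℝ := fun a t φ =>
    traceForm e (dC t) (fderiv ℝ (fderiv ℝ (dir a (Z t))) φ) with hTZd
  -- Half of this is the time derivative of ∂_a w. It is arranged so that every division by G or Z
  -- has a tame numerator, which makes it mild.
  set A : E → ℝ → E → ℝ := fun a t φ =>
    ((G t φ)⁻¹ * TGd a t φ - ((G t φ)⁻¹ * TG t φ) * ((G t φ)⁻¹ * dir a (G t) φ)) -
    ((Z t φ)⁻¹ * TZd a t φ - ((Z t φ)⁻¹ * TZ t φ) * ((Z t φ)⁻¹ * dir a (Z t) φ)) with hA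
  set β : ℝ → E → ℝ := fun t φ =>
    (TG t φ * (dir a (logQuot Z G t) φ * dir b (logQuot Z G t) φ) +
      (G t φ * (A a t φ * dir b (logQuot Z G t) φ) +
        G t φ * (dir a (logQuot Z G t) φ * A b t φ))) * (1 / 2) with hβ
  have hw := P.mild_logQuot
  have hwd : ∀ a, Mild 3 (fun t : Ioi t₀ => Z t) (fun t : Ioi t₀ => dir a (logQuot Z G t)) :=
    fun a => hw.dir a
  have hwd1 : ∀ a, Mild 1 (fun t : Ioi t₀ => Z t) (fun t : Ioi t₀ => dir a (logQuot Z G t)) :=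
    fun a => (hwd a).mono (by norm_num)
  have tTG : Tame 1 (fun t : Ioi t₀ => Z t) (fun t : Ioi t₀ => TG t) :=
    (P.tame_G.traceForm (n := 2) e (A := fun t : Ioi t₀ => dC t) P.bound_nonneg
      (fun t => P.bound t t.2)).mono (by norm_num)
  have tTZ : Tame 1 (fun t : Ioi t₀ => Z t) (fun t : Ioi t₀ => TZ t) :=
    (P.tame_Z.traceForm (n := 2) e (A := fun t : Ioi t₀ => dC t) P.bound_nonneg
      (fun t => P.bound t t.2)).mono (by norm_num)
  have tTGd : ∀ a, Tame 1 (fun t : Ioi t₀ => Z t) (fun t : Ioi t₀ => TGd a t) := fun a =>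
    (P.tame_G.dir (n := 3) a).traceForm (n := 1) e (A := fun t : Ioi t₀ => dC t) P.bound_nonneg
      (fun t => P.bound t t.2)
  have tTZd : ∀ a, Tame 1 (fun t : Ioi t₀ => Z t) (fun t : Ioi t₀ => TZd a t) := fun a =>
    (P.tame_Z.dir (n := 3) a).traceForm (n := 1) e (A := fun t : Ioi t₀ => dC t) P.bound_nonneg
      (fun t => P.bound t t.2)
  have mA : ∀ a, Mild 1 (fun t : Ioi t₀ => Z t) (fun t : Ioi t₀ => A a t) := fun a =>
    ((P.mild_inv_G (by norm_num) (tTGd a)).sub ((P.mild_inv_G (by norm_num) tTG).mul P.Z_pos'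
      (P.mild_inv_G (n := 1) (by norm_num) (f := fun t => dir a (G t))
        ((P.tame_G.dir (n := 3) a).mono (by norm_num))))).sub
    ((P.mild_inv_Z (by norm_num) (tTZd a)).sub ((P.mild_inv_Z (by norm_num) tTZ).mul P.Z_pos'
      (P.mild_inv_Z (n := 1) (by norm_num) (f := fun t => dir a (Z t))
        ((P.tame_Z.dir (n := 3) a).mono (by norm_num)))))
  have hψ : Tame 3 (fun t : Ioi t₀ => Z t) (fun (t : Ioi t₀) φ =>
      G t φ * (dir a (logQuot Z G t) φ * dir b (logQuot Z G t) φ)) :=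
    (P.tame_G.mono (by norm_num)).mul P.Z_pos' ((hwd a).mul P.Z_pos' (hwd b))
  have hβt : Tame 1 (fun t : Ioi t₀ => Z t) (fun t : Ioi t₀ => β t) := by
    have hG1 := P.tame_G.mono (m := 1) (by norm_num)
    have h1 := tTG.mul P.Z_pos' ((hwd1 a).mul P.Z_pos' (hwd1 b))
    have h2 := hG1.mul P.Z_pos' ((mA a).mul P.Z_pos' (hwd1 b))
    have h3 := hG1.mul P.Z_pos' ((hwd1 a).mul P.Z_pos' (mA b))
    have h4 := (h1.add (h2.add h3)).comp_left
        (fun _ => (1 / 2 : ℝ) • ContinuousLinearMap.id ℝ ℝ) (fun _ => le_rfl) (norm_nonneg _)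
    convert h4 using 3 with t x
    simp only [hβ, smul_apply, smul_eq_mul, ContinuousLinearMap.id_apply]
    ring
  obtain ⟨c₁, hc₁⟩ := hψ.exists_bddC3
    (f := fun t φ => G t φ * (dir a (logQuot Z G t) φ * dir b (logQuot Z G t) φ)) P.Z_pos'
    P.M_nonneg P.Z_le'
  obtain ⟨c₂, hc₂, hc₂'⟩ := hβt.exists_lipschitz P.Z_pos' P.M_nonneg P.Z_le'
  have hmax : ∀ s, t₀ < s → BddC3 (max c₁ c₂)
      (fun φ => G s φ * (dir a (logQuot Z G s) φ * dir b (logQuot Z G s) φ)) := fun s hs =>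
    ⟨(hc₁ s hs).1, fun j hj x => ((hc₁ s hs).2 j hj x).trans (le_max_left _ _)⟩
  have key := H.hasDerivAt_integral_D h0 ht (b := β) hmax (fun s hs φ => ?_)
    (fun s hs φ => (hc₂ s hs φ).trans (le_max_right _ _)) (fun s hs φ v =>
      (hc₂' s hs φ v).trans (mul_le_mul_of_nonneg_right (le_max_right _ _) (norm_nonneg _)))
  · refine key.congr_deriv (integral_congr_ae (Eventually.of_forall fun φ => ?_))
    have hg := (P.contDiff_log_G ht).of_le (show (3 : WithTop ℕ∞) ≤ 4 by norm_num)
    have hz := (P.contDiff_log_Z ht).of_le (show (3 : WithTop ℕ∞) ≤ 4 by norm_num)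
    have hψ2 : ContDiff ℝ 2 (fun φ => G t φ * (dir a (logQuot Z G t) φ *
        dir b (logQuot Z G t) φ)) := (hmax t ht).1.of_le (by norm_num)
    have hG2 : ContDiff ℝ 2 (G t) := (P.contDiff_G ht).of_le (by norm_num)
    have hZ2 : ContDiff ℝ 2 (Z t) := (P.contDiff_Z ht).of_le (by norm_num)
    have hGd : ∀ a, ContDiff ℝ 2 (dir a (G t)) := fun a =>
      contDiff_dir (n := 2) ((P.contDiff_G ht).of_le (by norm_num)) a
    have hZd : ∀ a, ContDiff ℝ 2 (dir a (Z t)) := fun a =>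
      contDiff_dir (n := 2) ((P.contDiff_Z ht).of_le (by norm_num)) a
    set Ak : Fin N → E → ℝ := fun k a =>
      ((G t φ)⁻¹ * dir (v k) (dir (v k) (dir a (G t))) φ -
        ((G t φ)⁻¹ * dir (v k) (dir (v k) (G t)) φ) * ((G t φ)⁻¹ * dir a (G t) φ)) -
      ((Z t φ)⁻¹ * dir (v k) (dir (v k) (dir a (Z t))) φ -
        ((Z t φ)⁻¹ * dir (v k) (dir (v k) (Z t)) φ) * ((Z t φ)⁻¹ * dir a (Z t) φ)) with hAk
    have hAs : ∀ a, A a t φ = ∑ k, Ak k a := fun a => by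
      simp only [hA, hAk, hTG, hTZ, hTGd, hTZd, hv, fderiv_fderiv_eq_dir hG2,
        fderiv_fderiv_eq_dir hZ2, fderiv_fderiv_eq_dir (hGd a), fderiv_fderiv_eq_dir (hZd a),
        Finset.sum_sub_distrib, Finset.mul_sum, Finset.sum_mul]
    simp only [hβ, hAs, bochnerForm]
    rw [hTG]
    simp only [hv, fderiv_fderiv_eq_dir hG2, fderiv_fderiv_eq_dir hψ2]
    rw [Finset.sum_mul, Finset.sum_mul, Finset.mul_sum, Finset.mul_sum, Finset.mul_sum,
      ← Finset.sum_add_distrib, ← Finset.sum_add_distrib, Finset.sum_mul, Finset.sum_div,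
      ← Finset.sum_sub_distrib]
    refine Finset.sum_congr rfl fun k _ => ?_
    have hid := bochner_identity hg hz (w := logQuot Z G t) rfl (A := Ak k) (k := v k) (x := φ)
      (fun c => by
        simp only [P.exp_log_G ht, P.exp_log_Z ht, Real.exp_log (P.G_pos ht φ),
          Real.exp_log (P.Z_pos t ht φ), hAk]) a b
    have e4 : (fun y => Real.exp (Real.log (G t y)) * (dir a (logQuot Z G t) y *
        dir b (logQuot Z G t) y)) =
        fun y => G t y * (dir a (logQuot Z G t) y * dir b (logQuot Z G t) y) := by
      funext y; rw [Real.exp_log (P.G_pos ht y)]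
    rw [e4, P.exp_log_G ht, Real.exp_log (P.G_pos ht φ)] at hid
    linarith
  · have hd : ∀ a, HasDerivAt (fun s => dir a (logQuot Z G s) φ) (A a s φ / 2) s := fun a => by
      have h1 := (((P.heat_G s hs φ).inv (P.G_pos hs φ).ne').fun_mul (P.heat_dir_G a s hs φ)).fun_sub
        (((P.heat_Z s hs φ).inv (P.Z_pos s hs φ).ne').fun_mul (P.heat_dir_Z a s hs φ))
      refine (h1.congr_deriv ?_).congr_of_eventuallyEq ?_
      · have := (P.G_pos hs φ).ne'
        have := (P.Z_pos s hs φ).ne'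
        simp only [hA, hTG, hTZ, hTGd, hTZd, Pi.inv_apply]
        field_simp
        ring
      · filter_upwards [lt_mem_nhds hs] with r hr
        exact P.dir_logQuot hr a φ
    refine ((P.heat_G s hs φ).fun_mul ((hd a).fun_mul (hd b))).congr_deriv ?_
    simp only [hβ, hTG]
    ring

theorem continuous_density {t : ℝ} (ht : t₀ < t) (a b : E) :
    Continuous fun φ => G t φ * (dir a (logQuot Z G t) φ * dir b (logQuot Z G t) φ) := by
  have hw : ∀ a, Continuous (dir a (logQuot Z G t)) := fun a =>
    ((P.mild_logQuot.dir a).1 ⟨t, ht⟩).continuous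
  exact (P.contDiff_G ht).continuous.mul ((hw a).mul (hw b))

theorem exists_density_bound {t : ℝ} (ht : t₀ < t) (a b : E) : ∃ c, ∀ φ,
    ‖G t φ * (dir a (logQuot Z G t) φ * dir b (logQuot Z G t) φ)‖ ≤ c := by
  have h := (P.tame_G.mono (m := 3) (by norm_num)).mul P.Z_pos'
    ((P.mild_logQuot.dir a).mul P.Z_pos' (P.mild_logQuot.dir b))
  obtain ⟨c, -, hc⟩ := h.const_le (fun i x => (P.Z_pos' i x).le) P.M_nonneg P.Z_le'
    (Nat.zero_le 3)
  exact ⟨c, fun φ => by simpa only [norm_iteratedFDeriv_zero] using hc ⟨t, ht⟩ φ⟩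

/-- Every summand is G times a product of mild derivatives of w and log Z, hence tame and in
particular bounded. -/
theorem integrable_bochnerForm [FiniteDimensional ℝ E] [MeasurableSpace E] [BorelSpace E]
    {C : ℝ → Mat N} {μ : ℝ → ℝ → Measure E} {D : ℝ → Measure E} {K' : ℝ}
    (H : GaussianFlow e dC C μ D K') {t : ℝ} (ht : t₀ < t) (v : Fin N → E) (a b : E) :
    Integrable (fun φ => bochnerForm Z G v t φ a b) (D t) := by
  refine integrable_finsetSum _ fun k _ => ?_
  have hz : ∀ a, Mild 2 (fun t : Ioi t₀ => Z t)
      (fun t : Ioi t₀ => dir (v k) (dir a fun y => Real.log (Z t y))) := fun a => by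
    refine Mild.dir ?_ (v k)
    have h := (P.mild_inv_Z (n := 3) (by norm_num) (f := fun t => fderiv ℝ (Z t))
      P.tame_Z.fderiv).clm_apply a
    convert h using 3 with t
    exact congrFun (dir_log ((P.contDiff_Z t.2).differentiable (by norm_num)) (P.Z_pos' t) a) _
  have hw : ∀ a, Mild 2 (fun t : Ioi t₀ => Z t) (fun t : Ioi t₀ => dir a (logQuot Z G t)) :=
    fun a => (P.mild_logQuot.dir a).mono (by norm_num)
  have hw2 : ∀ a, Mild 2 (fun t : Ioi t₀ => Z t)
      (fun t : Ioi t₀ => dir (v k) (dir a (logQuot Z G t))) := fun a =>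
    (P.mild_logQuot.dir a).dir (v k)
  have hG : Tame 2 (fun t : Ioi t₀ => Z t) (fun t : Ioi t₀ => G t) := P.tame_G.mono (by norm_num)
  have h1 := hG.mul P.Z_pos' (((hw a).mul P.Z_pos' (hw (v k))).mul P.Z_pos' (hz b))
  have h2 := hG.mul P.Z_pos' (((hw b).mul P.Z_pos' (hw (v k))).mul P.Z_pos' (hz a))
  have h3 := hG.mul P.Z_pos' ((hw2 a).mul P.Z_pos' (hw2 b))
  have hint : ∀ {f : Ioi t₀ → E → ℝ}, Tame 2 (fun t : Ioi t₀ => Z t) f →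
      Integrable (f ⟨t, ht⟩) (D t) := fun {f} hf => by
    obtain ⟨c, -, hc⟩ := hf.const_le (fun i x => (P.Z_pos' i x).le) P.M_nonneg P.Z_le'
      (Nat.zero_le 2)
    exact H.integrable_D (hf.1 _).continuous (M := c)
      (fun φ => by simpa only [norm_iteratedFDeriv_zero] using hc ⟨t, ht⟩ φ) t
  refine (((hint h1).add (hint h2)).sub (hint h3)).congr (Eventually.of_forall fun φ => ?_)
  simp only [Pi.add_apply, Pi.sub_apply]
  ring

/-- In the directions v_k the contraction is a double sum. The two terms with Hess log Z coincide by
symmetry of second derivatives and add up to its value on Ċ_t∇w; the squares of the second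
derivatives of w enter with a negative sign and are dropped. -/
theorem sum_mul_density {t : ℝ} (ht : t₀ < t) {v : Fin N → E}
    (hv : ∀ B : E →L[ℝ] E →L[ℝ] ℝ, traceForm e (dC t) B = ∑ k, B (v k) (v k)) (φ : E) :
    ∑ i, ∑ j, dC t i j * bochnerForm Z G v t φ (e i) (e j) ≤
      2 * G t φ * fderiv ℝ (fderiv ℝ fun y => Real.log (Z t y)) φ
        (∑ i, ∑ j, (dC t i j * dir (e i) (logQuot Z G t) φ) • e j)
        (∑ i, ∑ j, (dC t i j * dir (e i) (logQuot Z G t) φ) • e j) := by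
  set ℓ := fderiv ℝ (logQuot Z G t) φ with hℓ
  set Bz := fderiv ℝ (fderiv ℝ fun y => Real.log (Z t y)) φ with hBz
  set Bw := fderiv ℝ (fderiv ℝ (logQuot Z G t)) φ with hBw
  have hz2 : ContDiff ℝ 2 (fun y => Real.log (Z t y)) := (P.contDiff_log_Z ht).of_le (by norm_num)
  have hw2 : ContDiff ℝ 2 (logQuot Z G t) :=
    (P.mild_logQuot.1 ⟨t, ht⟩).of_le (by norm_num)
  have hs : ∑ i, ∑ j, (dC t i j * dir (e i) (logQuot Z G t) φ) • e j = ∑ k, ℓ (v k) • v k := by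
    refine (SeparatingDual.eq_iff_forall_dual_eq (R := ℝ)).2 fun f => ?_
    have := hv (ℓ.smulRight f)
    simp only [traceForm, ContinuousLinearMap.smulRight_apply, smul_apply, smul_eq_mul] at this
    simp only [map_sum, map_smul, smul_eq_mul, ← this, dir, ← hℓ]
    exact Finset.sum_congr rfl fun i _ => Finset.sum_congr rfl fun j _ => by ring
  have hκ := hv (∑ k, G t φ • (ℓ (v k) • (ℓ.smulRight (Bz (v k)) + (Bz (v k)).smulRight ℓ) -
    (Bw (v k)).smulRight (Bw (v k))))
  have e1 : ∀ a b, bochnerForm Z G v t φ a b =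
      (∑ k, G t φ • (ℓ (v k) • (ℓ.smulRight (Bz (v k)) + (Bz (v k)).smulRight ℓ) -
        (Bw (v k)).smulRight (Bw (v k)))) a b := fun a b => by
    simp only [bochnerForm, sum_apply, smul_apply, sub_apply, add_apply,
      ContinuousLinearMap.smulRight_apply, smul_eq_mul, ← fderiv_fderiv_eq_dir hz2,
      ← fderiv_fderiv_eq_dir hw2, ← hBz, ← hBw]
    refine Finset.sum_congr rfl fun k _ => ?_
    simp only [dir, ← hℓ]
    ring
  simp only [e1]
  rw [traceForm] at hκ
  rw [hκ, hs]
  have hG := (P.G_pos ht φ).le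
  simp only [sum_apply, smul_apply, sub_apply, add_apply,
      ContinuousLinearMap.smulRight_apply, smul_eq_mul, map_sum, map_smul]
  rw [Finset.mul_sum]
  refine Finset.sum_le_sum fun l _ => ?_
  rw [Finset.mul_sum, Finset.mul_sum]
  refine Finset.sum_le_sum fun k _ => ?_
  have : Bz (v k) (v l) = Bz (v l) (v k) := by
    rw [hBz, fderiv_fderiv_eq_dir hz2, fderiv_fderiv_eq_dir hz2, dir_comm hz2]
  rw [this]
  nlinarith [mul_nonneg hG (mul_self_nonneg (Bw (v k) (v l)))]

/-- The differential inequality for the Fisher information under the multiscale criterion. -/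
theorem exists_hasDerivAt_fisher [FiniteDimensional ℝ E] [MeasurableSpace E] [BorelSpace E]
    {C : ℝ → Mat N} {μ : ℝ → ℝ → Measure E} {D : ℝ → Measure E} {K' : ℝ}
    (H : GaussianFlow e dC C μ D K') (h0 : 0 ≤ t₀) {t : ℝ} (ht : t₀ < t) {C₂ : Mat N}
    (hC₂ : ∀ i j, HasDerivAt (fun s => dC s i j) (C₂ i j) t) {κ : ℝ}
    (hcrit : ∀ φ (ℓ : E →L[ℝ] ℝ), κ * ∑ i, ∑ j, dC t i j * (ℓ (e i) * ℓ (e j)) ≤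
      -fderiv ℝ (fderiv ℝ fun y => Real.log (Z t y)) φ (∑ i, ∑ j, (dC t i j * ℓ (e i)) • e j)
        (∑ i, ∑ j, (dC t i j * ℓ (e i)) • e j) -
      1 / 2 * ∑ i, ∑ j, C₂ i j * (ℓ (e i) * ℓ (e j))) :
    ∃ I', HasDerivAt (fisher e dC D Z G) I' t ∧ I' ≤ -2 * κ * fisher e dC D Z G t := by
  obtain ⟨v, hv⟩ := P.factor t ht
  set J : Fin N → Fin N → E → ℝ := fun i j φ =>
    G t φ * (dir (e i) (logQuot Z G t) φ * dir (e j) (logQuot Z G t) φ) with hJ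
  have hJi : ∀ i j, Integrable (J i j) (D t) := fun i j => by
    obtain ⟨c, hc⟩ := P.exists_density_bound ht (e i) (e j)
    exact H.integrable_D (P.continuous_density ht (e i) (e j)) hc t
  have hder : HasDerivAt (fisher e dC D Z G) (∑ i, ∑ j, (C₂ i j * (∫ φ, J i j φ ∂D t) +
      dC t i j * ∫ φ, bochnerForm Z G v t φ (e i) (e j) ∂D t)) t :=
    HasDerivAt.fun_sum fun i _ => HasDerivAt.fun_sum fun j _ =>
      (hC₂ i j).fun_mul (P.hasDerivAt_integral_dir_dir H h0 ht hv (e i) (e j))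
  refine ⟨_, hder, ?_⟩
  have hKi := fun i j => P.integrable_bochnerForm H ht v (e i) (e j)
  have hi1 : Integrable (fun φ => ∑ i, ∑ j, (C₂ i j * J i j φ +
      dC t i j * bochnerForm Z G v t φ (e i) (e j))) (D t) :=
    integrable_finsetSum _ fun i _ => integrable_finsetSum _ fun j _ =>
      ((hJi i j).const_mul _).add ((hKi i j).const_mul _)
  have hi2 : Integrable (fun φ => -2 * κ * ∑ i, ∑ j, dC t i j * J i j φ) (D t) :=
    (integrable_sum_sum (dC t) hJi).const_mul _
  have e1 : ∑ i, ∑ j, (C₂ i j * (∫ φ, J i j φ ∂D t) +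
      dC t i j * ∫ φ, bochnerForm Z G v t φ (e i) (e j) ∂D t) =
      ∫ φ, ∑ i, ∑ j, (C₂ i j * J i j φ + dC t i j * bochnerForm Z G v t φ (e i) (e j)) ∂D t := by
    have h := integral_add (integrable_sum_sum C₂ hJi) (integrable_sum_sum (dC t) hKi)
    rw [integral_sum_sum C₂ hJi, integral_sum_sum (dC t) hKi] at h
    simp only [Finset.sum_add_distrib]
    exact h.symm
  have e2 : -2 * κ * fisher e dC D Z G t =
      ∫ φ, -2 * κ * ∑ i, ∑ j, dC t i j * J i j φ ∂D t := by
    rw [integral_const_mul, integral_sum_sum (dC t) hJi]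
    rfl
  rw [e1, e2]
  refine integral_mono hi1 hi2 fun φ => ?_
  -- Pointwise, the integrand is at most G times (∇w)²_{C₂} + 2 Hess log Z(Ċ_t∇w, Ċ_t∇w), which is
  -- -2G times the form on the right of the criterion, evaluated at ℓ = dw.
  have h1 := P.sum_mul_density ht hv φ
  have h2 := hcrit φ (fderiv ℝ (logQuot Z G t) φ)
  have hG := (P.G_pos ht φ).le
  have h3 := mul_le_mul_of_nonneg_left h2 (mul_nonneg zero_le_two hG)
  have e3 : ∀ A : Mat N, ∑ i, ∑ j, A i j * J i j φ = G t φ * ∑ i, ∑ j, A i j *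
      (fderiv ℝ (logQuot Z G t) φ (e i) * fderiv ℝ (logQuot Z G t) φ (e j)) := fun A => by
    simp only [Finset.mul_sum]
    exact Finset.sum_congr rfl fun i _ => Finset.sum_congr rfl fun j _ => by
      simp only [hJ, dir]; ring
  simp only [Finset.sum_add_distrib, e3]
  simp only [dir] at h1
  linarith

theorem integral_density_eq_fisher [FiniteDimensional ℝ E] [MeasurableSpace E] [BorelSpace E]
    {C : ℝ → Mat N} {μ : ℝ → ℝ → Measure E} {D : ℝ → Measure E} {K' : ℝ}
    (H : GaussianFlow e dC C μ D K') {t : ℝ} (ht : t₀ < t) :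
    ∫ φ, ∑ i, ∑ j, dC t i j * (G t φ * (dir (e i) (logQuot Z G t) φ *
        dir (e j) (logQuot Z G t) φ)) ∂D t = fisher e dC D Z G t := by
  refine integral_sum_sum (dC t) fun i j => ?_
  obtain ⟨c, hc⟩ := P.exists_density_bound ht (e i) (e j)
  exact H.integrable_D (P.continuous_density ht (e i) (e j)) hc t

theorem hasDerivAt_entropy_fisher [FiniteDimensional ℝ E] [MeasurableSpace E] [BorelSpace E]
    {C : ℝ → Mat N} {μ : ℝ → ℝ → Measure E} {D : ℝ → Measure E} {K' : ℝ}
    (H : GaussianFlow e dC C μ D K') (h0 : 0 ≤ t₀) {t : ℝ} (ht : t₀ < t) :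
    HasDerivAt (fun s => ∫ φ, G s φ * logQuot Z G s φ ∂D s)
      (-(1 / 2 * fisher e dC D Z G t)) t := by
  refine (P.hasDerivAt_entropy H h0 ht).congr_deriv ?_
  rw [integral_neg, integral_const_mul, P.integral_density_eq_fisher H ht]

theorem fisher_nonneg [FiniteDimensional ℝ E] [MeasurableSpace E] [BorelSpace E]
    {C : ℝ → Mat N} {μ : ℝ → ℝ → Measure E} {D : ℝ → Measure E} {K' : ℝ}
    (H : GaussianFlow e dC C μ D K') {t : ℝ} (ht : t₀ < t) : 0 ≤ fisher e dC D Z G t := by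
  rw [← P.integral_density_eq_fisher H ht]
  refine integral_nonneg fun φ => ?_
  obtain ⟨v, hv⟩ := P.factor t ht
  have := hv (G t φ • (fderiv ℝ (logQuot Z G t) φ).smulRight (fderiv ℝ (logQuot Z G t) φ))
  simp only [traceForm, smul_apply, ContinuousLinearMap.smulRight_apply, smul_eq_mul] at this
  simp only [dir, this, Pi.zero_apply]
  exact Finset.sum_nonneg fun k _ => mul_nonneg (P.G_pos ht φ).le (mul_self_nonneg _)

end HeatPair

end HeatPair

/-! ### Grönwall's inequality with an integrable coefficient -/

section Gronwall

/-- Only k is assumed integrable, so the derivative f'/f of log f is not integrated; it is compared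
with k through the one-sided fundamental theorem for inequalities. -/
theorem log_sub_log_le_integral {f f' k : ℝ → ℝ} {a b : ℝ} (hab : a ≤ b)
    (hf : ∀ x ∈ Icc a b, HasDerivAt f (f' x) x) (h0 : ∀ x ∈ Icc a b, 0 < f x)
    (hk : IntervalIntegrable k volume a b) (hle : ∀ x ∈ Icc a b, f' x ≤ k x * f x) :
    Real.log (f b) - Real.log (f a) ≤ ∫ x in a..b, k x := by
  refine intervalIntegral.sub_le_integral_of_hasDeriv_right_of_le (g' := fun x => f' x / f x) hab
    (fun x hx => ((hf x hx).continuousAt.log (h0 x hx).ne').continuousWithinAt)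
    (fun x hx => ((hf x (Ioo_subset_Icc_self hx)).log
      (h0 x (Ioo_subset_Icc_self hx)).ne').hasDerivWithinAt)
    ((intervalIntegrable_iff_integrableOn_Icc_of_le hab).1 hk) fun x hx => ?_
  exact (div_le_iff₀ (h0 x (Ioo_subset_Icc_self hx))).2 (hle x (Ioo_subset_Icc_self hx))

/-- Grönwall's inequality for a nonnegative function and an integrable coefficient. -/
theorem le_mul_exp_integral_of_deriv_le {f f' k : ℝ → ℝ} {a b : ℝ} (hab : a ≤ b)
    (hf : ∀ x ∈ Icc a b, HasDerivAt f (f' x) x) (h0 : ∀ x ∈ Icc a b, 0 ≤ f x)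
    (hk : IntervalIntegrable k volume a b) (hle : ∀ x ∈ Icc a b, f' x ≤ k x * f x) :
    f b ≤ f a * Real.exp (∫ x in a..b, k x) := by
  by_cases hz : ∀ x ∈ Icc a b, 0 < f x
  · have h := log_sub_log_le_integral hab hf hz hk hle
    have ha := hz a (left_mem_Icc.2 hab)
    have hb := hz b (right_mem_Icc.2 hab)
    rw [← Real.log_div hb.ne' ha.ne', Real.log_le_iff_le_exp (div_pos hb ha),
      div_le_iff₀ ha] at h
    linarith
  -- If f vanishes at c, the positive case applied to f + ε on [c, b], with |k| as coefficient,
  -- gives f b ≤ const · ε, hence f b = 0.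
  · push Not at hz
    obtain ⟨c, hc, hfc⟩ := hz
    have hfc : f c = 0 := le_antisymm hfc (h0 c hc)
    have hsub : ∀ x ∈ Icc c b, x ∈ Icc a b := fun x hx => ⟨hc.1.trans hx.1, hx.2⟩
    have hk' : IntervalIntegrable k volume c b := hk.mono_set (by
      rw [uIcc_of_le hc.2, uIcc_of_le hab]; exact Icc_subset_Icc_left hc.1)
    have key : ∀ ε > 0, f b ≤ ε * Real.exp (∫ x in c..b, |k x|) := fun ε hε => by
      have hpos : ∀ x ∈ Icc c b, 0 < f x + ε := fun x hx =>
        add_pos_of_nonneg_of_pos (h0 x (hsub x hx)) hε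
      have h := log_sub_log_le_integral hc.2 (f := fun x => f x + ε)
        (fun x hx => (hf x (hsub x hx)).add_const ε) hpos hk'.abs
        (fun x hx => (hle x (hsub x hx)).trans (by
          have := h0 x (hsub x hx)
          nlinarith [le_abs_self (k x), abs_nonneg (k x), mul_nonneg (abs_nonneg (k x)) hε.le,
            mul_nonneg (sub_nonneg.2 (le_abs_self (k x))) this]))
      have hb := hpos b (right_mem_Icc.2 hc.2)
      simp only [hfc, zero_add] at h
      rw [← Real.log_div hb.ne' hε.ne', Real.log_le_iff_le_exp (div_pos hb hε),
        div_le_iff₀ hε] at h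
      linarith
    have hb : f b ≤ 0 := by
      have : Tendsto (fun ε : ℝ => ε * Real.exp (∫ x in c..b, |k x|)) (𝓝[>] 0) (𝓝 0) := by
        have h : Tendsto (fun ε : ℝ => ε * Real.exp (∫ x in c..b, |k x|)) (𝓝 0)
            (𝓝 (0 * Real.exp (∫ x in c..b, |k x|))) := tendsto_id.mul_const _
        rw [zero_mul] at h
        exact h.mono_left nhdsWithin_le_nhds
      exact ge_of_tendsto this (eventually_mem_nhdsWithin.mono fun ε hε => key ε hε)
    exact hb.trans (mul_nonneg (h0 a (left_mem_Icc.2 hab)) (Real.exp_pos _).le)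

end Gronwall

/-! ### Convexity of the entropy in the clock Λ -/

section Convexity

/-- Convexity of the entropy as a function of `Λ`. -/
theorem entropy_convex {S I lam Λ : ℝ → ℝ} (hS : ∀ t, 0 < t → HasDerivAt S (-(1 / 2 * I t)) t)
    (hΛ : ∀ t, 0 < t → HasDerivAt Λ (Real.exp (-2 * lam t)) t)
    (hI : ∀ s t, 0 < s → s ≤ t → I t ≤ I s * Real.exp (-2 * (lam t - lam s))) {r s T : ℝ}
    (hr : 0 < r) (hrs : r ≤ s) (hsT : s ≤ T) :
    (S s - S T) * (Λ s - Λ r) ≤ (S r - S s) * (Λ T - Λ s) := by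
  have hs : 0 < s := hr.trans_le hrs
  -- A is minus the slope of S with respect to Λ at time s. The decay of I makes S + AΛ decrease
  -- before s and increase after it, which is the tangent line inequality.
  set A := 1 / 2 * (I s * Real.exp (2 * lam s)) with hA
  have hd : ∀ t, 0 < t → HasDerivAt (fun t => S t + A * Λ t)
      (1 / 2 * (I s * Real.exp (-2 * (lam t - lam s)) - I t)) t := fun t ht => by
    refine ((hS t ht).fun_add ((hΛ t ht).const_mul A)).congr_deriv ?_
    rw [hA, show -2 * (lam t - lam s) = 2 * lam s + -2 * lam t by ring, Real.exp_add]
    ring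
  have hmono : ∀ {a b : ℝ}, 0 < a → a ≤ b → MonotoneOn Λ (Icc a b) := fun {a b} ha hab => by
    refine monotoneOn_of_deriv_nonneg (convex_Icc a b)
      (fun t ht => (hΛ t (ha.trans_le ht.1)).continuousAt.continuousWithinAt)
      (fun t ht => ?_) (fun t ht => ?_)
    · rw [interior_Icc] at ht
      exact (hΛ t (ha.trans ht.1)).differentiableAt.differentiableWithinAt
    · rw [interior_Icc] at ht
      rw [(hΛ t (ha.trans ht.1)).deriv]
      positivity
  have h1 : S s + A * Λ s ≤ S T + A * Λ T := by
    refine (monotoneOn_of_deriv_nonneg (convex_Icc s T)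
      (fun t ht => (hd t (hs.trans_le ht.1)).continuousAt.continuousWithinAt)
      (fun t ht => ?_) (fun t ht => ?_)) (left_mem_Icc.2 hsT) (right_mem_Icc.2 hsT) hsT
    · rw [interior_Icc] at ht
      exact (hd t (hs.trans ht.1)).differentiableAt.differentiableWithinAt
    · rw [interior_Icc] at ht
      rw [(hd t (hs.trans ht.1)).deriv]
      linarith [hI s t hs ht.1.le]
  have h2 : S s + A * Λ s ≤ S r + A * Λ r := by
    refine (antitoneOn_of_deriv_nonpos (convex_Icc r s)
      (fun t ht => (hd t (hr.trans_le ht.1)).continuousAt.continuousWithinAt)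
      (fun t ht => ?_) (fun t ht => ?_)) (left_mem_Icc.2 hrs) (right_mem_Icc.2 hrs) hrs
    · rw [interior_Icc] at ht
      exact (hd t (hr.trans ht.1)).differentiableAt.differentiableWithinAt
    · rw [interior_Icc] at ht
      rw [(hd t (hr.trans ht.1)).deriv]
      have ht0 := hr.trans ht.1
      have h3 := hI t s ht0 ht.2.le
      have h4 := mul_le_mul_of_nonneg_right h3 (Real.exp_pos (-2 * (lam t - lam s))).le
      rw [mul_assoc, ← Real.exp_add, show -2 * (lam s - lam t) + -2 * (lam t - lam s) = 0 by ring,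
        Real.exp_zero, mul_one] at h4
      linarith
  have m1 := hmono hr hrs (left_mem_Icc.2 hrs) (right_mem_Icc.2 hrs) hrs
  have m2 := hmono hs hsT (left_mem_Icc.2 hsT) (right_mem_Icc.2 hsT) hsT
  calc (S s - S T) * (Λ s - Λ r) ≤ (A * (Λ T - Λ s)) * (Λ s - Λ r) :=
        mul_le_mul_of_nonneg_right (by linarith) (by linarith)
    _ = (A * (Λ s - Λ r)) * (Λ T - Λ s) := by ring
    _ ≤ _ := mul_le_mul_of_nonneg_right (by linarith) (by linarith)

/-- The entropy bound obtained from convexity in `Λ` and the initial slope. -/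
theorem entropy_sub_le_of_convex {S I lam Λ : ℝ → ℝ} {S₀ S₁ L Q : ℝ}
    (hS : ∀ t, 0 < t → HasDerivAt S (-(1 / 2 * I t)) t)
    (hΛ : ∀ t, 0 < t → HasDerivAt Λ (Real.exp (-2 * lam t)) t)
    (hI : ∀ s t, 0 < s → s ≤ t → I t ≤ I s * Real.exp (-2 * (lam t - lam s)))
    (hΛ0 : Tendsto (fun t => Λ t / t) (𝓝[>] 0) (𝓝 1)) (hΛ1 : Tendsto Λ atTop (𝓝 L))
    (hS0 : ∀ t, 0 < t → S t ≤ S₀) (hS1 : Tendsto S atTop (𝓝 S₁))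
    (hQ : ∀ δ > 0, ∀ᶠ t in 𝓝[>] 0, S₀ - S t ≤ t * (Q + δ)) (hL : 0 ≤ L) :
    S₀ - S₁ ≤ L * Q := by
  have hid : Tendsto (fun t : ℝ => t) (𝓝[>] 0) (𝓝 0) := tendsto_id.mono_left nhdsWithin_le_nhds
  have hΛz : Tendsto Λ (𝓝[>] 0) (𝓝 0) := by
    have h := hΛ0.mul hid
    rw [one_mul] at h
    refine h.congr' (eventually_mem_nhdsWithin.mono fun t (ht : 0 < t) => ?_)
    field_simp
  -- The three-chord inequality with left end r → 0 and right end T → ∞. Only S r ≤ S₀ is used at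
  -- the left end, so S₀ need not be known to be the limit of S.
  have h1 : ∀ s, 0 < s → (S s - S₁) * Λ s ≤ (S₀ - S s) * (L - Λ s) := fun s hs => by
    have h2 : ∀ T, s ≤ T → (S s - S T) * Λ s ≤ (S₀ - S s) * (Λ T - Λ s) := fun T hT => by
      have hlim : Tendsto (fun r => (S s - S T) * (Λ s - Λ r)) (𝓝[>] 0)
          (𝓝 ((S s - S T) * (Λ s - 0))) := (tendsto_const_nhds.sub hΛz).const_mul _
      rw [sub_zero] at hlim
      refine le_of_tendsto hlim ?_
      filter_upwards [Ioo_mem_nhdsGT hs] with r hr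
      refine (entropy_convex hS hΛ hI hr.1 hr.2.le hT).trans
        (mul_le_mul_of_nonneg_right (by linarith [hS0 r hr.1]) ?_)
      have hm : MonotoneOn Λ (Ioi 0) := monotoneOn_of_deriv_nonneg (convex_Ioi 0)
        (fun t ht => (hΛ t ht).continuousAt.continuousWithinAt)
        (fun t ht => by
          rw [interior_Ioi] at ht
          exact (hΛ t ht).differentiableAt.differentiableWithinAt)
        (fun t ht => by
          rw [interior_Ioi] at ht
          rw [(hΛ t ht).deriv]
          positivity)
      linarith [hm hs (hs.trans_le hT) hT]
    exact le_of_tendsto_of_tendsto ((tendsto_const_nhds.sub hS1).mul_const _)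
      ((hΛ1.sub tendsto_const_nhds).const_mul _) ((eventually_ge_atTop s).mono h2)
  -- Rearranged, the previous inequality reads (S₀ - S₁) Λ t ≤ (S₀ - S t) L. Dividing by t and using
  -- Λ t / t → 1 brings in the initial slope.
  have h3 : ∀ δ > 0, S₀ - S₁ ≤ L * (Q + δ) := fun δ hδ => by
    have hlim : Tendsto (fun t => (S₀ - S₁) * (Λ t / t)) (𝓝[>] 0) (𝓝 ((S₀ - S₁) * 1)) :=
      hΛ0.const_mul _
    rw [mul_one] at hlim
    refine le_of_tendsto hlim ?_
    filter_upwards [hQ δ hδ, eventually_mem_nhdsWithin] with t ht (ht0 : 0 < t)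
    rw [← mul_div_assoc, div_le_iff₀ ht0]
    have h5 := h1 t ht0
    have h6 := mul_le_mul_of_nonneg_left ht hL
    linarith
  have h4 : Tendsto (fun δ : ℝ => L * (Q + δ)) (𝓝[>] 0) (𝓝 (L * (Q + 0))) :=
    (tendsto_const_nhds.add hid).const_mul _
  rw [add_zero] at h4
  exact ge_of_tendsto h4 (eventually_mem_nhdsWithin.mono fun δ hδ => h3 δ hδ)

end Convexity

/-! ### Gaussian flows produce heat pairs -/

section FlowHeatPair

variable {N : ℕ} {E : Type} [NormedAddCommGroup E] [InnerProductSpace ℝ E] [FiniteDimensional ℝ E]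
  [MeasurableSpace E] [BorelSpace E]

theorem avg_pos {f : E → ℝ} (hf : Continuous f) {M : ℝ} (h0 : ∀ x, 0 < f x) (hM : ∀ x, f x ≤ M)
    (μ : Measure E) [IsProbabilityMeasure μ] (φ : E) : 0 < avg μ f φ := by
  rw [avg, integral_pos_iff_support_of_nonneg (fun x => (h0 _).le)
    (integrable_shift hf (fun x => by rw [Real.norm_of_nonneg (h0 x).le]; exact hM x) μ φ)]
  have : Function.support (fun ζ => f (φ + ζ)) = univ :=
    eq_univ_of_forall fun x => (h0 _).ne'
  rw [this, measure_univ]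
  exact one_pos

theorem dir_avg {c : ℝ} {f : E → ℝ} (hf : BddC3 c f) (μ : Measure E) [IsProbabilityMeasure μ]
    (a : E) : dir a (avg μ f) = avg μ (dir a f) := by
  funext φ
  rw [dir, hf.fderiv_avg]
  exact ContinuousLinearMap.integral_apply
    (integrable_shift (hf.contDiff_fderiv.continuous) hf.norm_fderiv_le μ φ) a

/-- The smoothing up to time t₀ makes both functions tame with respect to the weight Z at t₀, and
Jensen keeps the constants for all later times. Four derivatives are needed because the density G
∂_a w ∂_b w must have three bounded ones. -/
theorem GaussianFlow.heatPair {e : Fin N → E} {dC C : ℝ → Mat N} {μ : ℝ → ℝ → Measure E}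
    {D : ℝ → Measure E} {K : ℝ} (H : GaussianFlow e dC C μ D K) {t₀ : ℝ} (h0 : 0 < t₀)
    (hS : Smoother 4 (μ 0 t₀)) {Z₀ G₀ : E → ℝ} (hZ : Continuous Z₀) (hG : Continuous G₀)
    {ε M : ℝ} (hε : 0 < ε) (hM : 0 < M) (hZ0 : ∀ x, 0 < Z₀ x) (hZM : ∀ x, Z₀ x ≤ M)
    (hG0 : ∀ x, ε * Z₀ x ≤ G₀ x) (hGM : ∀ x, G₀ x ≤ M * Z₀ x)
    (hfac : ∀ t, t₀ < t → ∃ v : Fin N → E, ∀ B : E →L[ℝ] E →L[ℝ] ℝ,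
      traceForm e (dC t) B = ∑ k, B (v k) (v k)) :
    HeatPair e dC t₀ (fun t => avg (μ 0 t) Z₀) (fun t => avg (μ 0 t) G₀) ε M K := by
  have hprob := H.prob
  have hZn : ∀ x, ‖Z₀ x‖ ≤ M := fun x => by rw [Real.norm_of_nonneg (hZ0 x).le]; exact hZM x
  have hGp : ∀ x, 0 < G₀ x := fun x => (mul_pos hε (hZ0 x)).trans_le (hG0 x)
  have hGn : ∀ x, ‖G₀ x‖ ≤ M * M := fun x => by
    rw [Real.norm_of_nonneg (hGp x).le]
    exact (hGM x).trans (mul_le_mul_of_nonneg_left (hZM x) hM.le)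
  have tZ : Tame 4 (fun _ : Unit => avg (μ 0 t₀) Z₀) (fun _ : Unit => avg (μ 0 t₀) Z₀) :=
    Smoother.tame_avg 4 hS (fun _ => hZ) (fun _ => hZ)
      (fun _ x => by rw [Real.norm_of_nonneg (hZ0 x).le]) hM.le (fun _ => hZM)
  have tG : Tame 4 (fun _ : Unit => avg (μ 0 t₀) Z₀) (fun _ : Unit => avg (μ 0 t₀) G₀) := by
    -- The factor M⁻¹ makes the initial datum of G smaller than that of Z, so that Z can serve as
    -- its weight.
    have h := Smoother.tame_avg (ι := Unit) 4 hS (f := fun _ x => M⁻¹ * G₀ x) (ρ := fun _ => Z₀)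
      (fun _ => continuous_const.mul hG) (fun _ => hZ)
      (fun _ x => by
        rw [Real.norm_of_nonneg (by have := (hGp x).le; positivity), inv_mul_le_iff₀ hM]
        exact hGM x) hM.le (fun _ => hZM)
    have h' := h.comp_left (fun _ => M • ContinuousLinearMap.id ℝ ℝ) (fun _ => le_rfl)
      (norm_nonneg _)
    convert h' using 3 with _ φ
    simp only [smul_apply, ContinuousLinearMap.id_apply, smul_eq_mul, avg_const_mul]
    field_simp
  set z := avg (μ 0 t₀) Z₀ with hz
  set g := avg (μ 0 t₀) G₀ with hg
  have zpos : ∀ x, 0 < z x := avg_pos hZ hZ0 hZM _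
  have zle : ∀ (μ : Measure E) [IsProbabilityMeasure μ] x, avg μ Z₀ x ≤ M := fun μ _ x =>
    (le_abs_self _).trans (norm_avg_le_const hZn μ x)
  have stepZ : ∀ t, t₀ ≤ t → avg (μ 0 t) Z₀ = avg (μ t₀ t) z := fun t ht =>
    H.avg_avg le_rfl h0.le ht hZ hZn
  have stepG : ∀ t, t₀ ≤ t → avg (μ 0 t) G₀ = avg (μ t₀ t) g := fun t ht =>
    H.avg_avg le_rfl h0.le ht hG hGn
  have havg : ∀ {f : E → ℝ} {F : ℝ → E → ℝ}, Tame 4 (fun _ : Unit => z) (fun _ : Unit => f) →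
      (∀ t, t₀ ≤ t → F t = avg (μ t₀ t) f) →
      Tame 4 (fun t : Ioi t₀ => avg (μ 0 t) Z₀) (fun t : Ioi t₀ => F t) := fun {f F} hf hF => by
    have h := hf.avg (fun _ => (continuous_avg hZ hZn _)) (fun _ x => (zpos x).le) hM.le
      (fun _ => zle _) (κ := Ioi t₀) (fun _ => ()) (fun t => μ t₀ t)
    convert h using 2 with t t
    · exact stepZ t t.2.le
    · exact hF t t.2.le
  have hheat : ∀ {f : E → ℝ} {F : ℝ → E → ℝ}, Tame 3 (fun _ : Unit => z) (fun _ : Unit => f) →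
      (∀ t, t₀ ≤ t → F t = avg (μ t₀ t) f) → ∀ t, t₀ < t → ∀ φ, HasDerivAt (fun s => F s φ)
        (traceForm e (dC t) (fderiv ℝ (fderiv ℝ (F t)) φ) / 2) t := fun {f F} hf hF t ht φ => by
    obtain ⟨c, hc⟩ := hf.exists_uniform_bddC3 (fun _ => zpos) hM.le (fun _ => zle _)
    rw [hF t ht.le]
    refine (H.hasDerivAt_avg h0.le ht (hc ()) φ).congr_of_eventuallyEq ?_
    filter_upwards [lt_mem_nhds ht] with s hs
    rw [hF s hs.le]
  have hdirs : ∀ {f : E → ℝ} {F : ℝ → E → ℝ}, Tame 4 (fun _ : Unit => z) (fun _ : Unit => f) →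
      (∀ t, t₀ ≤ t → F t = avg (μ t₀ t) f) → ∀ a t, t₀ ≤ t →
        dir a (F t) = avg (μ t₀ t) (dir a f) := fun {f F} hf hF a t ht => by
    obtain ⟨c, hc⟩ := (hf.mono (m := 3) (by norm_num)).exists_uniform_bddC3 (fun _ => zpos) hM.le
      (fun _ => zle _)
    rw [hF t ht, dir_avg (hc ())]
  exact
    { eps_pos := hε
      Z_pos := fun t _ φ => avg_pos hZ hZ0 hZM _ φ
      Z_le := fun t _ φ => zle _ φ
      le_G := fun t _ φ => by
        rw [← avg_const_mul]
        exact avg_mono (f := fun x => ε * Z₀ x) (continuous_const.mul hZ) hG (M := ε * M)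
          (fun x => by rw [norm_mul, Real.norm_of_nonneg hε.le]; gcongr; exact hZn x) hGn hG0 _ _
      G_le := fun t _ φ => by
        rw [← avg_const_mul]
        exact avg_mono (g := fun x => M * Z₀ x) hG (continuous_const.mul hZ) (M' := M * M) hGn
          (fun x => by rw [norm_mul, Real.norm_of_nonneg hM.le]; gcongr; exact hZn x) hGM _ _
      M_nonneg := hM.le
      tame_Z := havg tZ stepZ
      tame_G := havg tG stepG
      heat_Z := hheat (tZ.mono (by norm_num)) stepZ
      heat_G := hheat (tG.mono (by norm_num)) stepG
      heat_dir_Z := fun a => hheat (tZ.dir a) (hdirs tZ stepZ a)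
      heat_dir_G := fun a => hheat (tG.dir a) (hdirs tG stepG a)
      bound_nonneg := H.K_nonneg
      bound := fun t ht => H.bound t (h0.trans ht)
      factor := hfac }

end FlowHeatPair

/-! ### The Gaussian flow of the covariance decomposition -/

section Concrete

variable {N : ℕ} {dC : ℝ → Mat N}

theorem cov_zero (dC : ℝ → Mat N) : cov dC 0 = 0 := by
  ext i j
  simp [cov]

open scoped MatrixOrder in
-- With v_k = ∑_i (√A)_{ki} e_i the trace form becomes a sum over single directions, so that all
-- second order identities need to be verified in one direction only.
theorem exists_factor {E : Type} [NormedAddCommGroup E] [NormedSpace ℝ E] (e : Fin N → E)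
    {A : Mat N} (hA : A.PosSemidef) : ∃ v : Fin N → E, ∀ B : E →L[ℝ] E →L[ℝ] ℝ,
      traceForm e A B = ∑ k, B (v k) (v k) := by
  have hs : CFC.sqrt A * CFC.sqrt A = A := CFC.sqrt_mul_sqrt_self A hA.nonneg
  have hsym : ∀ i j, CFC.sqrt A i j = CFC.sqrt A j i := fun i j => by
    have h : (CFC.sqrt A).IsHermitian := (CFC.sqrt_nonneg A).isSelfAdjoint
    simpa using (h.apply i j).symm
  refine ⟨fun k => ∑ i, CFC.sqrt A k i • e i, fun B => ?_⟩
  simp only [map_sum, map_smul, sum_apply, smul_apply, smul_eq_mul, Finset.mul_sum]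
  rw [Finset.sum_comm' (t' := Finset.univ) (s' := fun _ => Finset.univ) (by simp)]
  rw [traceForm, Finset.sum_comm]
  refine Finset.sum_congr rfl fun i _ => ?_
  rw [Finset.sum_comm (s := Finset.univ) (t := Finset.univ)]
  refine Finset.sum_congr rfl fun j _ => ?_
  conv_lhs => rw [← hs]
  rw [Matrix.mul_apply, Finset.sum_mul]
  refine Finset.sum_congr rfl fun k _ => ?_
  rw [hsym j k]
  ring

theorem posSemidef_of_quadForm_nonneg {A : Mat N} (hs : ∀ i j, A i j = A j i)
    (h : ∀ u, 0 ≤ quadForm A u) : A.PosSemidef := by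
  refine Matrix.PosSemidef.of_dotProduct_mulVec_nonneg (by ext i j; simp [hs i j]) fun x => ?_
  have := h (WithLp.toLp 2 x)
  simp only [quadForm] at this
  simp only [dotProduct, Matrix.mulVec, Finset.mul_sum, star_trivial]
  refine this.trans_eq ?_
  exact Finset.sum_congr rfl fun i _ => Finset.sum_congr rfl fun j _ => by ring

namespace IsDifferentiableCovDecomposition

variable (hC : IsDifferentiableCovDecomposition dC)
include hC

theorem intervalIntegrable {a b : ℝ} (ha : 0 ≤ a) (hab : a ≤ b) (i j : Fin N) :
    IntervalIntegrable (fun t => dC t i j) volume a b := by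
  rw [intervalIntegrable_iff_integrableOn_Ioc_of_le hab]
  exact (hC.integrable i j).mono_set fun x hx => ha.trans_lt hx.1

theorem cov_sub_apply {s t : ℝ} (hs : 0 ≤ s) (hst : s ≤ t) (i j : Fin N) :
    cov dC t i j - cov dC s i j = ∫ r in s..t, dC r i j := by
  simp only [cov, Matrix.of_apply]
  exact intervalIntegral.integral_interval_sub_left (hC.intervalIntegrable le_rfl (hs.trans hst) i j)
    (hC.intervalIntegrable le_rfl hs i j)

theorem covInf_sub_apply {t : ℝ} (ht : 0 ≤ t) (i j : Fin N) :
    covInf dC i j - cov dC t i j = ∫ r in Ioi t, dC r i j := by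
  simp only [cov, covInf, Matrix.of_apply]
  rw [intervalIntegral.integral_of_le ht, sub_eq_iff_eq_add', ← setIntegral_union
    (Ioc_disjoint_Ioi le_rfl) measurableSet_Ioi
    ((hC.integrable i j).mono_set fun x hx => hx.1)
    ((hC.integrable i j).mono_set fun x hx => ht.trans_lt hx), Ioc_union_Ioi_eq_Ioi ht]

theorem symm {t : ℝ} (ht : 0 ≤ t) (i j : Fin N) : dC t i j = dC t j i := by
  simpa using ((hC.posSemidef t ht).1.apply i j).symm

theorem quadForm_cov_sub {s t : ℝ} (hs : 0 ≤ s) (hst : s ≤ t) (u : Vec N) :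
    quadForm (cov dC t - cov dC s) u = ∫ r in s..t, quadForm (dC r) u := by
  have hi : ∀ i j, IntegrableOn (fun r => dC r i j * u i * u j) (Ioc s t) := fun i j =>
    (((hC.integrable i j).mono_set fun x hx => hs.trans_lt hx.1).mul_const _).mul_const _
  rw [intervalIntegral.integral_of_le hst]
  simp only [quadForm]
  rw [integral_finsetSum _ fun i _ => integrable_finsetSum _ fun j _ => hi i j]
  refine Finset.sum_congr rfl fun i _ => ?_
  rw [integral_finsetSum _ fun j _ => hi i j]
  refine Finset.sum_congr rfl fun j _ => ?_
  rw [integral_mul_const, integral_mul_const, Matrix.sub_apply, hC.cov_sub_apply hs hst,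
    intervalIntegral.integral_of_le hst]

theorem quadForm_covInf_sub {t : ℝ} (ht : 0 ≤ t) (u : Vec N) :
    quadForm (covInf dC - cov dC t) u = ∫ r in Ioi t, quadForm (dC r) u := by
  have hi : ∀ i j, IntegrableOn (fun r => dC r i j * u i * u j) (Ioi t) := fun i j =>
    (((hC.integrable i j).mono_set fun x hx => ht.trans_lt hx).mul_const _).mul_const _
  simp only [quadForm]
  rw [integral_finsetSum _ fun i _ => integrable_finsetSum _ fun j _ => hi i j]
  refine Finset.sum_congr rfl fun i _ => ?_
  rw [integral_finsetSum _ fun j _ => hi i j]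
  refine Finset.sum_congr rfl fun j _ => ?_
  rw [integral_mul_const, integral_mul_const, Matrix.sub_apply, hC.covInf_sub_apply ht]

theorem posSemidef_cov_sub {s t : ℝ} (hs : 0 ≤ s) (hst : s ≤ t) :
    (cov dC t - cov dC s).PosSemidef := by
  refine posSemidef_of_quadForm_nonneg (fun i j => ?_) fun u => ?_
  · rw [Matrix.sub_apply, Matrix.sub_apply, hC.cov_sub_apply hs hst, hC.cov_sub_apply hs hst]
    refine intervalIntegral.integral_congr fun r hr => hC.symm ?_ i j
    rw [uIcc_of_le hst] at hr
    exact hs.trans hr.1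
  · rw [hC.quadForm_cov_sub hs hst]
    exact intervalIntegral.integral_nonneg hst fun r hr =>
      quadForm_nonneg (hC.posSemidef r (hs.trans hr.1)) u

theorem posSemidef_covInf_sub {t : ℝ} (ht : 0 ≤ t) : (covInf dC - cov dC t).PosSemidef := by
  refine posSemidef_of_quadForm_nonneg (fun i j => ?_) fun u => ?_
  · rw [Matrix.sub_apply, Matrix.sub_apply, hC.covInf_sub_apply ht, hC.covInf_sub_apply ht]
    exact setIntegral_congr_fun measurableSet_Ioi fun r hr => hC.symm (ht.trans hr.le) i j
  · rw [hC.quadForm_covInf_sub ht]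
    exact setIntegral_nonneg measurableSet_Ioi fun r hr =>
      quadForm_nonneg (hC.posSemidef r (ht.trans hr.le)) u

theorem hasDerivAt_cov {t : ℝ} (ht : 0 < t) (i j : Fin N) :
    HasDerivAt (fun s => cov dC s i j) (dC t i j) t := by
  have hcont : ∀ᶠ s in 𝓝 t, ContinuousAt (fun t => dC t i j) s := by
    filter_upwards [lt_mem_nhds ht] with s hs
    exact (hC.differentiable s hs i j).continuousAt
  exact intervalIntegral.integral_hasDerivAt_right (hC.intervalIntegrable le_rfl ht.le i j)
    ⟨Ioi 0, Ioi_mem_nhds ht, (hC.integrable i j).aestronglyMeasurable⟩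
    hcont.self_of_nhds

/-- The covariance decomposition defines a Gaussian flow on `X`. -/
theorem exists_gaussianFlow : ∃ K, GaussianFlow (frame dC) dC (cov dC)
    (fun s t => gaussian dC (cov dC t - cov dC s)) (fun t => gaussian dC (covInf dC - cov dC t))
    K := by
  obtain ⟨K₀, hK₀⟩ := hC.bounded
  set k := |K₀| with hk
  have hb : ∀ t, 0 ≤ t → ∀ i j, |dC t i j| ≤ k := fun t ht i j =>
    (hK₀ t ht i j).trans (le_abs_self _)
  have hlip : ∀ s t, 0 ≤ s → s ≤ t → ∀ i j, |cov dC t i j - cov dC s i j| ≤ k * (t - s) :=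
    fun s t hs hst i j => by
      rw [hC.cov_sub_apply hs hst]
      have := intervalIntegral.norm_integral_le_of_norm_le_const (a := s) (b := t)
        (f := fun r => dC r i j) (C := k) fun r hr => by
          rw [uIoc_of_le hst] at hr
          exact hb r (hs.trans hr.1.le) i j
      rwa [abs_of_nonneg (sub_nonneg.2 hst)] at this
  -- Summing the constants of the moments of order 0 to 4 gives one constant valid for all of them.
  set S := ∑ p ∈ Finset.range 5, √(N * N * k) ^ p * stdMoment N p with hS
  have hSp : ∀ p, 0 ≤ √(N * N * k) ^ p * stdMoment N p := fun p =>
    mul_nonneg (by positivity) (stdMoment_nonneg N p)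
  have hS0 : 0 ≤ S := Finset.sum_nonneg fun p _ => hSp p
  have hk0 : 0 ≤ k := abs_nonneg _
  refine ⟨k + S, ?_⟩
  exact
    { prob := fun s t => inferInstance
      probD := fun t => inferInstance
      conv := fun r s t hr hrs hst => by
        rw [← gaussian_add dC (hC.posSemidef_cov_sub (hr.trans hrs) hst)
          (hC.posSemidef_cov_sub hr hrs), sub_add_sub_cancel]
      convD := fun s t hs hst => by
        rw [← gaussian_add dC (hC.posSemidef_covInf_sub (hs.trans hst))
          (hC.posSemidef_cov_sub hs hst), sub_add_sub_cancel]
      centred := fun s t _ _ ℓ => integral_gaussian_linear dC _ ℓ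
      second := fun s t hs hst B => integral_gaussian_bilin dC (hC.posSemidef_cov_sub hs hst) B
      integrable := fun s t p => integrable_norm_pow_gaussian dC _ p
      moment := fun s t hs hst p hp => by
        refine (integral_norm_pow_gaussian_le dC (hC.posSemidef_cov_sub hs hst) p).trans ?_
        have h1 : entrySum (cov dC t - cov dC s) ≤ N * N * k * (t - s) := by
          rw [entrySum]
          refine (Finset.sum_le_sum fun i _ => Finset.sum_le_sum fun j _ =>
            hlip s t hs hst i j).trans (le_of_eq ?_)
          simp
          ring
        have hts : 0 ≤ t - s := sub_nonneg.2 hst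
        calc √(entrySum (cov dC t - cov dC s)) ^ p * stdMoment N p
            ≤ √(N * N * k * (t - s)) ^ p * stdMoment N p :=
              mul_le_mul_of_nonneg_right (pow_le_pow_left₀ (Real.sqrt_nonneg _)
                (Real.sqrt_le_sqrt h1) p) (stdMoment_nonneg N p)
          _ = (√(N * N * k) ^ p * stdMoment N p) * √(t - s) ^ p := by
              rw [Real.sqrt_mul (by positivity), mul_pow]; ring
          _ ≤ (k + S) * √(t - s) ^ p := by
              refine mul_le_mul_of_nonneg_right ?_ (by positivity)
              have := Finset.single_le_sum (fun p _ => hSp p)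
                (Finset.mem_range.2 (by lia : p < 5))
              linarith
      lip := fun s t hs hst i j => (hlip s t hs hst i j).trans
        (mul_le_mul_of_nonneg_right (by linarith) (sub_nonneg.2 hst))
      deriv := fun t ht i j => hC.hasDerivAt_cov ht i j
      bound := fun t ht i j => (hb t ht.le i j).trans (by linarith) }

end IsDifferentiableCovDecomposition

end Concrete

/-! ### The criterion forces C_t to be nondegenerate on X -/

section Nondegeneracy

/-- A Chebyshev argument: with y a minimiser of Z₀ on a large ball, Z₀(x+ζ) ≥ Z₀(y)(1 - ‖ζ‖²/R²),
the right side being nonpositive for ‖ζ‖ > R. The choice of R makes the expected loss at most one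
half for every measure with second moment at most S. -/
theorem exists_pos_le_avg {E : Type} [NormedAddCommGroup E] [NormedSpace ℝ E]
    [FiniteDimensional ℝ E] [MeasurableSpace E] [BorelSpace E] {Z₀ : E → ℝ} (hZ : Continuous Z₀)
    (h0 : ∀ x, 0 < Z₀ x) {M : ℝ} (hM : ∀ x, Z₀ x ≤ M) (S : ℝ) : ∃ m > 0, ∀ μ : Measure E,
      IsProbabilityMeasure μ → Integrable (fun ζ => ‖ζ‖ ^ 2) μ → ∫ ζ, ‖ζ‖ ^ 2 ∂μ ≤ S →
      ∀ x, ‖x‖ ≤ 1 → m ≤ avg μ Z₀ x := by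
  set R : ℝ := 1 + 2 * |S| with hR
  have hR0 : 0 < R := by positivity
  obtain ⟨y, -, hy⟩ := (isCompact_closedBall (0 : E) (R + 1)).exists_isMinOn
    ⟨0, Metric.mem_closedBall_self (by positivity)⟩ hZ.continuousOn
  refine ⟨Z₀ y / 2, half_pos (h0 y), fun μ hμ hi hS x hx => ?_⟩
  have hpt : ∀ ζ, Z₀ y * (1 - ‖ζ‖ ^ 2 / R ^ 2) ≤ Z₀ (x + ζ) := fun ζ => by
    by_cases hζ : ‖ζ‖ ≤ R
    · have h1 : Z₀ y ≤ Z₀ (x + ζ) := hy (by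
        rw [mem_closedBall_zero_iff]
        exact (norm_add_le _ _).trans (by linarith))
      have h2 : 0 ≤ ‖ζ‖ ^ 2 / R ^ 2 := by positivity
      nlinarith [h0 y]
    · have h2 : 1 ≤ ‖ζ‖ ^ 2 / R ^ 2 := by
        rw [one_le_div (by positivity)]
        exact pow_le_pow_left₀ hR0.le (not_le.1 hζ).le 2
      nlinarith [h0 y, h0 (x + ζ)]
  have h1 : Integrable (fun ζ => Z₀ y * (1 - ‖ζ‖ ^ 2 / R ^ 2)) μ :=
    ((integrable_const _).sub (hi.div_const _)).const_mul _
  have h2 := integral_mono h1 (integrable_shift hZ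
    (fun x => by rw [Real.norm_of_nonneg (h0 x).le]; exact hM x) μ x) hpt
  refine le_trans ?_ h2
  rw [integral_const_mul, integral_sub (integrable_const _) (hi.div_const _), integral_div]
  simp only [integral_const, probReal_univ, one_smul]
  have h3 : (∫ ζ, ‖ζ‖ ^ 2 ∂μ) / R ^ 2 ≤ 1 / 2 := by
    rw [div_le_iff₀ (by positivity)]
    refine hS.trans ((le_abs_self S).trans ?_)
    nlinarith [abs_nonneg S]
  nlinarith [h0 y]

variable {N : ℕ}

theorem quadForm_sub (A B : Mat N) (u : Vec N) :
    quadForm (A - B) u = quadForm A u - quadForm B u := by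
  simp only [quadForm, Matrix.sub_apply, sub_mul, Finset.sum_sub_distrib]

theorem hasDerivAt_quadForm {A : ℝ → Mat N} {A' : Mat N} {t : ℝ}
    (h : ∀ i j, HasDerivAt (fun s => A s i j) (A' i j) t) (u : Vec N) :
    HasDerivAt (fun s => quadForm (A s) u) (quadForm A' u) t :=
  HasDerivAt.fun_sum fun i _ => HasDerivAt.fun_sum fun j _ =>
    ((h i j).mul_const (u i)).mul_const (u j)

open scoped MatrixOrder in
theorem norm_toEuclideanLin_sq_le {A : Mat N} (hA : A.PosSemidef) (u : Vec N) :
    ‖Matrix.toEuclideanLin A u‖ ^ 2 ≤ entrySum A * quadForm A u := by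
  have hs : CFC.sqrt A * CFC.sqrt A = A := CFC.sqrt_mul_sqrt_self A hA.nonneg
  have h1 : Matrix.toEuclideanLin A u = Matrix.toEuclideanCLM (𝕜 := ℝ) (CFC.sqrt A)
      (Matrix.toEuclideanCLM (𝕜 := ℝ) (CFC.sqrt A) u) := by
    conv_lhs => rw [← hs]
    rw [← mul_apply_eq_comp, ← map_mul]
    rfl
  rw [h1, norm_sqrt_apply_sq hA, ← norm_sqrt_apply_sq hA u]
  exact quadForm_le_entrySum A _

theorem toEuclideanLin_eq_zero {A : Mat N} (hA : A.PosSemidef) {u : Vec N}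
    (h : quadForm A u = 0) : Matrix.toEuclideanLin A u = 0 := by
  have := norm_toEuclideanLin_sq_le hA u
  rw [h, mul_zero] at this
  exact norm_eq_zero.1 (pow_eq_zero_iff two_ne_zero |>.1 (le_antisymm this (by positivity)))

theorem range_le_range_of_quadForm {A B : Mat N} (hA : A.PosSemidef) (hB : B.PosSemidef)
    (h : ∀ u, quadForm B u = 0 → quadForm A u = 0) :
    LinearMap.range (Matrix.toEuclideanLin A) ≤ LinearMap.range (Matrix.toEuclideanLin B) := by
  have sA := Matrix.isSymmetric_toEuclideanLin_iff.2 hA.1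
  have sB := Matrix.isSymmetric_toEuclideanLin_iff.2 hB.1
  rw [← Submodule.orthogonal_le_orthogonal_iff, sA.orthogonal_range, sB.orthogonal_range]
  intro u hu
  rw [LinearMap.mem_ker] at hu ⊢
  refine toEuclideanLin_eq_zero hA (h u ?_)
  rw [quadForm_eq_inner, hu, inner_zero_right]

/-- Subtracting κr²/2 leaves a convex function, whose value at 0 is at most the mean of its values
at ±ρ. -/
theorem midpoint_le_of_deriv2 {h : ℝ → ℝ} (hh : ContDiff ℝ 2 h) {κ : ℝ}
    (hκ : ∀ r, κ ≤ iteratedDeriv 2 h r) (ρ : ℝ) : κ * ρ ^ 2 ≤ h ρ + h (-ρ) - 2 * h 0 := by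
  set g : ℝ → ℝ := fun r => h r - κ / 2 * r ^ 2 with hg
  have hd : Differentiable ℝ h := hh.differentiable (by norm_num)
  have hd' : Differentiable ℝ (deriv h) :=
    ((contDiff_succ_iff_deriv (n := 1)).1 hh).2.2.differentiable (by norm_num)
  have hg' : ∀ r, HasDerivAt g (deriv h r - κ * r) r := fun r => by
    refine ((hd r).hasDerivAt.sub ((hasDerivAt_pow 2 r).const_mul (κ / 2))).congr_deriv ?_
    ring
  have hg1 : deriv g = fun r => deriv h r - κ * r := funext fun r => (hg' r).deriv
  have hg2 : ∀ r, HasDerivAt (deriv g) (deriv (deriv h) r - κ) r := fun r => by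
    rw [hg1]
    refine ((hd' r).hasDerivAt.sub ((hasDerivAt_id r).const_mul κ)).congr_deriv ?_
    ring
  have hc := convexOn_univ_of_deriv2_nonneg (f := g) (fun r => (hg' r).differentiableAt)
    (fun r => (hg2 r).differentiableAt) (fun r => by
      have h1 := hκ r
      rw [iteratedDeriv_succ, iteratedDeriv_one] at h1
      simp only [Function.iterate_succ, Function.iterate_zero, Function.comp, id]
      rw [(hg2 r).deriv]
      linarith)
  have := hc.2 (mem_univ ρ) (mem_univ (-ρ)) (by norm_num : (0 : ℝ) ≤ 1 / 2)
    (by norm_num : (0 : ℝ) ≤ 1 / 2) (by norm_num)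
  simp only [hg, smul_eq_mul] at this
  ring_nf at this ⊢
  linarith

variable {dC : ℝ → Mat N}

/-- Smoothness of V_t on X is not available before nondegeneracy is known. Along a direction C_t a,
however, the Cameron–Martin formula writes e^{-V_t} as a Gaussian factor times a moment generating
function, finite everywhere and hence analytic. -/
theorem contDiff_renormPotential_line {V₀ : fieldSpace dC → ℝ} (hV₀ : Continuous V₀) {M : ℝ}
    (hM : ∀ x, Real.exp (-V₀ x) ≤ M) {t : ℝ} (hA : (cov dC t).PosSemidef) (a : fieldSpace dC) :
    ContDiff ℝ 2 fun r : ℝ => renormPotential dC V₀ t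
      (r • toX dC (Matrix.toEuclideanLin (cov dC t) (a : Vec N))) := by
  set μ := gaussian dC (cov dC t)
  set Z₀ : fieldSpace dC → ℝ := fun x => Real.exp (-V₀ x) with hZ₀
  have hZc : Continuous Z₀ := by fun_prop
  set ν := μ.withDensity fun x => ENNReal.ofReal (Z₀ x) with hν
  have hint : ∀ f : fieldSpace dC → ℝ, ∫ x, f x ∂ν = ∫ x, Z₀ x * f x ∂μ := fun f => by
    rw [hν, integral_withDensity_eq_integral_toReal_smul (by fun_prop)
      (Eventually.of_forall fun x => ENNReal.ofReal_lt_top)]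
    simp only [ENNReal.toReal_ofReal (Real.exp_pos _).le, hZ₀, smul_eq_mul]
  have hexp : integrableExpSet (fun ζ => inner ℝ a ζ) ν = univ := by
    refine eq_univ_of_forall fun r => ?_
    change Integrable _ ν
    rw [hν, integrable_withDensity_iff_integrable_smul' (by fun_prop)
      (Eventually.of_forall fun x => ENNReal.ofReal_lt_top)]
    refine ((integrable_exp_norm μ (|r| * ‖a‖)).const_mul M).mono'
      (aestronglyMeasurable_of_continuous (by
        simp only [ENNReal.toReal_ofReal (Real.exp_pos _).le, hZ₀]
        fun_prop) _) (Eventually.of_forall fun x => ?_)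
    rw [ENNReal.toReal_ofReal (Real.exp_pos _).le, smul_eq_mul, norm_mul,
      Real.norm_of_nonneg (Real.exp_pos _).le, Real.norm_of_nonneg (Real.exp_pos _).le]
    refine mul_le_mul (hM x) (Real.exp_le_exp.2 ?_) (Real.exp_pos _).le
      ((Real.exp_pos _).le.trans (hM x))
    refine (le_abs_self _).trans ?_
    rw [abs_mul, mul_assoc]
    exact mul_le_mul_of_nonneg_left (abs_real_inner_le_norm _ _) (abs_nonneg r)
  have hana : ContDiff ℝ 2 (mgf (fun ζ => inner ℝ a ζ) ν) := by
    have h : AnalyticOnNhd ℝ (mgf (fun ζ => inner ℝ a ζ) ν) univ := by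
      have := analyticOnNhd_mgf (X := fun ζ => inner ℝ a ζ) (μ := ν)
      rwa [hexp, interior_univ] at this
    exact contDiffOn_univ.1 (h.contDiffOn uniqueDiffOn_univ)
  set q := quadForm (cov dC t) (a : Vec N) with hq
  have hval : ∀ r : ℝ, avg μ Z₀ (r • toX dC (Matrix.toEuclideanLin (cov dC t) (a : Vec N))) =
      Real.exp (-(r ^ 2 * q / 2)) * mgf (fun ζ => inner ℝ a ζ) ν r := fun r => by
    have h := integral_gaussian_shift dC hA (r • a) hZc
    have e1 : toX dC (Matrix.toEuclideanLin (cov dC t) ((r • a : fieldSpace dC) : Vec N)) =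
        r • toX dC (Matrix.toEuclideanLin (cov dC t) (a : Vec N)) := by
      rw [Submodule.coe_smul, map_smul, ← projX_apply, map_smul, projX_apply]
    have e2 : quadForm (cov dC t) ((r • a : fieldSpace dC) : Vec N) = r ^ 2 * q := by
      rw [hq, quadForm_eq_inner, quadForm_eq_inner, Submodule.coe_smul, map_smul,
        inner_smul_left, inner_smul_right]
      simp only [conj_trivial]
      ring
    rw [e1, e2] at h
    rw [avg, mgf, hint, ← integral_const_mul]
    simp_rw [add_comm (r • toX dC _)]
    rw [h]
    refine integral_congr_ae (Eventually.of_forall fun ζ => ?_)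
    simp only [smul_eq_mul, inner_smul_left, conj_trivial]
    rw [sub_eq_add_neg, Real.exp_add]
    ring
  have hfun : (fun r : ℝ => renormPotential dC V₀ t
      (r • toX dC (Matrix.toEuclideanLin (cov dC t) (a : Vec N)))) = fun r =>
      -Real.log (Real.exp (-(r ^ 2 * q / 2)) * mgf (fun ζ => inner ℝ a ζ) ν r) := by
    funext r
    rw [← hval]
    rfl
  rw [hfun]
  refine (ContDiff.log (by fun_prop) fun r => ?_).neg
  rw [← hval]
  exact (avg_pos hZc (fun _ => Real.exp_pos _) hM _ _).ne'

variable (hC : IsDifferentiableCovDecomposition dC)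
include hC

theorem IsDifferentiableCovDecomposition.posSemidef_cov {t : ℝ} (ht : 0 ≤ t) :
    (cov dC t).PosSemidef := by
  have := hC.posSemidef_cov_sub le_rfl ht
  rwa [cov_zero, sub_zero] at this

theorem IsDifferentiableCovDecomposition.posSemidef_covInf : (covInf dC).PosSemidef := by
  have := hC.posSemidef_covInf_sub le_rfl
  rwa [cov_zero, sub_zero] at this

/-- The nonnegative function r ↦ (u)²_{C_r} is nondecreasing, so it vanishes on [0, t] once it
vanishes at t; its derivative from the left at s is then zero. -/
theorem IsDifferentiableCovDecomposition.quadForm_dC_eq_zero {t : ℝ} {u : Vec N}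
    (h : quadForm (cov dC t) u = 0) {s : ℝ} (hs : 0 < s) (hst : s ≤ t) :
    quadForm (dC s) u = 0 := by
  have hmono : ∀ r, 0 ≤ r → r ≤ s → quadForm (cov dC r) u = 0 := fun r hr hrs => by
    have h1 := quadForm_nonneg (hC.posSemidef_cov_sub hr (hrs.trans hst)) u
    have h2 := quadForm_nonneg (hC.posSemidef_cov hr) u
    rw [quadForm_sub] at h1
    linarith
  have h1 := (hasDerivAt_quadForm (fun i j => hC.hasDerivAt_cov hs i j) u).hasDerivWithinAt
    (s := Icc 0 s)
  have h2 : HasDerivWithinAt (fun r => quadForm (cov dC r) u) 0 (Icc 0 s) s :=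
    (hasDerivWithinAt_const s (Icc 0 s) (0 : ℝ)).congr (fun r hr => hmono r hr.1 hr.2)
      (hmono s hs.le le_rfl)
  exact (uniqueDiffOn_Icc hs s (right_mem_Icc.2 hs.le)).eq_deriv _ h1 h2

/-- Null vectors of C_t are null for Ċ_t, so the range of Ċ_t lies in that of C_t. The component of
a preimage orthogonal to X is null for C_∞ ≥ C_t and may be discarded. -/
theorem IsDifferentiableCovDecomposition.exists_cov_apply_eq {t : ℝ} (ht : 0 < t) (u : Vec N) :
    ∃ a : fieldSpace dC, Matrix.toEuclideanLin (dC t) u =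
      Matrix.toEuclideanLin (cov dC t) (a : Vec N) := by
  have h1 := range_le_range_of_quadForm (hC.posSemidef t ht.le) (hC.posSemidef_cov ht.le)
    fun v hv => hC.quadForm_dC_eq_zero hv ht le_rfl
  obtain ⟨b, hb⟩ := h1 ⟨u, rfl⟩
  refine ⟨toX dC b, ?_⟩
  rw [← hb, ← sub_eq_zero, ← map_sub]
  refine toEuclideanLin_eq_zero (hC.posSemidef_cov ht.le) ?_
  have h2 : quadForm (covInf dC) (b - (toX dC b : Vec N)) = 0 := by
    rw [quadForm_eq_inner, real_inner_comm]
    exact Submodule.sub_starProjection_mem_orthogonal b _ ⟨_, rfl⟩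
  have h3 := quadForm_nonneg (hC.posSemidef_covInf_sub ht.le) (b - (toX dC b : Vec N))
  have h4 := quadForm_nonneg (hC.posSemidef_cov ht.le) (b - (toX dC b : Vec N))
  rw [quadForm_sub] at h3
  linarith

/-- The differential inequality for `Ċ` implied by the multiscale criterion. -/
theorem exists_quadForm_ddot_le {V₀ : fieldSpace dC → ℝ} (hV₀ : Continuous V₀) {M : ℝ}
    (hM : ∀ x, Real.exp (-V₀ x) ≤ M) {dlam : ℝ → ℝ} (hcrit : MultiscaleCriterion dC V₀ dlam)
    (T : ℝ) : ∃ B, ∀ t, 0 < t → t ≤ T → ∀ u,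
      quadForm (ddot dC t) u ≤ (B - 2 * dlam t) * quadForm (dC t) u := by
  obtain ⟨K, H⟩ := hC.exists_gaussianFlow
  have hK := H.K_nonneg
  set Z₀ : fieldSpace dC → ℝ := fun x => Real.exp (-V₀ x) with hZ₀
  have hZc : Continuous Z₀ := by fun_prop
  obtain ⟨m, hm, hmle⟩ := exists_pos_le_avg hZc (fun _ => Real.exp_pos _) hM (K * T)
  set b := |2 * Real.log M - 2 * Real.log m| with hb
  set S := (N : ℝ) * N * K with hS
  refine ⟨2 * (b * S), fun t ht htT u => ?_⟩
  set μ := gaussian dC (cov dC t) with hμ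
  have hlow : ∀ x, ‖x‖ ≤ 1 → m ≤ avg μ Z₀ x := by
    have h1 := H.moment 0 t le_rfl ht.le 2 (by norm_num)
    rw [cov_zero, sub_zero, sub_zero, Real.sq_sqrt ht.le] at h1
    exact hmle μ inferInstance (integrable_norm_pow_gaussian dC _ 2)
      (h1.trans (mul_le_mul_of_nonneg_left htT hK))
  have hup : ∀ x, avg μ Z₀ x ≤ M := fun x => (le_abs_self _).trans (norm_avg_le_const
    (f := Z₀) (fun x => (Real.norm_of_nonneg (Real.exp_pos _).le).trans_le (hM x)) μ x)
  have hVlow : ∀ x, ‖x‖ ≤ 1 → renormPotential dC V₀ t x ≤ -Real.log m := fun x hx =>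
    neg_le_neg (Real.log_le_log hm (hlow x hx))
  have hVup : -Real.log M ≤ renormPotential dC V₀ t 0 :=
    neg_le_neg (Real.log_le_log (hm.trans_le (hlow 0 (by simp))) (hup 0))
  obtain ⟨a, ha⟩ := hC.exists_cov_apply_eq ht u
  set w := toX dC (Matrix.toEuclideanLin (dC t) u) with hw
  set h : ℝ → ℝ := fun r => renormPotential dC V₀ t (r • w) with hh
  have hC2 : ContDiff ℝ 2 h := by
    have := contDiff_renormPotential_line hV₀ hM (hC.posSemidef_cov ht.le) a
    rwa [← ha] at this
  set f := quadForm (dC t) u with hf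
  set f' := quadForm (ddot dC t) u with hf'
  set κ := dlam t * f + 1 / 2 * f' with hκ
  have hκle : ∀ r, κ ≤ iteratedDeriv 2 h r := fun r => by
    have h1 := hcrit t ht (r • w) u
    have h2 : hessForm (renormPotential dC V₀ t) (r • w) w = iteratedDeriv 2 h r := by
      have h3 : (fun s : ℝ => renormPotential dC V₀ t (r • w + s • w)) = fun s => h (r + s) := by
        funext s; rw [hh, ← add_smul]
      rw [hessForm, h3, iteratedDeriv_comp_const_add]
      simp
    rw [h2] at h1
    linarith
  have hf0 : 0 ≤ f := quadForm_nonneg (hC.posSemidef t ht.le) u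
  have hwle : ‖w‖ ^ 2 ≤ S * f := by
    refine (pow_le_pow_left₀ (norm_nonneg _) (norm_toX_le dC _) 2).trans
      ((norm_toEuclideanLin_sq_le (hC.posSemidef t ht.le) u).trans
        (mul_le_mul_of_nonneg_right ?_ hf0))
    refine (Finset.sum_le_sum fun i _ => Finset.sum_le_sum fun j _ =>
      H.bound t ht i j).trans (le_of_eq ?_)
    simp [hS]
    ring
  -- The second derivative of V_t along w is at least κ everywhere, whereas V_t is bounded above on
  -- the unit ball and below at the origin. The second difference over unit vectors ±w/‖w‖ therefore
  -- gives κ ≤ b‖w‖², and ‖w‖² ≤ S f because w comes from Ċ_t u. For w = 0 the second difference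
  -- vanishes.
  have hκb : κ ≤ b * (S * f) := by
    have hb0 : 0 ≤ b := abs_nonneg _
    have hS0 : 0 ≤ S := by positivity
    by_cases hw0 : w = 0
    · have h1 := midpoint_le_of_deriv2 hC2 hκle 1
      simp only [hh, hw0, smul_zero] at h1
      have : 0 ≤ b * (S * f) := by positivity
      linarith
    · have hn : 0 < ‖w‖ := norm_pos_iff.2 hw0
      have h1 := midpoint_le_of_deriv2 hC2 hκle ‖w‖⁻¹
      have hunit : ‖‖w‖⁻¹ • w‖ ≤ 1 := by
        rw [norm_smul, norm_inv, norm_norm, inv_mul_cancel₀ hn.ne']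
      have h2 := hVlow (‖w‖⁻¹ • w) hunit
      have h3 := hVlow (-‖w‖⁻¹ • w) (by rwa [neg_smul, norm_neg])
      have h4 : κ * ‖w‖⁻¹ ^ 2 ≤ b := by
        refine h1.trans (le_trans ?_ (le_abs_self _))
        simp only [hh, zero_smul]
        linarith
      rw [inv_pow, ← div_eq_mul_inv, div_le_iff₀ (by positivity)] at h4
      exact h4.trans (mul_le_mul_of_nonneg_left hwle hb0)
  linarith

/-- The multiscale criterion forces `C_t` to be nondegenerate on `X` for `t > 0`. -/
theorem posOn_cov {V₀ : fieldSpace dC → ℝ} (hV₀ : Continuous V₀) {M : ℝ}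
    (hM : ∀ x, Real.exp (-V₀ x) ≤ M) {dlam : ℝ → ℝ} (hcrit : MultiscaleCriterion dC V₀ dlam)
    (hdlam : ∀ t, 0 ≤ t → IntervalIntegrable dlam volume 0 t) {t : ℝ} (ht : 0 < t) :
    PosOn dC (cov dC t) := by
  intro a ha
  refine (quadForm_nonneg (hC.posSemidef_cov ht.le) _).lt_of_ne' fun h0 => ha ?_
  -- Up to time t this is monotonicity of C_s. Beyond t the differential inequality for Ċ propagates
  -- the zero. The form of C_∞ then vanishes at a, so a is orthogonal to X.
  have hz : ∀ s, 0 < s → quadForm (dC s) (a : Vec N) = 0 := fun s hs => by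
    rcases le_total s t with hst | hts
    · exact hC.quadForm_dC_eq_zero h0 hs hst
    · obtain ⟨B, hB⟩ := exists_quadForm_ddot_le hC hV₀ hM hcrit s
      have hk : IntervalIntegrable (fun r => B - 2 * dlam r) volume t s := by
        refine intervalIntegrable_const.sub (IntervalIntegrable.const_mul ?_ 2)
        refine (hdlam s hs.le).mono_set ?_
        rw [uIcc_of_le hts, uIcc_of_le hs.le]
        exact Icc_subset_Icc_left ht.le
      have h1 := le_mul_exp_integral_of_deriv_le hts
        (f := fun r => quadForm (dC r) (a : Vec N)) (k := fun r => B - 2 * dlam r)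
        (f' := fun r => quadForm (ddot dC r) (a : Vec N))
        (fun r hr => hasDerivAt_quadForm
          (fun i j => (hC.differentiable r (ht.trans_le hr.1) i j).hasDerivAt) _)
        (fun r hr => quadForm_nonneg (hC.posSemidef r (ht.le.trans hr.1)) _) hk
        (fun r hr => hB r (ht.trans_le hr.1) hr.2 _)
      rw [hC.quadForm_dC_eq_zero h0 ht le_rfl, zero_mul] at h1
      exact le_antisymm h1 (quadForm_nonneg (hC.posSemidef s hs.le) _)
  have h1 : quadForm (covInf dC) (a : Vec N) = 0 := by
    have := hC.quadForm_covInf_sub le_rfl (a : Vec N)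
    rw [cov_zero, sub_zero] at this
    rw [this, setIntegral_congr_fun measurableSet_Ioi (g := fun _ => (0 : ℝ)) fun r hr => hz r hr]
    simp
  have h2 := toEuclideanLin_eq_zero hC.posSemidef_covInf h1
  have hsym := Matrix.isSymmetric_toEuclideanLin_iff.2 hC.posSemidef_covInf.1
  have h3 : (a : Vec N) ∈ (fieldSpace dC)ᗮ := by
    rw [hsym.orthogonal_range]
    exact h2
  have h4 := h3 _ a.2
  rw [inner_self_eq_zero] at h4
  exact Subtype.ext h4

end Nondegeneracy

/-! ### Entropy and Fisher information of the renormalisation flow -/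

section EntropyFlow

variable {N : ℕ} (dC : ℝ → Mat N)

/-- `t ↦ E_{C_t}[f(· + ζ)]`. -/
def evolve (f : fieldSpace dC → ℝ) (t : ℝ) : fieldSpace dC → ℝ :=
  avg (gaussian dC (cov dC t - cov dC 0)) f

/-- The entropy `E_{C_∞ - C_t}[G_t log (G_t / Z_t)]` along the flow. -/
def flowEntropy (Z₀ G₀ : fieldSpace dC → ℝ) (t : ℝ) : ℝ :=
  ∫ φ, evolve dC G₀ t φ * logQuot (evolve dC Z₀) (evolve dC G₀) t φ ∂gaussian dC (covInf dC - cov dC t)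

/-- The Fisher information along the flow. -/
def flowFisher (Z₀ G₀ : fieldSpace dC → ℝ) : ℝ → ℝ :=
  fisher (frame dC) dC (fun t => gaussian dC (covInf dC - cov dC t)) (evolve dC Z₀) (evolve dC G₀)

variable {dC}

theorem renormPotential_eq (V₀ : fieldSpace dC → ℝ) (t : ℝ) :
    renormPotential dC V₀ t = fun φ => -Real.log (evolve dC (fun x => Real.exp (-V₀ x)) t φ) := by
  funext φ
  rw [evolve, cov_zero, sub_zero]
  rfl

/-- The criterion is stated for vectors u, the Fisher estimate for covectors ℓ. The Riesz
representative of ℓ translates between the two. -/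
theorem frame_criterion {t : ℝ} (hsym : ∀ i j, dC t i j = dC t j i)
    (ℓ : fieldSpace dC →L[ℝ] ℝ) : ∃ u : Vec N,
      (∀ A : Mat N, quadForm A u = ∑ i, ∑ j, A i j * (ℓ (frame dC i) * ℓ (frame dC j))) ∧
      toX dC (Matrix.toEuclideanLin (dC t) u) =
        ∑ i, ∑ j, (dC t i j * ℓ (frame dC i)) • frame dC j := by
  set v := (InnerProductSpace.toDual ℝ (fieldSpace dC)).symm ℓ with hv
  have hℓ : ∀ i, ℓ (frame dC i) = (v : Vec N) i := fun i => by
    rw [← inner_frame, real_inner_comm, hv, InnerProductSpace.toDual_symm_apply]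
  refine ⟨v, fun A => ?_, ?_⟩
  · simp only [quadForm, hℓ, mul_assoc]
  · rw [toX_eq_sum, Finset.sum_comm]
    refine Finset.sum_congr rfl fun j _ => ?_
    rw [← Finset.sum_smul]
    congr 1
    simp only [Matrix.toLpLin_apply, Matrix.mulVec, dotProduct, hℓ]
    exact Finset.sum_congr rfl fun i _ => by rw [hsym j i]

variable (hC : IsDifferentiableCovDecomposition dC)
include hC

theorem exists_heatPair {V₀ : fieldSpace dC → ℝ} (hV₀ : Continuous V₀) {M : ℝ}
    (hM : ∀ x, Real.exp (-V₀ x) ≤ M) {dlam : ℝ → ℝ} (hcrit : MultiscaleCriterion dC V₀ dlam)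
    (hdlam : ∀ t, 0 ≤ t → IntervalIntegrable dlam volume 0 t) {G₀ : fieldSpace dC → ℝ}
    (hG : Continuous G₀) {ε : ℝ} (hε : 0 < ε) (hG0 : ∀ x, ε * Real.exp (-V₀ x) ≤ G₀ x)
    (hGM : ∀ x, G₀ x ≤ M * Real.exp (-V₀ x)) {K : ℝ}
    (H : GaussianFlow (frame dC) dC (cov dC) (fun s t => gaussian dC (cov dC t - cov dC s))
      (fun t => gaussian dC (covInf dC - cov dC t)) K) {t₀ : ℝ} (ht₀ : 0 < t₀) :
    HeatPair (frame dC) dC t₀ (evolve dC fun x => Real.exp (-V₀ x)) (evolve dC G₀) ε M K := by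
  refine H.heatPair ht₀ ?_ (by fun_prop) hG hε ((Real.exp_pos _).trans_le (hM 0))
    (fun x => Real.exp_pos _) hM hG0 hGM fun t ht => exists_factor _ (hC.posSemidef t (ht₀.trans ht).le)
  simp only [cov_zero, sub_zero]
  exact PosOn.smoother dC (hC.posSemidef_cov ht₀.le) (posOn_cov hC hV₀ hM hcrit hdlam ht₀) 4

theorem hasDerivAt_flowEntropy {V₀ : fieldSpace dC → ℝ} (hV₀ : Continuous V₀) {M : ℝ}
    (hM : ∀ x, Real.exp (-V₀ x) ≤ M) {dlam : ℝ → ℝ} (hcrit : MultiscaleCriterion dC V₀ dlam)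
    (hdlam : ∀ t, 0 ≤ t → IntervalIntegrable dlam volume 0 t) {G₀ : fieldSpace dC → ℝ}
    (hG : Continuous G₀) {ε : ℝ} (hε : 0 < ε) (hG0 : ∀ x, ε * Real.exp (-V₀ x) ≤ G₀ x)
    (hGM : ∀ x, G₀ x ≤ M * Real.exp (-V₀ x)) {t : ℝ} (ht : 0 < t) :
    HasDerivAt (flowEntropy dC (fun x => Real.exp (-V₀ x)) G₀)
      (-(1 / 2 * flowFisher dC (fun x => Real.exp (-V₀ x)) G₀ t)) t := by
  obtain ⟨K, H⟩ := hC.exists_gaussianFlow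
  -- Any starting time strictly between 0 and t will do, and t/2 is taken.
  exact (exists_heatPair hC hV₀ hM hcrit hdlam hG hε hG0 hGM H (half_pos ht)).hasDerivAt_entropy_fisher
    H (half_pos ht).le (half_lt_self ht)

theorem flowFisher_le {V₀ : fieldSpace dC → ℝ} (hV₀ : Continuous V₀) {M : ℝ}
    (hM : ∀ x, Real.exp (-V₀ x) ≤ M) {dlam : ℝ → ℝ} (hcrit : MultiscaleCriterion dC V₀ dlam)
    (hdlam : ∀ t, 0 ≤ t → IntervalIntegrable dlam volume 0 t) {G₀ : fieldSpace dC → ℝ}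
    (hG : Continuous G₀) {ε : ℝ} (hε : 0 < ε) (hG0 : ∀ x, ε * Real.exp (-V₀ x) ≤ G₀ x)
    (hGM : ∀ x, G₀ x ≤ M * Real.exp (-V₀ x)) {s t : ℝ} (hs : 0 < s) (hst : s ≤ t) :
    flowFisher dC (fun x => Real.exp (-V₀ x)) G₀ t ≤
      flowFisher dC (fun x => Real.exp (-V₀ x)) G₀ s * Real.exp (∫ r in s..t, -2 * dlam r) := by
  obtain ⟨K, H⟩ := hC.exists_gaussianFlow
  have P := exists_heatPair hC hV₀ hM hcrit hdlam hG hε hG0 hGM H (half_pos hs)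
  have hlt : ∀ r ∈ Icc s t, s / 2 < r := fun r hr => (half_lt_self hs).trans_le hr.1
  have hder : ∀ r ∈ Icc s t, ∃ I', HasDerivAt (flowFisher dC (fun x => Real.exp (-V₀ x)) G₀) I' r ∧
      I' ≤ -2 * dlam r * flowFisher dC (fun x => Real.exp (-V₀ x)) G₀ r := fun r hr => by
    have hr0 : 0 < r := hs.trans_le hr.1
    refine P.exists_hasDerivAt_fisher H (half_pos hs).le (hlt r hr) (C₂ := ddot dC r)
      (fun i j => (hC.differentiable r hr0 i j).hasDerivAt) fun φ ℓ => ?_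
    obtain ⟨u, hu, hu'⟩ := frame_criterion (fun i j => hC.symm hr0.le i j) ℓ
    have h1 := hcrit r hr0 φ u
    have hc2 : ContDiff ℝ 2 (fun y => Real.log (evolve dC (fun x => Real.exp (-V₀ x)) r y)) :=
      (P.contDiff_log_Z (hlt r hr)).of_le (by norm_num)
    rw [renormPotential_eq, hessForm_eq hc2.neg, hu', hu, hu] at h1
    have h2 : fderiv ℝ (fun y => -Real.log (evolve dC (fun x => Real.exp (-V₀ x)) r y)) =
        fun y => -fderiv ℝ (fun y => Real.log (evolve dC (fun x => Real.exp (-V₀ x)) r y)) y := by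
      funext y; exact fderiv_fun_neg
    rw [h2, fderiv_fun_neg] at h1
    simpa using h1
  choose! I' hI' hle using hder
  have hk : IntervalIntegrable (fun r => -2 * dlam r) volume s t := by
    refine IntervalIntegrable.const_mul ((hdlam t (hs.le.trans hst)).mono_set ?_) _
    rw [uIcc_of_le hst, uIcc_of_le (hs.le.trans hst)]
    exact Icc_subset_Icc_left hs.le
  exact le_mul_exp_integral_of_deriv_le hst hI' (fun r hr => P.fisher_nonneg H (hlt r hr)) hk hle

end EntropyFlow

/-! ### The Bregman divergence of x log x -/

section Bregman

/-- The Bregman divergence of `x log x`. -/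
def bregman (x a : ℝ) : ℝ := x * Real.log x - x * Real.log a - x + a

theorem bregman_nonneg {x a : ℝ} (hx : 0 < x) (ha : 0 < a) : 0 ≤ bregman x a := by
  have h := Real.log_le_sub_one_of_pos (div_pos ha hx)
  rw [Real.log_div ha.ne' hx.ne'] at h
  have h2 := mul_le_mul_of_nonneg_left h hx.le
  have h3 : x * (a / x - 1) = a - x := by field_simp
  rw [bregman]
  linarith

/-- The difference of the two sides has derivative (y-1)³/y, so it is minimal at y = 1, where it
vanishes. -/
theorem log_le_cubic {y : ℝ} (hy : 0 < y) :
    Real.log y ≤ (y - 1) - (y - 1) ^ 2 / 2 + (y - 1) ^ 3 / 3 := by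
  set f : ℝ → ℝ := fun y => (y - 1) - (y - 1) ^ 2 / 2 + (y - 1) ^ 3 / 3 - Real.log y with hf
  have hd : ∀ y, 0 < y → HasDerivAt f ((y - 1) ^ 3 / y) y := fun y hy => by
    have h1 : HasDerivAt (fun y : ℝ => y - 1) 1 y := (hasDerivAt_id y).sub_const 1
    refine (((h1.fun_sub ((h1.fun_pow 2).div_const 2)).fun_add ((h1.fun_pow 3).div_const 3)).fun_sub
      (Real.hasDerivAt_log hy.ne')).congr_deriv ?_
    field_simp
    ring
  have h1 : f 1 = 0 := by simp [hf]
  suffices f 1 ≤ f y by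
    rw [h1] at this
    simp only [hf] at this
    linarith
  rcases le_total y 1 with h | h
  · refine (antitoneOn_of_deriv_nonpos (convex_Icc y 1)
      (fun x hx => (hd x (hy.trans_le hx.1)).continuousAt.continuousWithinAt)
      (fun x hx => ?_) (fun x hx => ?_)) (left_mem_Icc.2 h) (right_mem_Icc.2 h) h
    · rw [interior_Icc] at hx
      exact (hd x (hy.trans hx.1)).differentiableAt.differentiableWithinAt
    · rw [interior_Icc] at hx
      rw [(hd x (hy.trans hx.1)).deriv]
      refine div_nonpos_of_nonpos_of_nonneg ?_ (hy.trans hx.1).le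
      exact Odd.pow_nonpos (by decide) (by linarith [hx.2])
  · refine (monotoneOn_of_deriv_nonneg (convex_Icc 1 y)
      (fun x hx => (hd x (one_pos.trans_le hx.1)).continuousAt.continuousWithinAt)
      (fun x hx => ?_) (fun x hx => ?_)) (left_mem_Icc.2 h) (right_mem_Icc.2 h) h
    · rw [interior_Icc] at hx
      exact (hd x (one_pos.trans hx.1)).differentiableAt.differentiableWithinAt
    · rw [interior_Icc] at hx
      rw [(hd x (one_pos.trans hx.1)).deriv]
      exact div_nonneg (pow_nonneg (by linarith [hx.1]) 3) (one_pos.trans hx.1).le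

/-- The cubic bound for log at y = x/a, multiplied by x. The leading term has the exact constant
1/(2a), which is what fixes the constant of the log-Sobolev inequality. -/
theorem bregman_le {x a : ℝ} (hx : 0 < x) (ha : 0 < a) :
    bregman x a ≤ (x - a) ^ 2 / (2 * a) + |x - a| ^ 3 / (6 * a ^ 2) + (x - a) ^ 4 / (3 * a ^ 3) := by
  have h := log_le_cubic (div_pos hx ha)
  rw [Real.log_div hx.ne' ha.ne'] at h
  have h2 := mul_le_mul_of_nonneg_left h hx.le
  have h3 : -(x - a) ^ 3 / (6 * a ^ 2) ≤ |x - a| ^ 3 / (6 * a ^ 2) := by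
    gcongr
    rw [← abs_pow]
    exact neg_le_abs _
  have h4 : x * (x / a - 1 - (x / a - 1) ^ 2 / 2 + (x / a - 1) ^ 3 / 3) - x + a =
      (x - a) ^ 2 / (2 * a) + -(x - a) ^ 3 / (6 * a ^ 2) + (x - a) ^ 4 / (3 * a ^ 3) := by
    field_simp
    ring
  rw [bregman]
  linarith

end Bregman

/-! ### The initial slope of the entropy -/

section SmallTime

variable {N : ℕ} {E : Type} [NormedAddCommGroup E] [InnerProductSpace ℝ E] [FiniteDimensional ℝ E]
  [MeasurableSpace E] [BorelSpace E]

/-- Increments over distances at least δ are bounded by 2M ≤ 2M‖ζ‖²/δ². A modulus of this form can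
be integrated using the second moment alone. -/
theorem exists_modulus {f : E → ℝ} {M : ℝ} (hM : ∀ x, |f x| ≤ M) {A : Set E} {η δ : ℝ}
    (hδ : 0 < δ) (hη : 0 ≤ η) (h : ∀ φ ∈ A, ∀ ζ, ‖ζ‖ < δ → |f (φ + ζ) - f φ| ≤ η) :
    ∃ R, 0 ≤ R ∧ ∀ φ ∈ A, ∀ ζ, |f (φ + ζ) - f φ| ≤ η + R * ‖ζ‖ ^ 2 := by
  have hM0 : 0 ≤ M := (abs_nonneg _).trans (hM 0)
  refine ⟨2 * M / δ ^ 2, by positivity, fun φ hφ ζ => ?_⟩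
  by_cases hζ : ‖ζ‖ < δ
  · have : 0 ≤ 2 * M / δ ^ 2 * ‖ζ‖ ^ 2 := by positivity
    linarith [h φ hφ ζ hζ]
  · have h1 : |f (φ + ζ) - f φ| ≤ 2 * M := (abs_sub _ _).trans (by linarith [hM (φ + ζ), hM φ])
    have h2 : 1 ≤ ‖ζ‖ ^ 2 / δ ^ 2 := by
      rw [one_le_div (by positivity)]
      exact pow_le_pow_left₀ hδ.le (not_lt.1 hζ) 2
    calc _ ≤ 2 * M * 1 := by linarith
      _ ≤ 2 * M * (‖ζ‖ ^ 2 / δ ^ 2) := by gcongr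
      _ ≤ _ := by rw [mul_div_assoc', mul_div_right_comm]; linarith

theorem exists_modulus_of_isCompact {f : E → ℝ} (hf : Continuous f) {M : ℝ} (hM : ∀ x, |f x| ≤ M)
    {A : Set E} (hA : IsCompact A) {η : ℝ} (hη : 0 < η) :
    ∃ R, 0 ≤ R ∧ ∀ φ ∈ A, ∀ ζ, |f (φ + ζ) - f φ| ≤ η + R * ‖ζ‖ ^ 2 := by
  have hc : IsCompact (Metric.cthickening 1 A) := hA.cthickening
  have hu := Metric.uniformContinuousOn_iff.1
    (hc.uniformContinuousOn_of_continuous hf.continuousOn) η hη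
  obtain ⟨δ, hδ, h⟩ := hu
  refine exists_modulus hM (δ := min δ 1) (by positivity) hη.le fun φ hφ ζ hζ => ?_
  have hd : dist (φ + ζ) φ = ‖ζ‖ := by simp
  have h1 : φ + ζ ∈ Metric.cthickening 1 A :=
    Metric.mem_cthickening_of_dist_le _ φ 1 A hφ (by rw [hd]; exact (hζ.trans_le (min_le_right _ _)).le)
  have h2 := h (φ + ζ) h1 φ (Metric.self_subset_cthickening A hφ)
    (by rw [hd]; exact hζ.trans_le (min_le_left _ _))
  exact h2.le

theorem exists_modulus_of_hasCompactSupport {f : E → ℝ} (hf : Continuous f)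
    (hs : HasCompactSupport f) {M : ℝ} (hM : ∀ x, |f x| ≤ M) {η : ℝ} (hη : 0 < η) :
    ∃ R, 0 ≤ R ∧ ∀ φ ζ, |f (φ + ζ) - f φ| ≤ η + R * ‖ζ‖ ^ 2 := by
  obtain ⟨δ, hδ, h⟩ := Metric.uniformContinuous_iff.1
    (hs.uniformContinuous_of_continuous hf) η hη
  obtain ⟨R, hR, h'⟩ := exists_modulus hM (A := univ) hδ hη.le fun φ _ ζ hζ =>
    (h (a := φ + ζ) (b := φ) (by simpa using hζ)).le
  exact ⟨R, hR, fun φ ζ => h' φ (mem_univ φ) ζ⟩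

theorem avg_bregman {Z₀ F : E → ℝ} (hZ : Continuous Z₀) (hF : Continuous F) {ε M : ℝ}
    (hZ0 : ∀ x, 0 < Z₀ x) (hZM : ∀ x, Z₀ x ≤ M) (hε : 0 < ε) (hFε : ∀ x, ε ≤ F x)
    (hFM : ∀ x, F x ≤ M) (μ : Measure E) [IsProbabilityMeasure μ] (a : ℝ) (φ : E) :
    avg μ (fun x => Z₀ x * bregman (F x) a) φ =
      avg μ (fun x => Z₀ x * F x * Real.log (F x)) φ - avg μ (fun x => Z₀ x * F x) φ * Real.log a -
        avg μ (fun x => Z₀ x * F x) φ + a * avg μ Z₀ φ := by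
  have hM0 : 0 ≤ M := (hZ0 0).le.trans (hZM 0)
  have hF0 : ∀ x, 0 < F x := fun x => hε.trans_le (hFε x)
  have hZn : ∀ x, ‖Z₀ x‖ ≤ M := fun x => (Real.norm_of_nonneg (hZ0 x).le).trans_le (hZM x)
  have hFn : ∀ x, ‖F x‖ ≤ M := fun x => (Real.norm_of_nonneg (hF0 x).le).trans_le (hFM x)
  have hGn : ∀ x, ‖Z₀ x * F x‖ ≤ M * M := fun x => by
    rw [norm_mul]; exact mul_le_mul (hZn x) (hFn x) (norm_nonneg _) hM0
  have hlog : ∀ x, ‖Real.log (F x)‖ ≤ |Real.log ε| + |Real.log M| := fun x => by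
    have h1 := Real.log_le_log hε (hFε x)
    have h2 := Real.log_le_log (hF0 x) (hFM x)
    rw [Real.norm_eq_abs, abs_le]
    constructor <;> linarith [neg_abs_le (Real.log ε), le_abs_self (Real.log M),
      abs_nonneg (Real.log ε), abs_nonneg (Real.log M)]
  have hlc : Continuous fun x => Real.log (F x) := hF.log fun x => (hF0 x).ne'
  have i1 := integrable_shift (f := fun x => Z₀ x * F x * Real.log (F x)) (by fun_prop)
    (M := M * M * (|Real.log ε| + |Real.log M|)) (fun x => by
      rw [norm_mul]; exact mul_le_mul (hGn x) (hlog x) (norm_nonneg _) (by positivity)) μ φ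
  have i2 := integrable_shift (f := fun x => Z₀ x * F x) (by fun_prop) hGn μ φ
  have i3 := integrable_shift hZ hZn μ φ
  have j1 : Integrable (fun ζ => Z₀ (φ + ζ) * F (φ + ζ) * Real.log (F (φ + ζ)) -
      Z₀ (φ + ζ) * F (φ + ζ) * Real.log a) μ := i1.sub (i2.mul_const _)
  have j2 : Integrable (fun ζ => Z₀ (φ + ζ) * F (φ + ζ) * Real.log (F (φ + ζ)) -
      Z₀ (φ + ζ) * F (φ + ζ) * Real.log a - Z₀ (φ + ζ) * F (φ + ζ)) μ := j1.sub i2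
  simp only [avg]
  rw [← integral_mul_const, ← integral_const_mul, ← integral_sub i1 (i2.mul_const _),
    ← integral_sub j1 i2, ← integral_add j2 (i3.const_mul a)]
  refine integral_congr_ae (Eventually.of_forall fun ζ => ?_)
  simp only [bregman]
  ring

/-- The entropy defect is the minimum over a of the averaged Bregman divergence from a, attained at
a = g/z; the excess for another a is z times the divergence of g/z from a. Nonnegativity gives the
first part, and the freedom to choose a the second. -/
theorem mul_logQuot_le_avg {Z₀ F : E → ℝ} (hZ : Continuous Z₀) (hF : Continuous F) {ε M : ℝ}
    (hZ0 : ∀ x, 0 < Z₀ x) (hZM : ∀ x, Z₀ x ≤ M) (hε : 0 < ε) (hFε : ∀ x, ε ≤ F x)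
    (hFM : ∀ x, F x ≤ M) (μ : Measure E) [IsProbabilityMeasure μ] (φ : E) :
    avg μ (fun x => Z₀ x * F x) φ *
        (Real.log (avg μ (fun x => Z₀ x * F x) φ) - Real.log (avg μ Z₀ φ)) ≤
      avg μ (fun x => Z₀ x * F x * Real.log (F x)) φ ∧
    ∀ a, 0 < a → avg μ (fun x => Z₀ x * F x * Real.log (F x)) φ -
      avg μ (fun x => Z₀ x * F x) φ *
        (Real.log (avg μ (fun x => Z₀ x * F x) φ) - Real.log (avg μ Z₀ φ)) ≤
      avg μ (fun x => Z₀ x * bregman (F x) a) φ := by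
  have hF0 : ∀ x, 0 < F x := fun x => hε.trans_le (hFε x)
  have hM0 : 0 ≤ M := (hZ0 0).le.trans (hZM 0)
  have hz := avg_pos hZ hZ0 hZM μ φ
  have hg : 0 < avg μ (fun x => Z₀ x * F x) φ :=
    avg_pos (hZ.mul hF) (fun x => mul_pos (hZ0 x) (hF0 x))
      (fun x => mul_le_mul (hZM x) (hFM x) (hF0 x).le hM0) μ φ
  have hb := avg_bregman hZ hF hZ0 hZM hε hFε hFM μ
  set z := avg μ Z₀ φ
  set g := avg μ (fun x => Z₀ x * F x) φ
  constructor
  · have h1 : 0 ≤ avg μ (fun x => Z₀ x * bregman (F x) (g / z)) φ :=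
      integral_nonneg fun ζ => mul_nonneg (hZ0 _).le (bregman_nonneg (hF0 _) (div_pos hg hz))
    rw [hb, Real.log_div hg.ne' hz.ne', div_mul_cancel₀ _ hz.ne'] at h1
    linarith
  · intro a ha
    have h1 := mul_nonneg hz.le (bregman_nonneg (div_pos hg hz) ha)
    have h2 : z * bregman (g / z) a = g * (Real.log g - Real.log z) - g * Real.log a - g + a * z := by
      rw [bregman, Real.log_div hg.ne' hz.ne']
      field_simp
    rw [hb]
    linarith

theorem sq_sub_sq_le {x y r : ℝ} (h : |x - y| ≤ r) {s : ℝ} (hx : |x| ≤ s) (hy : |y| ≤ s) :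
    x ^ 2 ≤ y ^ 2 + r * (2 * s) := by
  have h1 : x ^ 2 - y ^ 2 = (x - y) * (x + y) := by ring
  have h2 : (x - y) * (x + y) ≤ |x - y| * |x + y| := by rw [← abs_mul]; exact le_abs_self _
  have h3 : |x + y| ≤ 2 * s := (abs_add_le _ _).trans (by linarith)
  have h4 : |x - y| * |x + y| ≤ r * (2 * s) :=
    mul_le_mul h h3 (abs_nonneg _) ((abs_nonneg _).trans h)
  linarith

/-- To leading order the divergence is (∂_ζF)²/(2F), and higher terms are cubic and quartic in ζ.
Replacing Z₀(φ+ζ) by Z₀(φ) is needed only where ∇F ≠ 0, that is on a compact set, where the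
continuity of Z₀ is uniform. -/
theorem exists_bregman_bound {Z₀ F : E → ℝ} (hZ : Continuous Z₀) {ε M c : ℝ}
    (hZ0 : ∀ x, 0 < Z₀ x) (hZM : ∀ x, Z₀ x ≤ M) (hε : 0 < ε) (hFε : ∀ x, ε ≤ F x)
    (hF : BddC3 c F) (hs : HasCompactSupport (fderiv ℝ F)) {η : ℝ} (hη : 0 < η) :
    ∃ A, 0 ≤ A ∧ ∀ φ ζ, Z₀ (φ + ζ) * bregman (F (φ + ζ)) (F φ) ≤
      Z₀ φ / (2 * F φ) * (fderiv ℝ F φ ζ) ^ 2 + η * ‖ζ‖ ^ 2 + A * (‖ζ‖ ^ 3 + ‖ζ‖ ^ 4) := by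
  have hM0 : 0 ≤ M := (hZ0 0).le.trans (hZM 0)
  have hc0 := hF.nonneg
  have hF0 : ∀ x, 0 < F x := fun x => hε.trans_le (hFε x)
  set c₁ := c ^ 2 / (2 * ε) with hc₁
  have hc₁0 : 0 ≤ c₁ := by positivity
  obtain ⟨R, hR, hmod⟩ := exists_modulus_of_isCompact hZ
    (fun x => (abs_of_pos (hZ0 x)).trans_le (hZM x)) hs.isCompact (η := η / (c₁ + 1)) (by positivity)
  refine ⟨M * (c ^ 2 / ε + c ^ 3 / (6 * ε ^ 2) + c ^ 4 / (3 * ε ^ 3)) + R * c₁, by positivity,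
    fun φ ζ => ?_⟩
  set a := F φ with ha
  set Δ := F (φ + ζ) - a with hΔ
  set ℓ := fderiv ℝ F φ with hℓ
  have ha0 : 0 < a := hF0 φ
  have hae : ε ≤ a := hFε φ
  set n := ‖ζ‖ with hn
  have hn0 : 0 ≤ n := norm_nonneg ζ
  have hℓζ : |ℓ ζ| ≤ c * n := (ℓ.le_opNorm ζ).trans
    (mul_le_mul_of_nonneg_right (hF.norm_fderiv_le φ) hn0)
  have hΔn : |Δ| ≤ c * n := norm_sub_le_of_fderiv_bound (hF.1.differentiable (by norm_num))
    hF.norm_fderiv_le φ ζ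
  have hrem : |Δ - ℓ ζ| ≤ c * n ^ 2 + c * n ^ 3 := by
    have h1 := hF.taylor φ ζ
    have h2 : |fderiv ℝ (fderiv ℝ F) φ ζ ζ| ≤ c * n * n :=
      ((fderiv ℝ (fderiv ℝ F) φ).le_opNorm₂ ζ ζ).trans (by
        gcongr; exact hF.norm_fderiv_fderiv_le φ)
    have h3 : Δ - ℓ ζ = (F (φ + ζ) - F φ - ℓ ζ - fderiv ℝ (fderiv ℝ F) φ ζ ζ / 2) +
        fderiv ℝ (fderiv ℝ F) φ ζ ζ / 2 := by rw [hΔ]; ring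
    rw [h3]
    refine (abs_add_le _ _).trans ?_
    rw [abs_div, abs_two]
    have : 0 ≤ c * n ^ 2 := by positivity
    have e : c * n * n = c * n ^ 2 := by ring
    linarith
  have hΔ2 : Δ ^ 2 ≤ (ℓ ζ) ^ 2 + 2 * c ^ 2 * (n ^ 3 + n ^ 4) :=
    (sq_sub_sq_le hrem hΔn hℓζ).trans_eq (by ring)
  have hΔ3 : |Δ| ^ 3 ≤ c ^ 3 * n ^ 3 := by
    rw [← mul_pow]; exact pow_le_pow_left₀ (abs_nonneg _) hΔn 3
  have hΔ4 : Δ ^ 4 ≤ c ^ 4 * n ^ 4 := by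
    rw [← mul_pow, ← (by decide : Even 4).pow_abs]
    exact pow_le_pow_left₀ (abs_nonneg _) hΔn 4
  have hB := bregman_le (hF0 (φ + ζ)) ha0
  have hB2 : bregman (F (φ + ζ)) a ≤ (ℓ ζ) ^ 2 / (2 * a) +
      (c ^ 2 / ε + c ^ 3 / (6 * ε ^ 2) + c ^ 4 / (3 * ε ^ 3)) * (n ^ 3 + n ^ 4) := by
    have h1 : Δ ^ 2 / (2 * a) ≤ (ℓ ζ) ^ 2 / (2 * a) + c ^ 2 / ε * (n ^ 3 + n ^ 4) := by
      calc Δ ^ 2 / (2 * a) ≤ ((ℓ ζ) ^ 2 + 2 * c ^ 2 * (n ^ 3 + n ^ 4)) / (2 * a) := by gcongr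
        _ = (ℓ ζ) ^ 2 / (2 * a) + c ^ 2 * (n ^ 3 + n ^ 4) / a := by field_simp
        _ ≤ (ℓ ζ) ^ 2 / (2 * a) + c ^ 2 * (n ^ 3 + n ^ 4) / ε := by gcongr
        _ = _ := by ring
    have h2 : |Δ| ^ 3 / (6 * a ^ 2) ≤ c ^ 3 / (6 * ε ^ 2) * (n ^ 3 + n ^ 4) := by
      calc |Δ| ^ 3 / (6 * a ^ 2) ≤ (c ^ 3 * n ^ 3) / (6 * ε ^ 2) := by gcongr
        _ = c ^ 3 / (6 * ε ^ 2) * n ^ 3 := by ring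
        _ ≤ _ := by gcongr; linarith [pow_nonneg hn0 4]
    have h3 : Δ ^ 4 / (3 * a ^ 3) ≤ c ^ 4 / (3 * ε ^ 3) * (n ^ 3 + n ^ 4) := by
      calc Δ ^ 4 / (3 * a ^ 3) ≤ (c ^ 4 * n ^ 4) / (3 * ε ^ 3) := by gcongr
        _ = c ^ 4 / (3 * ε ^ 3) * n ^ 4 := by ring
        _ ≤ _ := by gcongr; linarith [pow_nonneg hn0 3]
    linarith
  have hℓc : (ℓ ζ) ^ 2 / (2 * a) ≤ c₁ * n ^ 2 := by
    calc (ℓ ζ) ^ 2 / (2 * a) = |ℓ ζ| ^ 2 / (2 * a) := by rw [sq_abs]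
      _ ≤ (c * n) ^ 2 / (2 * ε) := by gcongr
      _ = _ := by rw [hc₁]; ring
  have hZd : Z₀ (φ + ζ) * ((ℓ ζ) ^ 2 / (2 * a)) ≤
      Z₀ φ * ((ℓ ζ) ^ 2 / (2 * a)) + (η * n ^ 2 + R * c₁ * (n ^ 3 + n ^ 4)) := by
    by_cases hφ : φ ∈ tsupport (fderiv ℝ F)
    · have h1 := (le_abs_self _).trans (hmod φ hφ ζ)
      have h2 : 0 ≤ (ℓ ζ) ^ 2 / (2 * a) := by positivity
      have h3 := mul_le_mul_of_nonneg_right h1 h2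
      have h4 : (η / (c₁ + 1) + R * n ^ 2) * ((ℓ ζ) ^ 2 / (2 * a)) ≤
          (η / (c₁ + 1) + R * n ^ 2) * (c₁ * n ^ 2) := by gcongr
      have h5 : η / (c₁ + 1) * c₁ ≤ η := by
        rw [div_mul_eq_mul_div, div_le_iff₀ (by positivity)]
        nlinarith
      have h6 : η / (c₁ + 1) * c₁ * n ^ 2 ≤ η * n ^ 2 := by gcongr
      have h7 : 0 ≤ R * c₁ * n ^ 3 := by positivity
      linarith
    · have h1 : ℓ = 0 := image_eq_zero_of_notMem_tsupport hφ
      rw [h1]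
      simp only [zero_apply]
      have : 0 ≤ η * n ^ 2 + R * c₁ * (n ^ 3 + n ^ 4) := by positivity
      simpa using this
  have h1 := mul_le_mul_of_nonneg_left hB2 (hZ0 (φ + ζ)).le
  have hP : 0 ≤ (c ^ 2 / ε + c ^ 3 / (6 * ε ^ 2) + c ^ 4 / (3 * ε ^ 3)) * (n ^ 3 + n ^ 4) := by
    positivity
  have h2 := mul_le_mul_of_nonneg_right (hZM (φ + ζ)) hP
  have h3 : Z₀ φ / (2 * a) * (ℓ ζ) ^ 2 = Z₀ φ * ((ℓ ζ) ^ 2 / (2 * a)) := by ring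
  rw [h3]
  linarith

theorem exists_entropy_density_bound {Z₀ F : E → ℝ} (hZ : Continuous Z₀) (hF : Continuous F)
    {ε M : ℝ} (hZ0 : ∀ x, 0 < Z₀ x) (hZM : ∀ x, Z₀ x ≤ M) (hε : 0 < ε) (hFε : ∀ x, ε ≤ F x)
    (hFM : ∀ x, F x ≤ M) (μ : Measure E) [IsProbabilityMeasure μ] :
    Continuous (fun φ => avg μ (fun x => Z₀ x * F x) φ *
        (Real.log (avg μ (fun x => Z₀ x * F x) φ) - Real.log (avg μ Z₀ φ))) ∧
    ∃ c, ∀ φ, ‖avg μ (fun x => Z₀ x * F x) φ *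
        (Real.log (avg μ (fun x => Z₀ x * F x) φ) - Real.log (avg μ Z₀ φ))‖ ≤ c := by
  have hM0 : 0 ≤ M := (hZ0 0).le.trans (hZM 0)
  have hF0 : ∀ x, 0 < F x := fun x => hε.trans_le (hFε x)
  have hZn : ∀ x, ‖Z₀ x‖ ≤ M := fun x => (Real.norm_of_nonneg (hZ0 x).le).trans_le (hZM x)
  have hFn : ∀ x, ‖F x‖ ≤ M := fun x => (Real.norm_of_nonneg (hF0 x).le).trans_le (hFM x)
  have hGn : ∀ x, ‖Z₀ x * F x‖ ≤ M * M := fun x => by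
    rw [norm_mul]; exact mul_le_mul (hZn x) (hFn x) (norm_nonneg _) hM0
  have hGc : Continuous fun x => Z₀ x * F x := hZ.mul hF
  have hz := fun φ => avg_pos hZ hZ0 hZM μ φ
  have hg1 : ∀ φ, ε * avg μ Z₀ φ ≤ avg μ (fun x => Z₀ x * F x) φ := fun φ => by
    rw [← avg_const_mul]
    refine avg_mono (f := fun x => ε * Z₀ x) (M := ε * M) (by fun_prop) hGc (fun x => ?_) hGn
      (fun x => ?_) μ φ
    · rw [norm_mul, Real.norm_of_nonneg hε.le]
      exact mul_le_mul_of_nonneg_left (hZn x) hε.le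
    · nlinarith [hFε x, hZ0 x]
  have hg2 : ∀ φ, avg μ (fun x => Z₀ x * F x) φ ≤ M * avg μ Z₀ φ := fun φ => by
    rw [← avg_const_mul]
    refine avg_mono (g := fun x => M * Z₀ x) (M' := M * M) hGc (by fun_prop) hGn (fun x => ?_)
      (fun x => ?_) μ φ
    · rw [norm_mul, Real.norm_of_nonneg hM0]
      exact mul_le_mul_of_nonneg_left (hZn x) hM0
    · nlinarith [hFM x, hZ0 x]
  have hg : ∀ φ, 0 < avg μ (fun x => Z₀ x * F x) φ := fun φ =>
    (mul_pos hε (hz φ)).trans_le (hg1 φ)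
  have cz : Continuous (avg μ Z₀) := continuous_avg hZ hZn μ
  have cg : Continuous (avg μ (fun x => Z₀ x * F x)) := continuous_avg hGc hGn μ
  refine ⟨cg.mul ((cg.log fun φ => (hg φ).ne').sub (cz.log fun φ => (hz φ).ne')),
    M * M * (|Real.log ε| + |Real.log M|), fun φ => ?_⟩
  rw [norm_mul]
  refine mul_le_mul (norm_avg_le_const hGn μ φ) ?_ (norm_nonneg _) (by positivity)
  have h1 : ε ≤ avg μ (fun x => Z₀ x * F x) φ / avg μ Z₀ φ := (le_div_iff₀ (hz φ)).2 (hg1 φ)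
  have h2 : avg μ (fun x => Z₀ x * F x) φ / avg μ Z₀ φ ≤ M := (div_le_iff₀ (hz φ)).2 (hg2 φ)
  rw [← Real.log_div (hg φ).ne' (hz φ).ne']
  have h3 := Real.log_le_log hε h1
  have h4 := Real.log_le_log (hε.trans_le h1) h2
  rw [Real.norm_eq_abs, abs_le]
  constructor <;> linarith [neg_abs_le (Real.log ε), le_abs_self (Real.log M),
    abs_nonneg (Real.log ε), abs_nonneg (Real.log M)]

theorem exists_mul_log_bound {Z₀ F : E → ℝ} (hZ : Continuous Z₀) (hF : Continuous F)
    {ε M : ℝ} (hZ0 : ∀ x, 0 < Z₀ x) (hZM : ∀ x, Z₀ x ≤ M) (hε : 0 < ε) (hFε : ∀ x, ε ≤ F x)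
    (hFM : ∀ x, F x ≤ M) : Continuous (fun x => Z₀ x * F x * Real.log (F x)) ∧
      ∃ c, ∀ x, ‖Z₀ x * F x * Real.log (F x)‖ ≤ c := by
  have hM0 : 0 ≤ M := (hZ0 0).le.trans (hZM 0)
  have hF0 : ∀ x, 0 < F x := fun x => hε.trans_le (hFε x)
  refine ⟨(hZ.mul hF).mul (hF.log fun x => (hF0 x).ne'),
    M * M * (|Real.log ε| + |Real.log M|), fun x => ?_⟩
  rw [norm_mul, norm_mul]
  have h1 := Real.log_le_log hε (hFε x)
  have h2 := Real.log_le_log (hF0 x) (hFM x)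
  gcongr
  · exact (Real.norm_of_nonneg (hZ0 x).le).trans_le (hZM x)
  · exact (Real.norm_of_nonneg (hF0 x).le).trans_le (hFM x)
  · rw [Real.norm_eq_abs, abs_le]
    constructor <;> linarith [neg_abs_le (Real.log ε), le_abs_self (Real.log M),
      abs_nonneg (Real.log ε), abs_nonneg (Real.log M)]

/-! ### Comparison of the entropy with its initial value -/

section Slope

variable {e : Fin N → E} {dC C : ℝ → Mat N} {μ : ℝ → ℝ → Measure E} {D : ℝ → Measure E} {K : ℝ}

/-- The entropy does not exceed its initial value. -/
theorem GaussianFlow.entropy_le (H : GaussianFlow e dC C μ D K) {Z₀ F : E → ℝ}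
    (hZ : Continuous Z₀) (hF : Continuous F) {ε M : ℝ} (hZ0 : ∀ x, 0 < Z₀ x) (hZM : ∀ x, Z₀ x ≤ M)
    (hε : 0 < ε) (hFε : ∀ x, ε ≤ F x) (hFM : ∀ x, F x ≤ M) {t : ℝ} (ht : 0 ≤ t) :
    ∫ φ, avg (μ 0 t) (fun x => Z₀ x * F x) φ * logQuot (fun t => avg (μ 0 t) Z₀)
      (fun t => avg (μ 0 t) (fun x => Z₀ x * F x)) t φ ∂D t ≤
    ∫ φ, Z₀ φ * F φ * Real.log (F φ) ∂D 0 := by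
  have := H.prob 0 t
  obtain ⟨hc, c, hb⟩ := exists_mul_log_bound hZ hF hZ0 hZM hε hFε hFM
  obtain ⟨hc', c', hb'⟩ := exists_entropy_density_bound hZ hF hZ0 hZM hε hFε hFM (μ 0 t)
  rw [H.integral_D le_rfl ht hc hb]
  refine integral_mono (H.integrable_D hc' hb' t)
    (H.integrable_D (continuous_avg hc hb _) (fun x => norm_avg_le_const hb _ x) t) fun φ => ?_
  exact (mul_logQuot_le_avg hZ hF hZ0 hZM hε hFε hFM (μ 0 t) φ).1

/-- The initial slope of the entropy. -/
theorem GaussianFlow.entropy_slope (H : GaussianFlow e dC C μ D K) {Z₀ F : E → ℝ}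
    (hZ : Continuous Z₀) {ε M c : ℝ} (hF : BddC3 c F) (hs : HasCompactSupport (fderiv ℝ F))
    (hZ0 : ∀ x, 0 < Z₀ x) (hZM : ∀ x, Z₀ x ≤ M)
    (hε : 0 < ε) (hFε : ∀ x, ε ≤ F x) (hFM : ∀ x, F x ≤ M) {A : Mat N}
    (hA : ∀ η > 0, ∀ᶠ t in 𝓝[>] 0, ∀ i j, |C t i j - C 0 i j - t * A i j| ≤ η * t)
    {δ : ℝ} (hδ : 0 < δ) : ∀ᶠ t in 𝓝[>] 0, (∫ φ, Z₀ φ * F φ * Real.log (F φ) ∂D 0) -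
      (∫ φ, avg (μ 0 t) (fun x => Z₀ x * F x) φ * logQuot (fun t => avg (μ 0 t) Z₀)
      (fun t => avg (μ 0 t) (fun x => Z₀ x * F x)) t φ ∂D t) ≤
      t * ((∫ φ, Z₀ φ / (2 * F φ) *
        traceForm e A ((fderiv ℝ F φ).smulRight (fderiv ℝ F φ)) ∂D 0) + δ) := by
  have hK := H.K_nonneg
  have hM0 : 0 ≤ M := (hZ0 0).le.trans (hZM 0)
  have hF0 : ∀ x, 0 < F x := fun x => hε.trans_le (hFε x)
  have hc0 := hF.nonneg
  have hfs := frameSize_nonneg e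
  set ℓ := fderiv ℝ F with hℓ
  have hℓc : Continuous ℓ := hF.contDiff_fderiv.continuous
  set T : Mat N → E → ℝ := fun B φ => traceForm e B ((ℓ φ).smulRight (ℓ φ)) with hT
  have hTe : ∀ B φ, T B φ = ∑ i, ∑ j, B i j * (ℓ φ (e i) * ℓ φ (e j)) := fun B φ => rfl
  have hTc : ∀ B, Continuous (T B) := fun B => by
    simp_rw [funext (hTe B)]
    fun_prop
  have hTb : ∀ (B : Mat N) (b : ℝ), (∀ i j, |B i j| ≤ b) → 0 ≤ b → ∀ φ,
      |T B φ| ≤ b * frameSize e * c ^ 2 := fun B b hB hb φ => by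
    refine (abs_traceForm_le e hB _).trans ?_
    rw [ContinuousLinearMap.norm_smulRight_apply, ← pow_two]
    have := hF.norm_fderiv_le φ
    gcongr
  have hTA : ∀ B φ, T B φ ≠ 0 → φ ∈ tsupport ℓ := fun B φ h => by
    by_contra hφ
    refine h ?_
    rw [hTe, show ℓ φ = 0 from image_eq_zero_of_notMem_tsupport hφ]
    simp
  set w : E → ℝ := fun φ => Z₀ φ / (2 * F φ) with hw
  have hw0 : ∀ φ, 0 ≤ w φ := fun φ => div_nonneg (hZ0 φ).le (by linarith [hF0 φ])
  have hwb : ∀ φ, w φ ≤ M / (2 * ε) := fun φ =>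
    div_le_div₀ hM0 (hZM φ) (by positivity) (by linarith [hFε φ])
  have hwc : Continuous w := hZ.div (continuous_const.mul hF.continuous) fun φ => by
    have := hF0 φ; positivity
  set m := M / (2 * ε) * (frameSize e * c ^ 2) with hm
  have hm0 : 0 ≤ m := by positivity
  set q : E → ℝ := fun φ => w φ * T A φ with hq
  have hqc : Continuous q := hwc.mul (hTc A)
  set Mq := M / (2 * ε) * (entrySum A * frameSize e * c ^ 2) with hMq
  have hAe : ∀ i j, |A i j| ≤ entrySum A := fun i j =>
    (Finset.single_le_sum (f := fun j => |A i j|) (fun _ _ => abs_nonneg _)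
      (Finset.mem_univ j)).trans (Finset.single_le_sum (f := fun i => ∑ j, |A i j|)
        (fun _ _ => Finset.sum_nonneg fun _ _ => abs_nonneg _) (Finset.mem_univ i))
  have hqb : ∀ φ, |q φ| ≤ Mq := fun φ => by
    rw [hq, abs_mul, abs_of_nonneg (hw0 φ)]
    exact mul_le_mul (hwb φ) (hTb A _ hAe (entrySum_nonneg A) φ) (abs_nonneg _) (by positivity)
  have hqs : HasCompactSupport q := hs.mono' fun φ hφ => hTA A φ (right_ne_zero_of_mul hφ)
  -- The errors proportional to t are η from moving q back to time 0, ηm from the covariance and ηK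
  -- from the weight Z₀; together they equal tδ/2. The other half of δ absorbs the terms of higher
  -- order in t.
  set η := δ / (2 * (1 + m + K)) with hη
  have hη0 : 0 < η := by positivity
  obtain ⟨R, hR, hmod⟩ := exists_modulus_of_hasCompactSupport hqc hqs hqb hη0
  obtain ⟨A₁, hA₁, hbreg⟩ := exists_bregman_bound hZ hZ0 hZM hε hFε hF hs hη0
  have hsmall : ∀ᶠ t : ℝ in 𝓝[>] 0, R * K * t + A₁ * K * (√t + t) ≤ δ / 2 := by
    have h1 : Tendsto (fun t : ℝ => R * K * t + A₁ * K * (√t + t)) (𝓝[>] 0) (𝓝 0) := by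
      have : Continuous fun t : ℝ => R * K * t + A₁ * K * (√t + t) := by fun_prop
      have h := this.tendsto 0
      simp only [mul_zero, Real.sqrt_zero, add_zero] at h
      exact h.mono_left nhdsWithin_le_nhds
    exact (h1.eventually (Iio_mem_nhds (half_pos hδ))).mono fun t ht => ht.le
  obtain ⟨hlc, cl, hlb⟩ := exists_mul_log_bound hZ hF.continuous hZ0 hZM hε hFε hFM
  filter_upwards [hsmall, hA η hη0, eventually_mem_nhdsWithin] with t hts hAt (ht : 0 < t)
  have hprob := H.prob 0 t
  have hprobD := H.probD t
  obtain ⟨hdc, cd, hdb⟩ :=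
    exists_entropy_density_bound hZ hF.continuous hZ0 hZM hε hFε hFM (μ 0 t)
  have m2 := H.moment 0 t le_rfl ht.le 2 (by norm_num)
  have m3 := H.moment 0 t le_rfl ht.le 3 (by norm_num)
  have m4 := H.moment 0 t le_rfl ht.le 4 (by norm_num)
  have s2 : √t ^ 2 = t := Real.sq_sqrt ht.le
  have s3 : √t ^ 3 = t * √t := by rw [pow_succ, s2]
  have s4 : √t ^ 4 = t * t := by rw [show 4 = 2 * 2 from rfl, pow_mul, s2, pow_two]
  rw [sub_zero, s2] at m2
  rw [sub_zero, s3] at m3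
  rw [sub_zero, s4] at m4
  -- the defect at a fixed field
  have hpt : ∀ φ, avg (μ 0 t) (fun x => Z₀ x * F x * Real.log (F x)) φ -
      avg (μ 0 t) (fun x => Z₀ x * F x) φ * logQuot (fun t => avg (μ 0 t) Z₀)
      (fun t => avg (μ 0 t) (fun x => Z₀ x * F x)) t φ ≤
      t * q φ + t * (η * (m + K) + A₁ * K * (√t + t)) := fun φ => by
    -- Taking F φ as the reference value makes the divergence quadratic in the increment ζ.
    refine ((mul_logQuot_le_avg hZ hF.continuous hZ0 hZM hε hFε hFM (μ 0 t) φ).2 (F φ)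
      (hF0 φ)).trans ?_
    have iB : Integrable (fun ζ => (ℓ φ ζ) ^ 2) (μ 0 t) :=
      ((H.integrable 0 t 2).const_mul (‖ℓ φ‖ ^ 2)).mono'
        (aestronglyMeasurable_of_continuous (by fun_prop) _) (Eventually.of_forall fun ζ => by
          rw [norm_pow, ← mul_pow]
          exact pow_le_pow_left₀ (norm_nonneg _) ((ℓ φ).le_opNorm ζ) 2)
    have i1 := iB.const_mul (w φ)
    have i2 := (H.integrable 0 t 2).const_mul η
    have i34 : Integrable (fun ζ => ‖ζ‖ ^ 3 + ‖ζ‖ ^ 4) (μ 0 t) :=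
      (H.integrable 0 t 3).add (H.integrable 0 t 4)
    have i3 := i34.const_mul A₁
    have i12 : Integrable (fun ζ => w φ * (ℓ φ ζ) ^ 2 + η * ‖ζ‖ ^ 2) (μ 0 t) := i1.add i2
    have hmono : avg (μ 0 t) (fun x => Z₀ x * bregman (F x) (F φ)) φ ≤
        ∫ ζ, (w φ * (ℓ φ ζ) ^ 2 + η * ‖ζ‖ ^ 2 + A₁ * (‖ζ‖ ^ 3 + ‖ζ‖ ^ 4)) ∂μ 0 t := by
      refine integral_mono_of_nonneg (Eventually.of_forall fun ζ => ?_) (i12.add i3)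
        (Eventually.of_forall fun ζ => hbreg φ ζ)
      exact mul_nonneg (hZ0 _).le (bregman_nonneg (hF0 _) (hF0 φ))
    have hsec : ∫ ζ, (ℓ φ ζ) ^ 2 ∂μ 0 t = T (C t - C 0) φ := by
      refine Eq.trans ?_ (H.second 0 t le_rfl ht.le _)
      refine integral_congr_ae (Eventually.of_forall fun ζ => ?_)
      simp [pow_two]
    rw [integral_add i12 i3, integral_add i1 i2, integral_const_mul, integral_const_mul,
      integral_const_mul, integral_add (H.integrable 0 t 3) (H.integrable 0 t 4), hsec] at hmono
    refine hmono.trans ?_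
    have hTd : T (C t - C 0) φ ≤ t * T A φ + η * t * frameSize e * c ^ 2 := by
      have h1 := hTb (C t - C 0 - t • A) (η * t) (fun i j => hAt i j) (by positivity) φ
      have h2 : T (C t - C 0 - t • A) φ = T (C t - C 0) φ - t * T A φ := by
        simp only [hTe, Matrix.sub_apply, Matrix.smul_apply, smul_eq_mul, sub_mul,
          Finset.sum_sub_distrib, Finset.mul_sum, mul_assoc]
      rw [h2] at h1
      linarith [le_abs_self (T (C t - C 0) φ - t * T A φ)]
    have h1 := mul_le_mul_of_nonneg_left hTd (hw0 φ)
    have h2 : w φ * (η * t * frameSize e * c ^ 2) ≤ M / (2 * ε) * (η * t * frameSize e * c ^ 2) :=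
      mul_le_mul_of_nonneg_right (hwb φ) (by positivity)
    have h3 : M / (2 * ε) * (η * t * frameSize e * c ^ 2) = t * (η * m) := by rw [hm]; ring
    have h4 : η * (∫ ζ, ‖ζ‖ ^ 2 ∂μ 0 t) ≤ η * (K * t) := by gcongr
    have h5 : A₁ * ((∫ ζ, ‖ζ‖ ^ 3 ∂μ 0 t) + ∫ ζ, ‖ζ‖ ^ 4 ∂μ 0 t) ≤
        A₁ * (K * (t * √t) + K * (t * t)) := by gcongr
    have h6 : t * q φ = w φ * (t * T A φ) := by rw [hq]; ring
    rw [h6]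
    linarith
  -- integration over the field
  have hqn : ∀ φ, ‖q φ‖ ≤ Mq := hqb
  -- `D 0` is `D t` convolved with the increment, so the two integrals of q differ by an averaging
  -- defect, bounded by the modulus of the compactly supported q.
  have hq0 : ∫ φ, q φ ∂D t ≤ (∫ φ, q φ ∂D 0) + (η + R * K * t) := by
    rw [H.integral_D le_rfl ht.le hqc hqn]
    have h1 : ∀ φ, q φ ≤ avg (μ 0 t) q φ + (η + R * K * t) := fun φ => by
      have h2 : q φ - avg (μ 0 t) q φ = ∫ ζ, (q φ - q (φ + ζ)) ∂μ 0 t := by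
        rw [integral_sub (integrable_const _) (integrable_shift hqc hqn _ φ)]
        simp [avg]
      have h3 : ∫ ζ, (q φ - q (φ + ζ)) ∂μ 0 t ≤ ∫ ζ, (η + R * ‖ζ‖ ^ 2) ∂μ 0 t := by
        refine integral_mono ((integrable_const _).sub (integrable_shift hqc hqn _ φ))
          ((integrable_const _).add ((H.integrable 0 t 2).const_mul R)) fun ζ => ?_
        have := hmod φ ζ
        rw [abs_sub_comm] at this
        exact (le_abs_self _).trans this
      rw [integral_add (integrable_const _) ((H.integrable 0 t 2).const_mul R),
        integral_const_mul] at h3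
      simp only [integral_const, probReal_univ, one_smul] at h3
      have h4 : R * (∫ ζ, ‖ζ‖ ^ 2 ∂μ 0 t) ≤ R * (K * t) := by gcongr
      linarith
    have hav : Integrable (avg (μ 0 t) q) (D t) :=
      H.integrable_D (continuous_avg hqc hqn _) (fun x => norm_avg_le_const hqn _ x) t
    refine (integral_mono (H.integrable_D hqc hqn t) (hav.add (integrable_const _)) h1).trans ?_
    refine (integral_add hav (integrable_const _)).trans_le ?_
    simp
  have hil := H.integrable_D (continuous_avg hlc hlb (μ 0 t))
    (fun x => norm_avg_le_const hlb (μ 0 t) x) t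
  have hid := H.integrable_D hdc hdb t
  rw [H.integral_D le_rfl ht.le hlc hlb]
  have hfin := integral_mono (hil.sub hid) (((H.integrable_D hqc hqn t).const_mul t).add
    (integrable_const (t * (η * (m + K) + A₁ * K * (√t + t))))) hpt
  have e1 := integral_sub hil hid
  have e2 := integral_add ((H.integrable_D hqc hqn t).const_mul t)
    (integrable_const (μ := D t) (t * (η * (m + K) + A₁ * K * (√t + t))))
  rw [integral_const_mul] at e2
  simp only [integral_const, probReal_univ, one_smul] at e2
  have hkey := (e1.symm.trans_le hfin).trans e2.le
  refine le_trans hkey ?_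
  have hηm : η * (1 + m + K) = δ / 2 := by
    rw [hη]; field_simp
  have h7 := mul_le_mul_of_nonneg_left hq0 ht.le
  have h8 := mul_le_mul_of_nonneg_left hts ht.le
  have h9 : t * (η * (1 + m + K)) = t * (δ / 2) := by rw [hηm]
  change _ ≤ t * ((∫ φ, q φ ∂D 0) + δ)
  linarith

end Slope

end SmallTime

/-! ### The clock Λ(t) = ∫_0^t e^{-2λ_s} ds -/

section Clock

variable {dlam lam : ℝ → ℝ} (hdlam : ∀ t, 0 ≤ t → IntervalIntegrable dlam volume 0 t)
  (hlam : ∀ t, 0 ≤ t → lam t = ∫ s in (0 : ℝ)..t, dlam s)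
include hdlam hlam

theorem continuousOn_primitive : ContinuousOn lam (Ici 0) := by
  intro t (ht : 0 ≤ t)
  have h := intervalIntegral.continuousOn_primitive_interval' (hdlam (t + 1) (by linarith))
    left_mem_uIcc
  rw [uIcc_of_le (by linarith : (0 : ℝ) ≤ t + 1)] at h
  have h1 : ContinuousWithinAt lam (Icc 0 (t + 1)) t :=
    (h t ⟨ht, by linarith⟩).congr (fun s hs => hlam s hs.1) (hlam t ht)
  refine h1.mono_of_mem_nhdsWithin ?_
  filter_upwards [self_mem_nhdsWithin, mem_nhdsWithin_of_mem_nhds (Iio_mem_nhds (lt_add_one t))]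
    with s hs hs' using ⟨hs, hs'.le⟩

theorem primitive_sub {s t : ℝ} (hs : 0 ≤ s) (hst : s ≤ t) :
    lam t - lam s = ∫ r in s..t, dlam r := by
  rw [hlam t (hs.trans hst), hlam s hs]
  exact intervalIntegral.integral_interval_sub_left (hdlam t (hs.trans hst)) (hdlam s hs)

theorem hasDerivAt_clock (hint : IntegrableOn (fun t => Real.exp (-2 * lam t)) (Ioi 0)) {t : ℝ}
    (ht : 0 < t) : HasDerivAt (fun u => ∫ s in (0 : ℝ)..u, Real.exp (-2 * lam s))
      (Real.exp (-2 * lam t)) t := by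
  have hc : ContinuousAt lam t :=
    (continuousOn_primitive hdlam hlam).continuousAt (Ici_mem_nhds ht)
  refine intervalIntegral.integral_hasDerivAt_right ?_
    ⟨Ioi 0, Ioi_mem_nhds ht, hint.aestronglyMeasurable⟩ (by fun_prop)
  rw [intervalIntegrable_iff_integrableOn_Ioc_of_le ht.le]
  exact hint.mono_set Ioc_subset_Ioi_self

theorem tendsto_clock_div (hint : IntegrableOn (fun t => Real.exp (-2 * lam t)) (Ioi 0)) :
    Tendsto (fun t => (∫ s in (0 : ℝ)..t, Real.exp (-2 * lam s)) / t) (𝓝[>] 0) (𝓝 1) := by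
  have h0 : lam 0 = 0 := by simpa using hlam 0 le_rfl
  have hc : ContinuousWithinAt lam (Ioi 0) 0 :=
    ((continuousOn_primitive hdlam hlam) 0 self_mem_Ici).mono Ioi_subset_Ici_self
  have h := intervalIntegral.integral_hasDerivWithinAt_right (a := 0) (b := 0) (s := Ici 0)
    (t := Ioi 0) (f := fun t => Real.exp (-2 * lam t)) (by simp)
    ⟨Ioi 0, self_mem_nhdsWithin, hint.aestronglyMeasurable⟩
    ((hc.const_mul (-2)).rexp)
  have h2 := (hasDerivWithinAt_iff_tendsto_slope' (by simp)).1 (h.mono Ioi_subset_Ici_self)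
  simp only [h0, mul_zero, Real.exp_zero] at h2
  refine h2.congr fun t => ?_
  simp [slope_def_field]

end Clock

/-! ### A bounded smooth substitute for x log x -/

section CutOff

/-- A bounded smooth function which agrees with `x log x` on `[ε, M]`. -/
theorem exists_smooth_mul_log {ε M : ℝ} (hε : 0 < ε) (hM : ε ≤ M) :
    ∃ g : ℝ → ℝ, ContDiff ℝ ∞ g ∧ (∃ K, ∀ x, |g x| ≤ K) ∧
      ∀ x ∈ Icc ε M, g x = x * Real.log x := by
  -- The bump equals 1 on [3ε/4, M + ε/4] and vanishes outside (ε/2, M + ε/2), hence near 0, where x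
  -- log x is not smooth.
  let χ : ContDiffBump ((ε + M) / 2) :=
    { rIn := (M - ε) / 2 + ε / 4
      rOut := (M - ε) / 2 + ε / 2
      rIn_pos := by linarith
      rIn_lt_rOut := by linarith }
  set g : ℝ → ℝ := fun x => χ x * (x * Real.log x) with hg
  have hzero : ∀ x, x ≤ ε / 2 → χ x = 0 := fun x hx => by
    refine χ.zero_of_le_dist ?_
    rw [Real.dist_eq, abs_sub_comm]
    refine le_trans ?_ (le_abs_self _)
    change (M - ε) / 2 + ε / 2 ≤ _
    linarith
  have hsm : ContDiff ℝ ∞ g := contDiff_iff_contDiffAt.2 fun x => by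
    rcases lt_or_ge 0 x with hx | hx
    · exact χ.contDiff.contDiffAt.mul (contDiffAt_id.mul (contDiffAt_id.log hx.ne'))
    · refine (contDiffAt_const (c := (0 : ℝ))).congr_of_eventuallyEq ?_
      filter_upwards [Iio_mem_nhds (show x < ε / 2 by linarith)] with y hy
      rw [hg]
      simp only [hzero y (le_of_lt hy), zero_mul]
  refine ⟨g, hsm, ?_, fun x hx => ?_⟩
  · have hcs : HasCompactSupport g := χ.hasCompactSupport.mul_right
    obtain ⟨K, hK⟩ := hcs.exists_bound_of_continuous hsm.continuous
    exact ⟨K, hK⟩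
  · have : χ x = 1 := χ.one_of_mem_closedBall (by
      rw [Metric.mem_closedBall, Real.dist_eq, abs_le]
      change -((M - ε) / 2 + ε / 4) ≤ _ ∧ _ ≤ (M - ε) / 2 + ε / 4
      constructor <;> linarith [hx.1, hx.2])
    simp [hg, this]

end CutOff

/-! ### Identification with the renormalised measures and the limit t → ∞ -/

section Identification

variable {N : ℕ} {dC : ℝ → Mat N}

/-- The second moment vanishes for covariance zero, so ζ = 0 almost surely; no regularity of f is
needed. -/
theorem integral_gaussian_zero {f : fieldSpace dC → ℝ} : ∫ ζ, f ζ ∂gaussian dC 0 = f 0 := by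
  have h := integral_norm_pow_gaussian_le dC (Matrix.PosSemidef.zero (n := Fin N) (R := ℝ)) 2
  have h0 : entrySum (0 : Mat N) = 0 := by simp [entrySum]
  rw [h0, Real.sqrt_zero, zero_pow two_ne_zero, zero_mul] at h
  have h1 : ∫ ζ, ‖ζ‖ ^ 2 ∂gaussian dC 0 = 0 := le_antisymm h (integral_nonneg fun _ => by positivity)
  rw [integral_eq_zero_iff_of_nonneg (fun _ => by positivity)
    (integrable_norm_pow_gaussian dC 0 2)] at h1
  have h2 : (fun ζ => f ζ) =ᵐ[gaussian dC 0] fun _ => f 0 := by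
    filter_upwards [h1] with ζ hζ
    have : ζ = 0 := by simpa using hζ
    rw [this]
  rw [integral_congr_ae h2]
  simp

theorem exp_neg_renormPotential {V₀ : fieldSpace dC → ℝ} (hV₀ : Continuous V₀) {M : ℝ}
    (hM : ∀ x, Real.exp (-V₀ x) ≤ M) (t : ℝ) (φ : fieldSpace dC) :
    Real.exp (-renormPotential dC V₀ t φ) = evolve dC (fun x => Real.exp (-V₀ x)) t φ := by
  rw [renormPotential_eq, neg_neg, Real.exp_log]
  exact avg_pos (by fun_prop) (fun _ => Real.exp_pos _) hM _ φ

theorem evolve_zero (f : fieldSpace dC → ℝ) : evolve dC f 0 = f := by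
  funext φ
  rw [evolve, sub_self, avg, integral_gaussian_zero, add_zero]

/-- Since C_0 = 0, the renormalised potential at time 0 is V_0. Thus P_{0,t}F is the quotient
G_t/Z_t, whose logarithm is w. -/
theorem semigroup_zero_eq {V₀ : fieldSpace dC → ℝ} (hV₀ : Continuous V₀) {M : ℝ}
    (hM : ∀ x, Real.exp (-V₀ x) ≤ M) (F : fieldSpace dC → ℝ) (t : ℝ) (φ : fieldSpace dC) :
    semigroup dC V₀ 0 t F φ = evolve dC (fun x => Real.exp (-V₀ x) * F x) t φ /
      evolve dC (fun x => Real.exp (-V₀ x)) t φ := by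
  simp only [semigroup, exp_neg_renormPotential hV₀ hM, evolve_zero]
  rw [← exp_neg_renormPotential hV₀ hM, Real.exp_neg, div_inv_eq_mul, mul_comm]
  rfl

theorem integral_renormMeasure {V₀ : fieldSpace dC → ℝ} (hV₀ : Continuous V₀) {M : ℝ}
    (hM : ∀ x, Real.exp (-V₀ x) ≤ M) (f : fieldSpace dC → ℝ) (t : ℝ) :
    ∫ φ, f φ ∂renormMeasure dC V₀ t = (∫ ζ, Real.exp (-V₀ ζ) ∂gaussian dC (covInf dC))⁻¹ *
      ∫ φ, evolve dC (fun x => Real.exp (-V₀ x)) t φ * f φ ∂gaussian dC (covInf dC - cov dC t) := by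
  have hpos : 0 < ∫ ζ, Real.exp (-V₀ ζ) ∂gaussian dC (covInf dC) := by
    have := avg_pos (f := fun x => Real.exp (-V₀ x)) (by fun_prop) (fun _ => Real.exp_pos _) hM
      (gaussian dC (covInf dC)) 0
    simpa [avg] using this
  have hinf : Real.exp (renormPotentialInf dC V₀ 0) =
      (∫ ζ, Real.exp (-V₀ ζ) ∂gaussian dC (covInf dC))⁻¹ := by
    simp only [renormPotentialInf, renormPotentialCov, zero_add]
    rw [Real.exp_neg, Real.exp_log hpos]
  have hc : Continuous (evolve dC (fun x => Real.exp (-V₀ x)) t) :=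
    continuous_avg (f := fun x => Real.exp (-V₀ x)) (by fun_prop) (M := M)
      (fun x => (Real.norm_of_nonneg (Real.exp_pos _).le).trans_le (hM x)) _
  simp only [renormMeasure, exp_neg_renormPotential hV₀ hM, hinf]
  rw [integral_withDensity_eq_integral_toReal_smul
    (by exact (ENNReal.continuous_ofReal.comp (continuous_const.mul hc)).measurable)
    (Eventually.of_forall fun x => ENNReal.ofReal_lt_top), ← integral_const_mul]
  refine integral_congr_ae (Eventually.of_forall fun φ => ?_)
  have h1 : 0 ≤ evolve dC (fun x => Real.exp (-V₀ x)) t φ :=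
    integral_nonneg fun _ => (Real.exp_pos _).le
  simp only [smul_eq_mul]
  rw [ENNReal.toReal_ofReal (mul_nonneg (inv_nonneg.2 hpos.le) h1)]
  ring

theorem integral_initialMeasure (V₀ : fieldSpace dC → ℝ) (f : fieldSpace dC → ℝ) :
    ∫ φ, f φ ∂initialMeasure dC V₀ = (∫ ζ, Real.exp (-V₀ ζ) ∂gaussian dC (covInf dC))⁻¹ *
      ∫ φ, Real.exp (-V₀ φ) * f φ ∂gaussian dC (covInf dC) := by
  rw [initialMeasure, integral_tilted, ← integral_const_mul]
  refine integral_congr_ae (Eventually.of_forall fun φ => ?_)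
  simp only [smul_eq_mul]
  ring

/-- The limit of the entropy along the flow. -/
theorem tendsto_flowEntropy {V₀ : fieldSpace dC → ℝ} (hV₀ : Continuous V₀) {M : ℝ}
    (hM : ∀ x, Real.exp (-V₀ x) ≤ M) (hcont : ContinuityAssumption dC V₀)
    {F : fieldSpace dC → ℝ} (hF : ContDiff ℝ ∞ F) {ε : ℝ} (hε : 0 < ε) (hFε : ∀ x, ε ≤ F x)
    (hFM : ∀ x, F x ≤ M) :
    Tendsto (flowEntropy dC (fun x => Real.exp (-V₀ x)) (fun x => Real.exp (-V₀ x) * F x)) atTop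
      (𝓝 ((∫ ζ, Real.exp (-V₀ ζ) ∂gaussian dC (covInf dC)) *
        ((∫ φ, F φ ∂initialMeasure dC V₀) * Real.log (∫ φ, F φ ∂initialMeasure dC V₀)))) := by
  have hM0 : 0 ≤ M := (Real.exp_pos _).le.trans (hM 0)
  have hF0 : ∀ x, 0 < F x := fun x => hε.trans_le (hFε x)
  have hFc := hF.continuous
  obtain ⟨g, hg, hgb, hgeq⟩ := exists_smooth_mul_log hε ((hFε 0).trans (hFM 0))
  have hpos : 0 < ∫ ζ, Real.exp (-V₀ ζ) ∂gaussian dC (covInf dC) := by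
    have := avg_pos (f := fun x => Real.exp (-V₀ x)) (by fun_prop) (fun _ => Real.exp_pos _) hM
      (gaussian dC (covInf dC)) 0
    simpa [avg] using this
  have hZn : ∀ x, ‖Real.exp (-V₀ x)‖ ≤ M := fun x =>
    (Real.norm_of_nonneg (Real.exp_pos _).le).trans_le (hM x)
  have hGn : ∀ x, ‖Real.exp (-V₀ x) * F x‖ ≤ M * M := fun x => by
    rw [norm_mul]
    exact mul_le_mul (hZn x) ((Real.norm_of_nonneg (hF0 x).le).trans_le (hFM x)) (norm_nonneg _) hM0
  have hlim := (hcont F g hF ⟨M, fun φ => (abs_of_pos (hF0 φ)).trans_le (hFM φ)⟩ hg hgb).const_mul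
    (∫ ζ, Real.exp (-V₀ ζ) ∂gaussian dC (covInf dC))
  -- The quotient is a weighted average of F and so stays in [ε, M], where the cut-off g agrees with
  -- x log x. This holds both along the flow and for the limit E_{ν_0}[F].
  have hmem : ∀ (μ : Measure (fieldSpace dC)) [IsProbabilityMeasure μ] φ,
      avg μ (fun x => Real.exp (-V₀ x) * F x) φ / avg μ (fun x => Real.exp (-V₀ x)) φ ∈ Icc ε M :=
    fun μ _ φ => by
      have hz := avg_pos (f := fun x => Real.exp (-V₀ x)) (by fun_prop) (fun _ => Real.exp_pos _)
        hM μ φ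
      constructor
      · rw [le_div_iff₀ hz, ← avg_const_mul]
        refine avg_mono (M := ε * M) (by fun_prop) (by fun_prop) (fun x => ?_) hGn (fun x => ?_) μ φ
        · rw [norm_mul, Real.norm_of_nonneg hε.le]
          exact mul_le_mul_of_nonneg_left (hZn x) hε.le
        · nlinarith [hFε x, Real.exp_pos (-V₀ x)]
      · rw [div_le_iff₀ hz, ← avg_const_mul]
        refine avg_mono (M' := M * M) (by fun_prop) (by fun_prop) hGn (fun x => ?_) (fun x => ?_) μ φ
        · rw [norm_mul, Real.norm_of_nonneg hM0]
          exact mul_le_mul_of_nonneg_left (hZn x) hM0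
        · nlinarith [hFM x, Real.exp_pos (-V₀ x)]
  have hm : ∫ φ, F φ ∂initialMeasure dC V₀ ∈ Icc ε M := by
    rw [integral_initialMeasure]
    have := hmem (gaussian dC (covInf dC)) 0
    simp only [avg, zero_add] at this
    rwa [div_eq_inv_mul] at this
  rw [hgeq _ hm] at hlim
  refine hlim.congr fun t => ?_
  rw [integral_renormMeasure hV₀ hM, mul_inv_cancel_left₀ hpos.ne', flowEntropy]
  refine integral_congr_ae (Eventually.of_forall fun φ => ?_)
  have hz : 0 < evolve dC (fun x => Real.exp (-V₀ x)) t φ :=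
    avg_pos (by fun_prop) (fun _ => Real.exp_pos _) hM _ φ
  have hq : evolve dC (fun x => Real.exp (-V₀ x) * F x) t φ /
      evolve dC (fun x => Real.exp (-V₀ x)) t φ ∈ Icc ε M :=
    hmem (gaussian dC (cov dC t - cov dC 0)) φ
  have hg0 : 0 < evolve dC (fun x => Real.exp (-V₀ x) * F x) t φ := by
    have := hε.trans_le hq.1
    exact (div_pos_iff_of_pos_right hz).1 this
  simp only [semigroup_zero_eq hV₀ hM]
  rw [hgeq _ hq, logQuot, Real.log_div hg0.ne' hz.ne']
  field_simp

end Identification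

/-! ### Derivatives of square roots of nonnegative functions -/

section SquareRoot

variable {E : Type} [NormedAddCommGroup E] [NormedSpace ℝ E]

/-- Compactly supported smooth functions, shifted by a constant, are bounded in `C³`. -/
theorem exists_bddC3_add_const {f : E → ℝ} (hf : ContDiff ℝ ∞ f) (hs : HasCompactSupport f)
    (a : ℝ) : ∃ c, BddC3 c fun x => f x + a := by
  have hb : ∀ j ∈ Finset.range 4, ∃ c, ∀ x, ‖iteratedFDeriv ℝ j f x‖ ≤ c := fun j _ =>
    (hs.iteratedFDeriv j).exists_bound_of_continuous
      (hf.continuous_iteratedFDeriv (by exact_mod_cast le_top))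
  choose! c hc using hb
  have hle : ∀ j ∈ Finset.range 4, c j ≤ ∑ i ∈ Finset.range 4, c i := fun j hj =>
    Finset.single_le_sum (fun i hi => (norm_nonneg _).trans (hc i hi 0)) hj
  have h3 : ContDiff ℝ 3 f := hf.of_le (by norm_cast)
  refine ⟨∑ i ∈ Finset.range 4, c i + |a|, h3.add contDiff_const, fun j hj x => ?_⟩
  have hj' : j ∈ Finset.range 4 := Finset.mem_range.2 (by omega)
  rcases Nat.eq_zero_or_pos j with rfl | hj0
  · rw [norm_iteratedFDeriv_zero]
    have := (hc 0 hj' x).trans (hle 0 hj')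
    rw [norm_iteratedFDeriv_zero] at this
    exact (norm_add_le _ _).trans (add_le_add this le_rfl)
  · have : iteratedFDeriv ℝ j (fun x => f x + a) x = iteratedFDeriv ℝ j f x := by
      have hj3 : ContDiff ℝ j f := h3.of_le (by exact_mod_cast hj)
      rw [fun_iteratedFDeriv_add_apply hj3.contDiffAt contDiffAt_const,
        iteratedFDeriv_const_of_ne hj0.ne', Pi.zero_apply, add_zero]
    rw [this]
    exact ((hc j hj' x).trans (hle j hj')).trans (le_add_of_nonneg_right (abs_nonneg a))

theorem fderiv_eq_zero_of_nonneg {f : E → ℝ} (h0 : ∀ x, 0 ≤ f x) {x : E} (hx : f x = 0) :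
    fderiv ℝ f x = 0 :=
  IsLocalMin.fderiv_eq_zero (Eventually.of_forall fun y => hx.le.trans (h0 y))

/-- Away from zeros this is the chain rule. At a zero both f and √f are minimal, so both derivatives
are zero, for √f possibly through the convention at points of non-differentiability. -/
theorem fderiv_sqrt_eq {f : E → ℝ} (hf : Differentiable ℝ f) (h0 : ∀ x, 0 ≤ f x) (x : E) :
    fderiv ℝ (fun y => √(f y)) x = (1 / (2 * √(f x))) • fderiv ℝ f x := by
  rcases (h0 x).eq_or_lt with hx | hx
  · rw [fderiv_eq_zero_of_nonneg h0 hx.symm, smul_zero]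
    exact fderiv_eq_zero_of_nonneg (fun y => Real.sqrt_nonneg _) (by rw [← hx, Real.sqrt_zero])
  · exact ((hf x).hasFDerivAt.sqrt hx.ne').fderiv

/-- The square root of a nonnegative function with bounded second derivative is Lipschitz. -/
theorem norm_fderiv_sqrt_le {f : E → ℝ} (hf : ContDiff ℝ 2 f) (h0 : ∀ x, 0 ≤ f x) {c : ℝ}
    (hc : ∀ x, ‖fderiv ℝ (fderiv ℝ f) x‖ ≤ c) (x : E) :
    ‖fderiv ℝ (fun y => √(f y)) x‖ ≤ √c := by
  have hc0 : 0 ≤ c := (norm_nonneg _).trans (hc x)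
  refine ContinuousLinearMap.opNorm_le_bound _ (Real.sqrt_nonneg c) fun v => ?_
  rw [fderiv_sqrt_eq (hf.differentiable (by norm_num)) h0, smul_apply, smul_eq_mul,
    Real.norm_eq_abs]
  -- By Taylor, f(x) + s f'(x)v + c s²‖v‖² ≥ f(x + sv) ≥ 0 for all s, so the discriminant is
  -- nonpositive and (f'(x)v)² ≤ 4c f(x)‖v‖².
  have hd : discrim (c * ‖v‖ ^ 2) (fderiv ℝ f x v) (f x) ≤ 0 := discrim_le_zero fun s => by
    have h1 := norm_fderiv_add_sub_le hf hc x (s • v)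
    rw [Real.norm_eq_abs, map_smul, smul_eq_mul, norm_smul, mul_pow, Real.norm_eq_abs, sq_abs] at h1
    have h2 := (abs_le.1 h1).2
    nlinarith [h0 (x + s • v)]
  rw [discrim] at hd
  rcases (h0 x).eq_or_lt with hx | hx
  · rw [← hx]
    simp only [Real.sqrt_zero, mul_zero, div_zero, zero_mul, abs_zero]
    positivity
  · refine abs_le_of_sq_le_sq ?_ (by positivity)
    rw [mul_pow, mul_pow, div_pow, mul_pow, Real.sq_sqrt hx.le, Real.sq_sqrt hc0,
      div_mul_eq_mul_div, div_le_iff₀ (by positivity)]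
    nlinarith

end SquareRoot

/-! ### The log-Sobolev inequality -/

section Criterion

variable {N : ℕ} {dC : ℝ → Mat N}

theorem quadForm_gradient (Q : Mat N) (f : fieldSpace dC → ℝ) (φ : fieldSpace dC) :
    quadForm Q ((gradient f φ : fieldSpace dC) : Vec N) =
      traceForm (frame dC) Q ((fderiv ℝ f φ).smulRight (fderiv ℝ f φ)) := by
  have hℓ : ∀ i, fderiv ℝ f φ (frame dC i) = ((gradient f φ : fieldSpace dC) : Vec N) i := fun i => by
    rw [← inner_frame, real_inner_comm, gradient, InnerProductSpace.toDual_symm_apply]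
  simp only [quadForm, traceForm, ContinuousLinearMap.smulRight_apply, smul_apply, smul_eq_mul, hℓ,
    mul_assoc]

theorem quadForm_smul_right (Q : Mat N) (r : ℝ) (u : Vec N) :
    quadForm Q (r • u) = r ^ 2 * quadForm Q u := by
  simp only [quadForm, PiLp.smul_apply, smul_eq_mul, Finset.mul_sum]
  exact Finset.sum_congr rfl fun i _ => Finset.sum_congr rfl fun j _ => by ring

theorem quadForm_gradient_eq (Q : Mat N) {f : fieldSpace dC → ℝ} (hf : Differentiable ℝ f)
    (h0 : ∀ x, 0 ≤ f x) (φ : fieldSpace dC) :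
    quadForm Q ((gradient f φ : fieldSpace dC) : Vec N) =
      4 * f φ * quadForm Q ((gradient (fun ψ => √(f ψ)) φ : fieldSpace dC) : Vec N) := by
  have hs : gradient (fun ψ => √(f ψ)) φ = (1 / (2 * √(f φ))) • gradient f φ := by
    rw [gradient, fderiv_sqrt_eq hf h0, map_smul, gradient]
  rw [hs, Submodule.coe_smul, quadForm_smul_right]
  rcases (h0 φ).eq_or_lt with hx | hx
  · rw [gradient, fderiv_eq_zero_of_nonneg h0 hx.symm]
    simp [quadForm]
  · rw [div_pow, mul_pow, Real.sq_sqrt hx.le]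
    field_simp
    norm_num

theorem measurable_quadForm_gradient (Q : Mat N) (f : fieldSpace dC → ℝ) :
    Measurable fun φ => quadForm Q ((gradient f φ : fieldSpace dC) : Vec N) := by
  simp only [quadForm_gradient, traceForm, ContinuousLinearMap.smulRight_apply, smul_apply,
    smul_eq_mul]
  exact Finset.measurable_fun_sum _ fun i _ => Finset.measurable_fun_sum _ fun j _ =>
    ((measurable_fderiv_apply_const ℝ f _).mul (measurable_fderiv_apply_const ℝ f _)).const_mul _

theorem exists_quadForm_gradient_sqrt_le (Q : Mat N) {f : fieldSpace dC → ℝ}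
    (hf : ContDiff ℝ ∞ f) (hs : HasCompactSupport f) (h0 : ∀ x, 0 ≤ f x) :
    ∃ K, ∀ φ, ‖quadForm Q ((gradient (fun ψ => √(f ψ)) φ : fieldSpace dC) : Vec N)‖ ≤ K := by
  obtain ⟨c, hc⟩ := exists_bddC3_add_const hf hs 0
  simp only [add_zero] at hc
  have ha : ∀ i j, |Q i j| ≤ ∑ i, ∑ j, |Q i j| := fun i j =>
    (Finset.single_le_sum (f := fun j => |Q i j|) (fun _ _ => abs_nonneg _)
      (Finset.mem_univ j)).trans
    (Finset.single_le_sum (f := fun i => ∑ j, |Q i j|)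
      (fun _ _ => Finset.sum_nonneg fun _ _ => abs_nonneg _) (Finset.mem_univ i))
  refine ⟨(∑ i, ∑ j, |Q i j|) * frameSize (frame dC) * (√c * √c), fun φ => ?_⟩
  rw [quadForm_gradient, Real.norm_eq_abs]
  refine (abs_traceForm_le _ ha _).trans (mul_le_mul_of_nonneg_left ?_ ?_)
  · rw [ContinuousLinearMap.norm_smulRight_apply]
    have := norm_fderiv_sqrt_le (hc.1.of_le (by norm_num)) h0 hc.norm_fderiv_fderiv_le φ
    gcongr
  · exact mul_nonneg (Finset.sum_nonneg fun _ _ => Finset.sum_nonneg fun _ _ => abs_nonneg _)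
      (frameSize_nonneg _)

theorem isProbabilityMeasure_initialMeasure {V₀ : fieldSpace dC → ℝ} (hV₀ : Continuous V₀) {M : ℝ}
    (hM : ∀ x, Real.exp (-V₀ x) ≤ M) : IsProbabilityMeasure (initialMeasure dC V₀) :=
  isProbabilityMeasure_tilted (Integrable.of_bound (by fun_prop) M (Eventually.of_forall fun x =>
    (Real.norm_of_nonneg (Real.exp_pos _).le).trans_le (hM x)))

/-- Entropy is continuous under adding a small constant. -/
theorem tendsto_entropy_add_const {α : Type} [MeasurableSpace α] (ν : Measure α)
    [IsProbabilityMeasure ν] {f : α → ℝ} (hf : AEStronglyMeasurable f ν) {K : ℝ}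
    (hK : ∀ x, ‖f x‖ ≤ K) :
    Tendsto (fun ε => entropy ν fun x => f x + ε) (𝓝[>] 0) (𝓝 (entropy ν f)) := by
  have hfi : Integrable f ν := Integrable.of_bound hf K (Eventually.of_forall hK)
  have hε : Tendsto (fun ε : ℝ => ε) (𝓝[>] 0) (𝓝 0) := tendsto_nhdsWithin_of_tendsto_nhds tendsto_id
  have h1 : Tendsto (fun ε => ∫ x, f x + ε ∂ν) (𝓝[>] 0) (𝓝 (∫ x, f x ∂ν)) := by
    have : ∀ ε, ∫ x, f x + ε ∂ν = (∫ x, f x ∂ν) + ε := fun ε => by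
      rw [integral_add hfi (integrable_const ε)]
      simp
    simp only [this]
    simpa using hε.const_add (∫ x, f x ∂ν)
  obtain ⟨B, hB⟩ := (isCompact_Icc (a := -(K + 1)) (b := K + 1)).exists_bound_of_continuousOn
    Real.continuous_mul_log.continuousOn
  refine Tendsto.sub ?_ ((Real.continuous_mul_log.tendsto _).comp h1)
  refine tendsto_integral_filter_of_dominated_convergence (fun _ => B)
    (Eventually.of_forall fun ε => ?_) ?_ (integrable_const _) (Eventually.of_forall fun x => ?_)
  · exact Real.continuous_mul_log.comp_aestronglyMeasurable (hf.add aestronglyMeasurable_const)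
  · filter_upwards [self_mem_nhdsWithin, mem_nhdsWithin_of_mem_nhds (Iio_mem_nhds one_pos)]
      with ε (h0 : 0 < ε) (h1 : ε < 1)
    refine Eventually.of_forall fun x => hB _ ?_
    have := abs_le.1 (hK x)
    constructor <;> linarith
  · have : Tendsto (fun ε : ℝ => f x + ε) (𝓝[>] 0) (𝓝 (f x)) := by
      simpa using hε.const_add (f x)
    exact (Real.continuous_mul_log.tendsto _).comp this

variable (hC : IsDifferentiableCovDecomposition dC)
include hC

/-- Right continuity of Ċ at 0, integrated over [0, t]. -/
theorem eventually_abs_cov_sub_le {η : ℝ} (hη : 0 < η) : ∀ᶠ t in 𝓝[>] 0, ∀ i j,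
    |cov dC t i j - cov dC 0 i j - t * dC 0 i j| ≤ η * t := by
  refine eventually_all.2 fun i => eventually_all.2 fun j => ?_
  obtain ⟨δ, hδ, h⟩ := Metric.continuousWithinAt_iff.1 (hC.right_continuous_zero i j) η hη
  filter_upwards [self_mem_nhdsWithin, mem_nhdsWithin_of_mem_nhds (Iio_mem_nhds hδ)]
    with t (ht : 0 < t) (htδ : t < δ)
  have hi := hC.intervalIntegrable le_rfl ht.le i j
  have h1 : cov dC t i j - cov dC 0 i j - t * dC 0 i j =
      ∫ s in (0 : ℝ)..t, (dC s i j - dC 0 i j) := by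
    rw [intervalIntegral.integral_sub hi (by simp), cov_zero]
    simp [cov]
  rw [h1, ← Real.norm_eq_abs]
  refine (intervalIntegral.norm_integral_le_of_norm_le_const (C := η) fun s hs => ?_).trans_eq ?_
  · rw [uIoc_of_le ht.le] at hs
    have := h (x := s) hs.1.le (by rw [Real.dist_eq, sub_zero, abs_of_pos hs.1]; linarith [hs.2])
    exact this.le
  · rw [sub_zero, abs_of_pos ht]

/-- The log-Sobolev inequality for functions bounded away from zero. -/
theorem entropy_le_of_pos {V₀ : fieldSpace dC → ℝ} (hV₀ : Continuous V₀) {M : ℝ}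
    (hM : ∀ x, Real.exp (-V₀ x) ≤ M) (hcont : ContinuityAssumption dC V₀) {dlam lam : ℝ → ℝ}
    (hdlam : ∀ t, 0 ≤ t → IntervalIntegrable dlam volume 0 t)
    (hcrit : MultiscaleCriterion dC V₀ dlam)
    (hlam : ∀ t, 0 ≤ t → lam t = ∫ s in (0 : ℝ)..t, dlam s)
    (hint : IntegrableOn (fun t => Real.exp (-2 * lam t)) (Ioi 0))
    {F : fieldSpace dC → ℝ} (hF : ContDiff ℝ ∞ F) {c : ℝ} (hF3 : BddC3 c F)
    (hs : HasCompactSupport (fderiv ℝ F)) {ε : ℝ} (hε : 0 < ε) (hFε : ∀ x, ε ≤ F x) :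
    entropy (initialMeasure dC V₀) F ≤ (∫ t in Ioi (0 : ℝ), Real.exp (-2 * lam t)) *
      ∫ φ, quadForm (dC 0) ((gradient F φ : fieldSpace dC) : Vec N) / (2 * F φ) ∂initialMeasure dC V₀ := by
  obtain ⟨K, H⟩ := hC.exists_gaussianFlow
  have hFc := hF.continuous
  set M' := max M c with hM'
  have hM2 : ∀ x, Real.exp (-V₀ x) ≤ M' := fun x => (hM x).trans (le_max_left _ _)
  have hFM : ∀ x, F x ≤ M' := fun x =>
    ((le_abs_self _).trans (hF3.norm_le x)).trans (le_max_right _ _)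
  have hZ : Continuous fun x => Real.exp (-V₀ x) := by fun_prop
  have hG : Continuous fun x => Real.exp (-V₀ x) * F x := by fun_prop
  have hG0 : ∀ x, ε * Real.exp (-V₀ x) ≤ Real.exp (-V₀ x) * F x := fun x => by
    rw [mul_comm]; exact mul_le_mul_of_nonneg_left (hFε x) (Real.exp_pos _).le
  have hGM : ∀ x, Real.exp (-V₀ x) * F x ≤ M' * Real.exp (-V₀ x) := fun x => by
    rw [mul_comm M']; exact mul_le_mul_of_nonneg_left (hFM x) (Real.exp_pos _).le
  -- After division by the total mass of e^{-V_0}, the difference S₀ - S₁ is the entropy of F under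
  -- ν_0, and Q is the integral of (∇F)²_{Ċ_0}/(2F).
  have key := entropy_sub_le_of_convex
    (S := flowEntropy dC (fun x => Real.exp (-V₀ x)) fun x => Real.exp (-V₀ x) * F x)
    (I := flowFisher dC (fun x => Real.exp (-V₀ x)) fun x => Real.exp (-V₀ x) * F x)
    (Q := ∫ φ, Real.exp (-V₀ φ) / (2 * F φ) *
        traceForm (frame dC) (dC 0) ((fderiv ℝ F φ).smulRight (fderiv ℝ F φ))
          ∂gaussian dC (covInf dC - cov dC 0))
    (S₀ := ∫ φ, Real.exp (-V₀ φ) * F φ * Real.log (F φ) ∂gaussian dC (covInf dC - cov dC 0))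
    (fun t ht => hasDerivAt_flowEntropy hC hV₀ hM2 hcrit hdlam hG hε hG0 hGM ht)
    (fun t ht => hasDerivAt_clock hdlam hlam hint ht)
    (fun s t h0 hst => by
      have := flowFisher_le hC hV₀ hM2 hcrit hdlam hG hε hG0 hGM h0 hst
      rwa [intervalIntegral.integral_const_mul, ← primitive_sub hdlam hlam h0.le hst] at this)
    (tendsto_clock_div hdlam hlam hint)
    (intervalIntegral_tendsto_integral_Ioi 0 hint tendsto_id)
    (fun t ht => H.entropy_le hZ hFc (fun x => Real.exp_pos _) hM2 hε hFε hFM ht.le)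
    (tendsto_flowEntropy hV₀ hM2 hcont hF hε hFε hFM)
    (fun δ hδ => H.entropy_slope hZ hF3 hs (fun x => Real.exp_pos _) hM2 hε hFε hFM
      (fun η hη => eventually_abs_cov_sub_le hC hη) hδ)
    (integral_nonneg fun t => (Real.exp_pos _).le)
  have hpos : 0 < ∫ ζ, Real.exp (-V₀ ζ) ∂gaussian dC (covInf dC) := by
    have := avg_pos (f := fun x => Real.exp (-V₀ x)) (by fun_prop) (fun _ => Real.exp_pos _) hM
      (gaussian dC (covInf dC)) 0
    simpa [avg] using this
  rw [cov_zero, sub_zero] at key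
  rw [entropy, integral_initialMeasure V₀ (fun x => F x * Real.log (F x)),
    integral_initialMeasure V₀ (fun φ => quadForm (dC 0) ((gradient F φ : fieldSpace dC) : Vec N) / (2 * F φ))]
  have e1 : ∫ φ, Real.exp (-V₀ φ) * (F φ * Real.log (F φ)) ∂gaussian dC (covInf dC) =
      ∫ φ, Real.exp (-V₀ φ) * F φ * Real.log (F φ) ∂gaussian dC (covInf dC) := by
    simp only [mul_assoc]
  have e2 : ∫ φ, Real.exp (-V₀ φ) * (quadForm (dC 0) ((gradient F φ : fieldSpace dC) : Vec N) / (2 * F φ))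
      ∂gaussian dC (covInf dC) = ∫ φ, Real.exp (-V₀ φ) / (2 * F φ) *
        traceForm (frame dC) (dC 0) ((fderiv ℝ F φ).smulRight (fderiv ℝ F φ))
          ∂gaussian dC (covInf dC) := by
    refine integral_congr_ae (Eventually.of_forall fun φ => ?_)
    simp only [quadForm_gradient]
    ring
  rw [e1, e2]
  have := mul_le_mul_of_nonneg_left key (inv_nonneg.2 hpos.le)
  rw [mul_sub, inv_mul_cancel_left₀ hpos.ne'] at this
  linarith

/-- The log-Sobolev inequality under the multiscale criterion. -/
theorem entropy_le {V₀ : fieldSpace dC → ℝ} (hV₀ : Continuous V₀) {M : ℝ}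
    (hM : ∀ x, Real.exp (-V₀ x) ≤ M) (hcont : ContinuityAssumption dC V₀) {dlam lam : ℝ → ℝ}
    (hdlam : ∀ t, 0 ≤ t → IntervalIntegrable dlam volume 0 t)
    (hcrit : MultiscaleCriterion dC V₀ dlam)
    (hlam : ∀ t, 0 ≤ t → lam t = ∫ s in (0 : ℝ)..t, dlam s)
    (hint : IntegrableOn (fun t => Real.exp (-2 * lam t)) (Ioi 0))
    {F : fieldSpace dC → ℝ} (hF : ContDiff ℝ ∞ F) (hs : HasCompactSupport F)
    (h0 : ∀ x, 0 ≤ F x) :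
    entropy (initialMeasure dC V₀) F ≤ 2 * (∫ t in Ioi (0 : ℝ), Real.exp (-2 * lam t)) *
      ∫ φ, quadForm (dC 0) ((gradient (fun ψ => √(F ψ)) φ : fieldSpace dC) : Vec N) ∂initialMeasure dC V₀ := by
  have := isProbabilityMeasure_initialMeasure hV₀ hM
  obtain ⟨B, hB⟩ := hs.exists_bound_of_continuous hF.continuous
  obtain ⟨K, hK⟩ := exists_quadForm_gradient_sqrt_le (dC 0) hF hs h0
  have hdiff : Differentiable ℝ F := hF.differentiable (by simp)
  -- The function F + ε is bounded away from zero and has the same compactly supported gradient as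
  -- F; the bound obtained for it does not depend on ε.
  refine le_of_tendsto (tendsto_entropy_add_const _ hF.continuous.aestronglyMeasurable hB) ?_
  filter_upwards [self_mem_nhdsWithin] with ε (hε : 0 < ε)
  obtain ⟨c, hc⟩ := exists_bddC3_add_const hF hs ε
  have hd : fderiv ℝ (fun x => F x + ε) = fderiv ℝ F := by
    funext x
    rw [fderiv_add_const]
  have hgr : ∀ φ, gradient (fun x => F x + ε) φ = gradient F φ := fun φ => by
    rw [gradient, hd, gradient]
  have h1 := entropy_le_of_pos hC hV₀ hM hcont hdlam hcrit hlam hint (F := fun x => F x + ε)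
    (hF.add contDiff_const) hc (by rw [hd]; exact hs.fderiv ℝ) hε
    (fun x => le_add_of_nonneg_left (h0 x))
  refine h1.trans ?_
  rw [mul_comm 2, mul_assoc, ← integral_const_mul (2 : ℝ)]
  have hL : 0 ≤ ∫ t in Ioi (0 : ℝ), Real.exp (-2 * lam t) :=
    integral_nonneg fun t => (Real.exp_pos _).le
  refine mul_le_mul_of_nonneg_left ?_ hL
  refine integral_mono_of_nonneg (Eventually.of_forall fun φ => ?_)
    ((Integrable.of_bound (measurable_quadForm_gradient _ _).aestronglyMeasurable K
      (Eventually.of_forall hK)).const_mul 2) (Eventually.of_forall fun φ => ?_)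
  · have := h0 φ
    exact div_nonneg (quadForm_nonneg (hC.posSemidef 0 le_rfl) _) (by positivity)
  · simp only [hgr]
    have hq := quadForm_nonneg (hC.posSemidef 0 le_rfl) ((gradient (fun ψ => √(F ψ)) φ : fieldSpace dC) : Vec N)
    -- Since (∇F)² = 4F(∇√F)², division by 2(F + ε) leaves at most 2(∇√F)².
    rw [quadForm_gradient_eq _ hdiff h0, div_le_iff₀ (by linarith [h0 φ])]
    nlinarith [h0 φ, mul_nonneg hε.le hq]

end Criterion

end Polchinski

end

/-! ### The multiscale Bakry–Émery theorem -/

theorem theorem3p5 {N : ℕ} (dC : ℝ → Polchinski.Mat N)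
    (hC : Polchinski.IsDifferentiableCovDecomposition dC)
    (V₀ : Polchinski.fieldSpace dC → ℝ) (hV₀ : Continuous V₀) (hbdd : BddBelow (Set.range V₀))
    (hcont : Polchinski.ContinuityAssumption dC V₀)
    (dlam lam : ℝ → ℝ) (hdlam : ∀ t, 0 ≤ t → IntervalIntegrable dlam MeasureTheory.volume 0 t)
    (hcrit : Polchinski.MultiscaleCriterion dC V₀ dlam)
    (hlam : ∀ t, 0 ≤ t → lam t = ∫ s in (0 : ℝ)..t, dlam s)
    (γ : ℝ)
    (hint : MeasureTheory.IntegrableOn (fun t => Real.exp (-2 * lam t)) (Set.Ioi 0))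
    (hγ : 1 / γ = ∫ t in Set.Ioi (0 : ℝ), Real.exp (-2 * lam t)) :
    Polchinski.LogSobolev (Polchinski.initialMeasure dC V₀) (dC 0) γ := by
  obtain ⟨b, hb⟩ := hbdd
  have hM : ∀ x, Real.exp (-V₀ x) ≤ Real.exp (-b) := fun x =>
    Real.exp_le_exp.2 (neg_le_neg (hb (mem_range_self x)))
  have hpos : 0 < ∫ t in Ioi (0 : ℝ), Real.exp (-2 * lam t) := by
    rw [integral_pos_iff_support_of_nonneg (fun t => (Real.exp_pos _).le) hint]
    have : Function.support (fun t => Real.exp (-2 * lam t)) = univ :=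
      Function.support_eq_univ fun t => (Real.exp_pos _).ne'
    rw [this]
    simp
  refine ⟨one_div_pos.1 (hγ ▸ hpos), fun F hF hs h0 => ?_⟩
  have h := Polchinski.entropy_le hC hV₀ hM hcont hdlam hcrit hlam hint hF hs h0
  rwa [← hγ, mul_one_div] at h
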